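/- Let $X$ be a smooth, connected, complete (i.e. compact) algebraic curve over $\mathbb{C}$, with field of meromorphic (rational) functions $\mathbb{C}(X)$, and let $\omega$ be a nonzero meromorphic (rational) differential on $X$. For a (closed) point $x\in X$ let $k_x$ be the local field at $x$, i.e. the completion of $\mathbb{C}(X)$ at $x$, let $\mathcal{O}_x\subset k_x$ be the completed local ring, and for $f\in k_x$ let $\operatorname{res}_x(f\omega)\in\mathbb{C}$ be the residue. For a complex vector space $V$ with a symmetric bilinear form, call a subspace $L\subset V$ Lagrangian if it is isotropic, is maximal (for inclusion) among isotropic subspaces, and equals its own orthogonal $L^{\perp}$. (a) Let $S$ be a finite set of points of $X$ containing all zeros and poles of $\omega$. Let $k=\bigoplus_{s\in S}k_s$, with the bilinear form $\langle f,g\rangle_k=\sum_{s\in S}\operatorname{res}_s(f_sg_s\omega)$, and let $R\subset\mathbb{C}(X)$ be the ring of meromorphic functions on $X$ that are regular outside $S$. Then $R$ (more precisely, its image in $k$ under expansion at the points of $S$) is a Lagrangian, that is maximal isotropic, subspace of $k$. (b) Let $\mathbb{A}$ be the ring of adeles of $X$, i.e. the ring of families $(f_x)_{x\in X}\in\prod_{x\in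 X}k_x$ with $f_x\in\mathcal{O}_x$ for all but finitely many $x$, with the bilinear form $\langle f,g\rangle_{\mathbb{A}}=\sum_{x\in X}\operatorname{res}_x(f_xg_x\omega)$ (only finitely many terms are nonzero). Then $\mathbb{C}(X)$, embedded diagonally, is a Lagrangian, that is maximal isotropic, subspace of $\mathbb{A}$. -/

import Mathlib

open CategoryTheory AlgebraicGeometry
open scoped KaehlerDifferential

noncomputable section

namespace ResiduePairing

/-- The base scheme `Spec ℂ`. -/
abbrev SpecC : Scheme.{0} := Spec (CommRingCat.of ℂ)

/-- A smooth, connected, complete (that is, compact) complex curve: a connected scheme which is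
proper and smooth of relative dimension one over `ℂ`. -/
class IsSmoothCompleteCurve (X : Scheme.{0}) [X.Over SpecC] : Prop where
  connected : ConnectedSpace X
  isProper : IsProper (X ↘ SpecC)
  isSmooth : SmoothOfRelativeDimension 1 (X ↘ SpecC)

attribute [instance] IsSmoothCompleteCurve.connected IsSmoothCompleteCurve.isProper
  IsSmoothCompleteCurve.isSmooth

section Curve
variable (X : Scheme.{0}) [X.Over SpecC]

/-- Local rings of a complex scheme are `ℂ`-algebras, through `Spec 𝒪_x ⟶ X ⟶ Spec ℂ`. The stalk at
the generic point is the field `X.functionField` of meromorphic (rational) functions on `X`, so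
this covers the function field as well. -/
instance stalkAlgebra (x : X) : Algebra ℂ (X.presheaf.stalk x) :=
  RingHom.toAlgebra (Spec.preimage (X.fromSpecStalk x ≫ (X ↘ SpecC))).hom

theorem spec_map_stalkAlgebra (x : X) :
    Spec.map (CommRingCat.ofHom (algebraMap ℂ (X.presheaf.stalk x))) =
      X.fromSpecStalk x ≫ (X ↘ SpecC) :=
  Spec.map_preimage (X.fromSpecStalk x ≫ (X ↘ SpecC))

theorem stalkSpecializes_comp_algebraMap {x y : X} (h : x ⤳ y) :
    (X.presheaf.stalkSpecializes h).hom.comp (algebraMap ℂ (X.presheaf.stalk y)) =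
      algebraMap ℂ (X.presheaf.stalk x) := by
  have : CommRingCat.ofHom (algebraMap ℂ (X.presheaf.stalk y)) ≫ X.presheaf.stalkSpecializes h =
      CommRingCat.ofHom (algebraMap ℂ (X.presheaf.stalk x)) := by
    apply Spec.map_injective
    rw [Spec.map_comp, spec_map_stalkAlgebra, spec_map_stalkAlgebra,
      Scheme.SpecMap_stalkSpecializes_fromSpecStalk_assoc]
  exact congrArg CommRingCat.Hom.hom this

instance functionField_isScalarTower [IsIntegral X] (x : X) :
    IsScalarTower ℂ (X.presheaf.stalk x) X.functionField :=
  .of_algebraMap_eq' (stalkSpecializes_comp_algebraMap X _).symm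

variable [IsSmoothCompleteCurve X]

instance : IsLocallyNoetherian X := LocallyOfFiniteType.isLocallyNoetherian (X ↘ SpecC)

instance : CompactSpace X := by
  exact (quasiCompact_iff_compactSpace (f := X ↘ SpecC)).mp inferInstance

theorem exists_standardSmooth_chart (x : X) :
    ∃ (V : X.Opens) (_ : IsAffineOpen V) (hx : x ∈ V) (φ : ℂ →+* Γ(X, V)),
      φ.IsStandardSmoothOfRelativeDimension 1 ∧
      (X.presheaf.germ V x hx).hom.comp φ = algebraMap ℂ (X.presheaf.stalk x) := by
  obtain ⟨U, hU, V, hV, hx, e, h⟩ :=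
    SmoothOfRelativeDimension.exists_isStandardSmoothOfRelativeDimension (n := 1)
      (f := X ↘ SpecC) x
  obtain rfl : U = ⊤ := by
    ext y
    have : y = (X ↘ SpecC) x := Subsingleton.elim (α := PrimeSpectrum ℂ) _ _
    simpa [this] using e hx
  refine ⟨V, hV, hx, ((X ↘ SpecC).appLE ⊤ V e).hom.comp
    ((Scheme.ΓSpecIso (.of ℂ)).commRingCatIsoToRingEquiv.symm : ℂ →+* _), ?_, ?_⟩
  · exact RingHom.IsStandardSmoothOfRelativeDimension.comp (n := 1) (m := 0) h (.equiv _)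
  · have : (Scheme.ΓSpecIso (.of ℂ)).inv ≫ (X ↘ SpecC).appLE ⊤ V e ≫ X.presheaf.germ V x hx =
        CommRingCat.ofHom (algebraMap ℂ (X.presheaf.stalk x)) := by
      apply Spec.map_injective
      rw [spec_map_stalkAlgebra, ← hV.fromSpecStalk_eq_fromSpecStalk hx,
        IsAffineOpen.fromSpecStalk, Category.assoc, ← IsAffineOpen.SpecMap_appLE_fromSpec _ (isAffineOpen_top _) hV e]
      simp [Spec.map_comp, IsAffineOpen.fromSpec_top, Scheme.isoSpec_Spec_inv]
    exact congrArg CommRingCat.Hom.hom this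

theorem bijective_residue (x : X) (hx : IsClosed {x}) :
    Function.Bijective (algebraMap ℂ (IsLocalRing.ResidueField (X.presheaf.stalk x))) := by
  have h : (residueFieldIsoBase (X ↘ SpecC) x hx).inv =
      CommRingCat.ofHom (algebraMap ℂ (X.presheaf.stalk x)) ≫ X.residue x := by
    apply Spec.map_injective
    rw [SpecMap_residueFieldIsoBase_inv, Spec.map_comp, spec_map_stalkAlgebra]
    rfl
  have h2 : Function.Bijective (residueFieldIsoBase (X ↘ SpecC) x hx).inv.hom :=
    ConcreteCategory.bijective_of_isIso (residueFieldIsoBase (X ↘ SpecC) x hx).inv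
  rw [h] at h2
  exact h2

theorem kaehler_stalk (x : X) : Module.Free (X.presheaf.stalk x) Ω[X.presheaf.stalk x⁄ℂ] ∧
    Module.finrank (X.presheaf.stalk x) Ω[X.presheaf.stalk x⁄ℂ] = 1 ∧
    Algebra.FormallySmooth ℂ (X.presheaf.stalk x) := by
  obtain ⟨V, hV, hx, φ, hφ, h⟩ := exists_standardSmooth_chart X x
  algebraize [φ]
  let : Algebra Γ(X, V) (X.presheaf.stalk x) := (X.presheaf.germ V x hx).hom.toAlgebra
  have : IsScalarTower ℂ Γ(X, V) (X.presheaf.stalk x) := .of_algebraMap_eq' h.symm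
  have := hV.isLocalization_stalk ⟨x, hx⟩
  have : Algebra.FormallyEtale Γ(X, V) (X.presheaf.stalk x) :=
    .of_isLocalization (hV.primeIdealOf ⟨x, hx⟩).asIdeal.primeCompl
  let e := KaehlerDifferential.tensorKaehlerEquivOfFormallyEtale ℂ Γ(X, V) (X.presheaf.stalk x)
  have : Algebra.IsStandardSmooth ℂ Γ(X, V) :=
    Algebra.IsStandardSmoothOfRelativeDimension.isStandardSmooth 1
  have : Nontrivial Γ(X, V) := (algebraMap Γ(X, V) (X.presheaf.stalk x)).domain_nontrivial
  refine ⟨.of_equiv e, ?_, ?_⟩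
  · rw [← e.finrank_eq, Module.finrank_baseChange, Module.finrank,
      Algebra.IsStandardSmoothOfRelativeDimension.rank_kaehlerDifferential 1]
    simp
  · exact Algebra.FormallySmooth.comp ℂ Γ(X, V) (X.presheaf.stalk x)

theorem stalk_maximalIdeal_isPrincipal (x : X) (hx : IsClosed {x}) :
    (IsLocalRing.maximalIdeal (X.presheaf.stalk x)).IsPrincipal := by
  obtain ⟨h1, h2, h3⟩ := kaehler_stalk X x
  have hb := bijective_residue X x hx
  set A := X.presheaf.stalk x
  let κ := IsLocalRing.ResidueField A
  have hfin : Module.Finite A Ω[A⁄ℂ] := Module.finite_of_finrank_pos (h2 ▸ Nat.one_pos)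
  have hs : Function.Surjective (algebraMap A κ) := IsLocalRing.residue_surjective
  have hκ : Algebra.FormallySmooth ℂ κ :=
    .of_equiv (AlgEquiv.ofBijective (Algebra.ofId ℂ κ) hb)
  obtain ⟨l, hl⟩ := (Algebra.FormallySmooth.iff_split_injection (R := ℂ) hs).mp hκ
  have hker : RingHom.ker (algebraMap A κ) = IsLocalRing.maximalIdeal A := IsLocalRing.ker_residue
  have hφ : ∃ φ : (IsLocalRing.maximalIdeal A).Cotangent →ₗ[A] TensorProduct A κ Ω[A⁄ℂ],
      Function.Injective φ := by
    rw [← hker]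
    exact ⟨_, Function.LeftInverse.injective (LinearMap.congr_fun hl)⟩
  obtain ⟨φ, hφ⟩ := hφ
  let ψ : IsLocalRing.CotangentSpace A →ₗ[κ] TensorProduct A κ Ω[A⁄ℂ] :=
    LinearMap.extendScalarsOfSurjective hs φ
  have hle := LinearMap.finrank_le_finrank_of_injective (f := ψ) hφ
  rwa [Module.finrank_baseChange, h2, IsLocalRing.finrank_cotangentSpace_le_one_iff] at hle

theorem exists_sub_algebraMap_mem (x : X) (hx : IsClosed {x}) (a : X.presheaf.stalk x) :
    ∃ c : ℂ, a - algebraMap ℂ _ c ∈ IsLocalRing.maximalIdeal (X.presheaf.stalk x) := by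
  obtain ⟨c, hc⟩ := (bijective_residue X x hx).2 (algebraMap _ _ a)
  refine ⟨c, ?_⟩
  rw [← IsLocalRing.residue_eq_zero_iff, map_sub, sub_eq_zero]
  exact hc.symm

open KaehlerDifferential in
theorem span_D_parameter (x : X) (hx : IsClosed {x}) : ∀ t : X.presheaf.stalk x,
    IsLocalRing.maximalIdeal (X.presheaf.stalk x) = Ideal.span {t} →
      Submodule.span (X.presheaf.stalk x) {D ℂ (X.presheaf.stalk x) t} = ⊤ := by
  obtain ⟨h1, h2, -⟩ := kaehler_stalk X x
  have hb := exists_sub_algebraMap_mem X x hx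
  set A := X.presheaf.stalk x
  intro t ht
  have hfin : Module.Finite A Ω[A⁄ℂ] := Module.finite_of_finrank_pos (h2 ▸ Nat.one_pos)
  refine top_le_iff.mp (Submodule.le_of_le_smul_of_le_jacobson_bot (I := IsLocalRing.maximalIdeal A)
    hfin.fg_top (IsLocalRing.maximalIdeal_le_jacobson ⊥) ?_)
  rw [← KaehlerDifferential.span_range_derivation, Submodule.span_le]
  rintro _ ⟨a, rfl⟩
  obtain ⟨c, hm⟩ := hb a
  rw [ht, Ideal.mem_span_singleton'] at hm
  obtain ⟨b, hb⟩ := hm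
  have hD : D ℂ A a = b • D ℂ A t + t • D ℂ A b := by
    rw [← Derivation.leibniz, hb, map_sub, Derivation.map_algebraMap, sub_zero]
  rw [hD]
  refine Submodule.add_mem_sup (Submodule.smul_mem _ _ (Submodule.mem_span_singleton_self _)) ?_
  refine Submodule.smul_mem_smul ?_ ?_
  · rw [ht]; exact Ideal.mem_span_singleton_self t
  · rw [span_range_derivation]; trivial

open KaehlerDifferential in
theorem stalk_parameter (x : X) (hx : IsClosed {x}) : ∀ t : X.presheaf.stalk x,
    IsLocalRing.maximalIdeal (X.presheaf.stalk x) = Ideal.span {t} → ¬ IsNilpotent t := by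
  obtain ⟨h1, h2, -⟩ := kaehler_stalk X x
  have hsp := span_D_parameter X x hx
  set A := X.presheaf.stalk x
  intro t ht
  have hspan := hsp t ht
  have hfin : Module.Finite A Ω[A⁄ℂ] := Module.finite_of_finrank_pos (h2 ▸ Nat.one_pos)
  let e : Ω[A⁄ℂ] ≃ₗ[A] A := LinearEquiv.ofFinrankEq _ _ (by rw [h2, Module.finrank_self])
  have hinj : Function.Injective (e.toLinearMap ∘ₗ LinearMap.toSpanSingleton A _ (D ℂ A t)) := by
    refine OrzechProperty.injective_of_surjective_endomorphism _ ?_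
    refine e.surjective.comp ?_
    rwa [← LinearMap.range_eq_top, LinearMap.range_toSpanSingleton]
  intro hnil
  have hn := pow_nilpotencyClass hnil
  have hpos := pos_nilpotencyClass_iff.mpr hnil
  obtain ⟨n, hn'⟩ := Nat.exists_eq_succ_of_ne_zero hpos.ne'
  have h0 : D ℂ A (t ^ (n + 1)) = 0 := by rw [← Nat.succ_eq_add_one, ← hn', hn, map_zero]
  rw [Derivation.leibniz_pow, Nat.add_sub_cancel, ← Nat.cast_smul_eq_nsmul A, smul_smul] at h0
  have h3 : ((n + 1 : ℕ) : A) * t ^ n = 0 := hinj (by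
    rw [map_zero, LinearMap.comp_apply, LinearMap.toSpanSingleton_apply, h0, map_zero])
  have hu : IsUnit ((n + 1 : ℕ) : A) := by
    have : IsUnit (algebraMap ℂ A ((n + 1 : ℕ) : ℂ)) :=
      (IsUnit.mk0 _ (Nat.cast_ne_zero.mpr n.succ_ne_zero)).map _
    rwa [map_natCast] at this
  rw [hu.mul_right_eq_zero] at h3
  refine pow_pred_nilpotencyClass hnil ?_
  rwa [hn', Nat.succ_eq_add_one, Nat.add_sub_cancel]

theorem stalk_isDomain (x : X) (hx : IsClosed {x}) : IsDomain (X.presheaf.stalk x) := by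
  have hpr := stalk_maximalIdeal_isPrincipal X x hx
  have hpar := stalk_parameter X x hx
  set A := X.presheaf.stalk x
  obtain ⟨t, ht⟩ := hpr.principal
  have hnil := hpar t ht
  have key (a : A) (ha : a ≠ 0) : ∃ u n, IsUnit u ∧ a = t ^ n * u := by
    have hinf := Ideal.iInf_pow_eq_bot_of_isLocalRing (IsLocalRing.maximalIdeal A)
      (Ideal.IsPrime.ne_top inferInstance)
    have hex : ∃ n, a ∉ IsLocalRing.maximalIdeal A ^ n := by
      by_contra! h
      exact ha (by rw [← Ideal.mem_bot, ← hinf]; exact Ideal.mem_iInf.mpr h)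
    classical
    have hsp := Nat.find_spec hex
    have hne : Nat.find hex ≠ 0 := by
      intro h
      rw [h] at hsp
      simp at hsp
    obtain ⟨n, hn⟩ := Nat.exists_eq_succ_of_ne_zero hne
    have hmem : a ∈ IsLocalRing.maximalIdeal A ^ n := by
      by_contra h
      exact absurd (Nat.find_min' hex h) (by omega)
    rw [ht, Ideal.submodule_span_eq, Ideal.span_singleton_pow, Ideal.mem_span_singleton] at hmem
    obtain ⟨u, hu⟩ := hmem
    refine ⟨u, n, ?_, hu⟩
    by_contra hun
    have hum : u ∈ IsLocalRing.maximalIdeal A := hun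
    rw [ht, Ideal.submodule_span_eq, Ideal.mem_span_singleton] at hum
    obtain ⟨w, rfl⟩ := hum
    apply hsp
    rw [hn, ht, Ideal.submodule_span_eq, Ideal.span_singleton_pow, Ideal.mem_span_singleton]
    exact ⟨w, by rw [hu, Nat.succ_eq_add_one]; ring⟩
  have : NoZeroDivisors A := ⟨by
    intro a b hab
    by_contra! h
    obtain ⟨u, m, hu, rfl⟩ := key a h.1
    obtain ⟨v, n, hv, rfl⟩ := key b h.2
    have : t ^ (m + n) * (u * v) = 0 := by rw [← hab]; ring
    rw [(hu.mul hv).mul_left_eq_zero] at this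
    exact hnil ⟨_, this⟩⟩
  exact NoZeroDivisors.to_isDomain A

theorem exists_specializes_isClosed {Z : Set X} (hZ : IsClosed Z) (hne : Z.Nonempty) :
    ∃ y ∈ Z, IsClosed {y} := hZ.exists_closed_singleton hne

theorem stalk_isReduced (x : X) : IsReduced (X.presheaf.stalk x) := by
  obtain ⟨y, hxy, hy⟩ := exists_specializes_isClosed X (isClosed_closure (s := {x}))
    ⟨x, subset_closure rfl⟩
  have hs : x ⤳ y := specializes_iff_mem_closure.mpr hxy
  have hdom := stalk_isDomain X y hy
  obtain ⟨_, ⟨V, hV, rfl⟩, hyV, -⟩ :=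
    X.isBasis_affineOpens.exists_subset_of_mem_open (Set.mem_univ y) isOpen_univ
  have hxV : x ∈ V := hs.mem_open V.2 hyV
  let gx := (X.presheaf.germ V x hxV).hom
  let gy := (X.presheaf.germ V y hyV).hom
  have hcomp (a : Γ(X, V)) : (X.presheaf.stalkSpecializes hs).hom (gy a) = gx a :=
    X.presheaf.germ_stalkSpecializes_apply hyV hs a
  let := gx.toAlgebra
  let := gy.toAlgebra
  have hlx := hV.isLocalization_stalk ⟨x, hxV⟩
  have hly := hV.isLocalization_stalk ⟨y, hyV⟩
  refine ⟨fun a ⟨n, hn⟩ ↦ ?_⟩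
  obtain ⟨⟨g, h⟩, hgh⟩ := IsLocalization.surj
    (hV.primeIdealOf ⟨x, hxV⟩).asIdeal.primeCompl a
  have hh : IsUnit (gx h.1) := IsLocalization.map_units (X.presheaf.stalk x) h
  have hg : gx (g ^ n) = gx 0 := by
    rw [map_pow, map_zero, show gx g = a * gx h.1 from hgh.symm, mul_pow, hn, zero_mul]
  obtain ⟨u, hu⟩ := (IsLocalization.eq_iff_exists
    (hV.primeIdealOf ⟨x, hxV⟩).asIdeal.primeCompl (X.presheaf.stalk x)).mp hg
  have hux : IsUnit (gx u.1) := IsLocalization.map_units (X.presheaf.stalk x) u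
  have huy : gy u.1 ≠ 0 := by
    intro h0
    rw [← hcomp, h0, map_zero] at hux
    exact not_isUnit_zero hux
  have hgy : gy u.1 * gy g ^ n = 0 := by
    rw [← map_pow, ← map_mul, hu, mul_zero, map_zero]
  have hg0 : gy g = 0 := eq_zero_of_pow_eq_zero ((mul_eq_zero.mp hgy).resolve_left huy)
  have hgx0 : gx g = 0 := by rw [← hcomp, hg0, map_zero]
  have : a * gx h.1 = 0 := hgh.trans hgx0
  exact hh.mul_left_eq_zero.mp this

theorem irreducible_subset (Z₁ Z₂ : Set X) (h₁ : Z₁ ∈ irreducibleComponents X)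
    (h₂ : Z₂ ∈ irreducibleComponents X) (h : (Z₁ ∩ Z₂).Nonempty) : Z₁ = Z₂ := by
  have hc₁ := isClosed_of_mem_irreducibleComponents Z₁ h₁
  have hc₂ := isClosed_of_mem_irreducibleComponents Z₂ h₂
  obtain ⟨x, hx, hxc⟩ := exists_specializes_isClosed X (hc₁.inter hc₂) h
  have hdom := stalk_isDomain X x hxc
  let η := X.fromSpecStalk x (⟨⊥, Ideal.isPrime_bot⟩ : PrimeSpectrum (X.presheaf.stalk x))
  have main (Z : Set X) (hZ : Z ∈ irreducibleComponents X) (hxZ : x ∈ Z) : Z = closure {η} := by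
    obtain ⟨z, hz⟩ := QuasiSober.sober hZ.1 (isClosed_of_mem_irreducibleComponents Z hZ)
    have hzr : z ∈ Set.range (X.fromSpecStalk x) := by
      rw [Scheme.range_fromSpecStalk]
      exact hz.specializes hxZ
    obtain ⟨p, rfl⟩ := hzr
    have hp := ((PrimeSpectrum.le_iff_specializes ⟨⊥, Ideal.isPrime_bot⟩ p).mp
      (show ⊥ ≤ p.asIdeal from bot_le)).map (X.fromSpecStalk x).continuous
    have hle : Z ⊆ closure {η} := by
      rw [← hz.def]
      exact specializes_iff_closure_subset.mp hp
    exact hle.antisymm (hZ.2 isIrreducible_singleton.closure hle)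
  rw [main Z₁ h₁ hx.1, main Z₂ h₂ hx.2]

instance : IrreducibleSpace X := by
  have : IsNoetherian X := {}
  have hfin := TopologicalSpace.NoetherianSpace.finite_irreducibleComponents (α := X)
  obtain ⟨x⟩ : Nonempty X := inferInstance
  set Z := irreducibleComponent x
  have hZ : Z ∈ irreducibleComponents X := irreducibleComponent_mem_irreducibleComponents x
  have hcompl : Zᶜ = ⋃₀ (irreducibleComponents X \ {Z}) := by
    ext y
    constructor
    · intro hy
      refine ⟨irreducibleComponent y, ⟨irreducibleComponent_mem_irreducibleComponents y, ?_⟩,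
        mem_irreducibleComponent⟩
      rintro (h : _ = Z)
      exact hy (h ▸ mem_irreducibleComponent)
    · rintro ⟨W, ⟨hW, hne⟩, hyW⟩ hyZ
      exact hne (irreducible_subset X W Z hW hZ ⟨y, hyW, hyZ⟩)
  have hclopen : IsClopen Z := by
    refine ⟨isClosed_irreducibleComponent, ?_⟩
    rw [← isClosed_compl_iff, hcompl]
    rw [Set.sUnion_eq_biUnion]
    exact (hfin.subset Set.sdiff_subset).isClosed_biUnion
      fun W hW ↦ isClosed_of_mem_irreducibleComponents W hW.1
  have huniv : Z = Set.univ := hclopen.eq_univ ⟨x, mem_irreducibleComponent⟩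
  have hirr : IsIrreducible (Set.univ : Set X) := huniv ▸ isIrreducible_irreducibleComponent
  exact { isPreirreducible_univ := hirr.2, toNonempty := ⟨x⟩ }

instance : IsIntegral X := by
  have := stalk_isReduced X
  have : AlgebraicGeometry.IsReduced X := isReduced_of_isReduced_stalk X
  exact isIntegral_of_irreducibleSpace_of_isReduced X

theorem stalk_isDiscreteValuationRing (x : X) (hx : IsClosed {x}) :
    IsDiscreteValuationRing (X.presheaf.stalk x) := by
  obtain ⟨t, ht⟩ := (stalk_maximalIdeal_isPrincipal X x hx).principal
  have hnil := stalk_parameter X x hx t ht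
  have hnf : ¬ IsField (X.presheaf.stalk x) := by
    rw [IsLocalRing.isField_iff_maximalIdeal_eq, ht, Ideal.submodule_span_eq,
      Ideal.span_singleton_eq_bot]
    rintro rfl
    exact hnil IsNilpotent.zero
  exact ((IsDiscreteValuationRing.TFAE _ hnf).out 0 4).mpr
    (stalk_maximalIdeal_isPrincipal X x hx)

theorem finite_closedPoints_compl (U : X.Opens) (hU : (U : Set X).Nonempty) :
    {x : X | IsClosed {x} ∧ x ∉ U}.Finite := by
  have : IsNoetherian X := {}
  obtain ⟨T, hT, hcl, hirr, hsup⟩ := TopologicalSpace.NoetherianSpace.exists_finite_set_isClosed_irreducible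
    (U.isOpen.isClosed_compl)
  refine (hT.preimage (f := fun x : X ↦ ({x} : Set X)) (Set.singleton_injective.injOn)).subset ?_
  rintro x ⟨hx, hxU⟩
  have hx' : x ∈ (U : Set X)ᶜ := hxU
  rw [hsup] at hx'
  obtain ⟨Z, hZT, hxZ⟩ := hx'
  obtain ⟨z, hz⟩ := QuasiSober.sober (hirr Z hZT) (hcl Z hZT)
  have hzU : z ∉ U := by
    have : z ∈ (U : Set X)ᶜ := hsup ▸ ⟨Z, hZT, hz.mem⟩
    exact this
  have hzr : z ∈ Set.range (X.fromSpecStalk x) := by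
    rw [Scheme.range_fromSpecStalk]
    exact hz.specializes hxZ
  have hηr : genericPoint X ∈ Set.range (X.fromSpecStalk x) := by
    rw [Scheme.range_fromSpecStalk]
    exact genericPoint_specializes x
  obtain ⟨p, rfl⟩ := hzr
  obtain ⟨q, hq⟩ := hηr
  have := stalk_isDiscreteValuationRing X x hx
  by_cases hp : p.asIdeal = ⊥
  · have hpq : p ⤳ q := (PrimeSpectrum.le_iff_specializes p q).mp
      (show p.asIdeal ≤ q.asIdeal from hp ▸ bot_le)
    have h1 := hpq.map (X.fromSpecStalk x).continuous
    rw [hq] at h1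
    exact absurd (h1.mem_open U.isOpen ((genericPoint_spec X).mem_open_set_iff U.isOpen |>.mpr
      (by simpa using hU))) hzU
  · have hpm : p = IsLocalRing.closedPoint (X.presheaf.stalk x) :=
      PrimeSpectrum.ext (IsLocalRing.eq_maximalIdeal (p.isPrime.isMaximal hp))
    rw [hpm, Scheme.fromSpecStalk_closedPoint] at hz
    have hZ : Z = {x} := by rw [← hz.def, hx.closure_eq]
    change {x} ∈ T
    rwa [← hZ]

/-- A rational function is regular at all but finitely many points. -/
theorem finite_not_regular (f : X.functionField) :
    {x : X | IsClosed {x} ∧ f ∉ (algebraMap (X.presheaf.stalk x) X.functionField).range}.Finite := by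
  obtain ⟨U, hU, g, hg⟩ := X.presheaf.exists_germ_eq f
  refine (finite_closedPoints_compl X U ⟨_, hU⟩).subset ?_
  rintro x ⟨hx, hf⟩
  refine ⟨hx, fun hxU ↦ hf ⟨X.presheaf.germ U x hxU g, ?_⟩⟩
  have : Nonempty U := ⟨⟨_, hU⟩⟩
  rw [Scheme.algebraMap_germ_eq_germToFunctionField]
  exact hg

/-- The points of the curve, in the classical sense: the closed points of the scheme. -/
abbrev Point : Type := {x : X // IsClosed {x}}

instance (x : Point X) : IsDiscreteValuationRing (X.presheaf.stalk x.1) :=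
  stalk_isDiscreteValuationRing X x.1 x.2

/-- The local field `k_x` at a point `x`: the completion of the function field with respect to the
valuation of the discrete valuation ring `𝒪_x`. -/
abbrev LocalField (x : Point X) : Type :=
  (IsDiscreteValuationRing.maximalIdeal (X.presheaf.stalk x.1)).adicCompletion X.functionField

/-- The ring of integers of `k_x`, which is the completed local ring at `x`. -/
def localIntegers (x : Point X) : Subalgebra ℂ (LocalField X x) where
  toSubsemiring := ((IsDiscreteValuationRing.maximalIdeal (X.presheaf.stalk x.1)).adicCompletionIntegers X.functionField).toSubring.toSubsemiring
  algebraMap_mem' c := by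
    rw [IsScalarTower.algebraMap_apply ℂ (X.presheaf.stalk x.1) (LocalField X x)]
    exact IsDedekindDomain.HeightOneSpectrum.coe_algebraMap_mem _ _ _ _

open Filter in
theorem eventually_mem_localIntegers (f : X.functionField) :
    ∀ᶠ x in cofinite, algebraMap X.functionField (LocalField X x) f ∈ localIntegers X x := by
  have h := (finite_not_regular X f).preimage (f := fun x : Point X ↦ x.1)
    Subtype.val_injective.injOn
  refine h.subset fun x hx ↦ ⟨x.2, ?_⟩
  rintro ⟨a, rfl⟩
  refine hx ?_
  change algebraMap X.functionField (LocalField X x)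
    (algebraMap (X.presheaf.stalk x.1) X.functionField a) ∈ localIntegers X x
  rw [← IsScalarTower.algebraMap_apply (X.presheaf.stalk x.1) X.functionField]
  exact IsDedekindDomain.HeightOneSpectrum.coe_algebraMap_mem _ _ _ _

/-- The ring of adeles of `X`: families of elements of the local fields, integral at almost all
points. -/
abbrev Adele : Type :=
  RestrictedProduct (fun x : Point X ↦ LocalField X x)
    (fun x ↦ (localIntegers X x : Set (LocalField X x))) Filter.cofinite

/-- The diagonal embedding of the field of functions on `X` in the adeles. -/
def diagonal : X.functionField →ₗ[ℂ] Adele X where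
  toFun f := ⟨fun x ↦ algebraMap X.functionField (LocalField X x) f,
    eventually_mem_localIntegers X f⟩
  map_add' f g := RestrictedProduct.ext _ _ fun x ↦ map_add (algebraMap X.functionField (LocalField X x)) f g
  map_smul' c f := RestrictedProduct.ext _ _ fun x ↦
    (IsScalarTower.toAlgHom ℂ X.functionField (LocalField X x)).toLinearMap.map_smul c f

/-- The ring of functions on `X` which are regular outside `S`. -/
def regularOutside (S : Finset (Point X)) : Subalgebra ℂ X.functionField where
  carrier := {f | ∀ x ∉ S, f ∈ (algebraMap (X.presheaf.stalk x.1) X.functionField).range}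
  mul_mem' hf hg x hx := mul_mem (hf x hx) (hg x hx)
  add_mem' hf hg x hx := add_mem (hf x hx) (hg x hx)
  algebraMap_mem' c x _ := ⟨algebraMap ℂ _ c,
    (IsScalarTower.algebraMap_apply ℂ (X.presheaf.stalk x.1) X.functionField c).symm⟩

/-- The ring `k`, direct sum of the local fields at the points of the finite set `S`. -/
abbrev LocalProduct (S : Finset (Point X)) : Type := ∀ s : S, LocalField X s.1

/-- Expansion of a function on `X` at all the points of `S`. -/
def toLocalProduct (S : Finset (Point X)) : X.functionField →ₐ[ℂ] LocalProduct X S :=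
  AlgHom.pi fun s ↦ IsScalarTower.toAlgHom ℂ X.functionField (LocalField X s.1)

open KaehlerDifferential

/-- The differential of a regular germ at `x`, as a meromorphic differential on `X`. -/
def differential (x : Point X) (t : X.presheaf.stalk x.1) : Ω[X.functionField⁄ℂ] :=
  D ℂ X.functionField (algebraMap (X.presheaf.stalk x.1) X.functionField t)

theorem exists_differential_eq (x : Point X) {t : X.presheaf.stalk x.1} (ht : Irreducible t)
    (a : X.presheaf.stalk x.1) :
    ∃ b : X.presheaf.stalk x.1, differential X x a =
      algebraMap (X.presheaf.stalk x.1) X.functionField b • differential X x t := by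
  have h := span_D_parameter X x.1 x.2 t ht.maximalIdeal_eq
  have ha : D ℂ (X.presheaf.stalk x.1) a ∈
      Submodule.span (X.presheaf.stalk x.1) {D ℂ (X.presheaf.stalk x.1) t} := h ▸ trivial
  obtain ⟨b, hb⟩ := Submodule.mem_span_singleton.mp ha
  refine ⟨b, ?_⟩
  have := congrArg (KaehlerDifferential.map ℂ ℂ (X.presheaf.stalk x.1) X.functionField) hb
  rw [map_smul, map_D, map_D, ← algebraMap_smul X.functionField] at this
  exact this.symm

theorem span_differential (x : Point X) {t : X.presheaf.stalk x.1} (ht : Irreducible t) :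
    Submodule.span X.functionField {differential X x t} = ⊤ := by
  rw [← top_le_iff, ← span_range_derivation, Submodule.span_le]
  rintro _ ⟨f, rfl⟩
  obtain ⟨a, b, hb, rfl⟩ := IsFractionRing.div_surjective (X.presheaf.stalk x.1) f
  obtain ⟨a', ha⟩ := exists_differential_eq X x ht a
  obtain ⟨b', hb'⟩ := exists_differential_eq X x ht b
  have hmem (r : X.functionField) : r • differential X x t ∈
      Submodule.span X.functionField {differential X x t} :=
    Submodule.smul_mem _ _ (Submodule.mem_span_singleton_self _)
  change D ℂ X.functionField _ ∈ _
  rw [Derivation.leibniz_div]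
  change _ • (_ • differential X x a - _ • differential X x b) ∈ _
  rw [ha, hb']
  exact Submodule.smul_mem _ _ (sub_mem (Submodule.smul_mem _ _ (hmem _))
    (Submodule.smul_mem _ _ (hmem _)))

theorem differential_ne_zero (x : Point X) {t : X.presheaf.stalk x.1} (ht : Irreducible t) :
    differential X x t ≠ 0 := by
  intro h
  have h1 := span_differential X x ht
  rw [h, Submodule.span_zero_singleton] at h1
  have h2 : Module.finrank X.functionField Ω[X.functionField⁄ℂ] = 1 :=
    (kaehler_stalk X (genericPoint X)).2.1
  have := (Submodule.subsingleton_iff X.functionField).mp (subsingleton_of_bot_eq_top h1)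
  rw [Module.finrank_zero_of_subsingleton] at h2
  exact zero_ne_one h2

theorem exists_eq_smul_differential (x : Point X) {t : X.presheaf.stalk x.1} (ht : Irreducible t)
    (ω : Ω[X.functionField⁄ℂ]) : ∃ h : X.functionField, ω = h • differential X x t := by
  have : ω ∈ Submodule.span X.functionField {differential X x t} :=
    span_differential X x ht ▸ trivial
  obtain ⟨h, hh⟩ := Submodule.mem_span_singleton.mp this
  exact ⟨h, hh.symm⟩

theorem le_exp_neg_one {y : WithZero (Multiplicative ℤ)} (hy : y < 1) :
    y ≤ WithZero.exp (-1 : ℤ) := by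
  by_cases h0 : y = 0
  · rw [h0]; exact zero_le
  · rw [← WithZero.exp_zero, ← WithZero.log_lt_iff_lt_exp h0] at hy
    exact (WithZero.log_le_iff_le_exp h0).mp (by omega)

/-- The finite Laurent sum `∑ a n • t ^ n`. -/
def laurentSum {L : Type*} [Field L] [Algebra ℂ L] (t : L) : (ℤ →₀ ℂ) →ₗ[ℂ] L :=
  Finsupp.linearCombination ℂ fun n : ℤ ↦ t ^ n

theorem map_laurentSum {L M : Type*} [Field L] [Algebra ℂ L] [Field M] [Algebra ℂ M]
    (φ : L →ₐ[ℂ] M) (t : L) (a : ℤ →₀ ℂ) : φ (laurentSum t a) = laurentSum (φ t) a := by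
  simp [laurentSum, Finsupp.linearCombination_apply, Finsupp.sum, map_sum, map_smul, map_zpow₀]

theorem mem_localIntegers_iff (x : Point X) (y : LocalField X x) :
    y ∈ localIntegers X x ↔ Valued.v y ≤ 1 := Iff.rfl

theorem valued_functionField (x : Point X) (g : X.functionField) :
    Valued.v (algebraMap X.functionField (LocalField X x) g) =
      (IsDiscreteValuationRing.maximalIdeal (X.presheaf.stalk x.1)).valuation X.functionField g :=
  IsDedekindDomain.HeightOneSpectrum.valuedAdicCompletion_eq_valuation' _ g

theorem algebraMap_mem_localIntegers_iff (x : Point X) (g : X.functionField) :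
    algebraMap X.functionField (LocalField X x) g ∈ localIntegers X x ↔
      g ∈ (algebraMap (X.presheaf.stalk x.1) X.functionField).range := by
  rw [mem_localIntegers_iff, valued_functionField]
  refine ⟨fun h ↦ IsDiscreteValuationRing.exists_lift_of_le_one h, ?_⟩
  rintro ⟨a, rfl⟩
  exact IsDedekindDomain.HeightOneSpectrum.valuation_le_one _ a

theorem valued_lt_one_iff (x : Point X) (a : X.presheaf.stalk x.1) :
    Valued.v (algebraMap (X.presheaf.stalk x.1) (LocalField X x) a) < 1 ↔
      a ∈ IsLocalRing.maximalIdeal (X.presheaf.stalk x.1) := by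
  rw [IsScalarTower.algebraMap_apply (X.presheaf.stalk x.1) X.functionField (LocalField X x),
    valued_functionField, IsDedekindDomain.HeightOneSpectrum.valuation_of_algebraMap]
  exact IsDedekindDomain.HeightOneSpectrum.intValuation_lt_one_iff_mem _ a

theorem valued_complex (x : Point X) {c : ℂ} (hc : c ≠ 0) :
    Valued.v (algebraMap ℂ (LocalField X x) c) = 1 := by
  have h (d : ℂ) : Valued.v (algebraMap ℂ (LocalField X x) d) ≤ 1 :=
    (mem_localIntegers_iff X x _).mp (algebraMap_mem _ d)
  refine le_antisymm (h c) ?_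
  have h2 := h c⁻¹
  rw [map_inv₀, map_inv₀] at h2
  have h0 : Valued.v (algebraMap ℂ (LocalField X x) c) ≠ 0 := by
    rw [Valuation.ne_zero_iff]
    exact (map_ne_zero _).mpr hc
  exact (inv_le_one₀ (zero_lt_iff.mpr h0)).mp h2

theorem valued_parameter (x : Point X) {t : X.presheaf.stalk x.1} (ht : Irreducible t) :
    Valued.v (algebraMap (X.presheaf.stalk x.1) (LocalField X x) t) =
      WithZero.exp (-1 : ℤ) := by
  rw [IsScalarTower.algebraMap_apply (X.presheaf.stalk x.1) X.functionField (LocalField X x),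
    valued_functionField, IsDedekindDomain.HeightOneSpectrum.valuation_of_algebraMap]
  exact IsDedekindDomain.HeightOneSpectrum.intValuation_singleton _ ht.ne_zero ht.maximalIdeal_eq

theorem coeff_eq_zero_of_mem_localIntegers (x : Point X) {t : X.presheaf.stalk x.1}
    (ht : Irreducible t) (a : ℤ →₀ ℂ)
    (h : laurentSum (algebraMap (X.presheaf.stalk x.1) (LocalField X x) t) a ∈ localIntegers X x)
    (n : ℤ) (hn : n < 0) : a n = 0 := by
  by_contra hne
  have hv := valued_parameter X x ht
  set τ := algebraMap (X.presheaf.stalk x.1) (LocalField X x) t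
  have hterm (m : ℤ) (hm : a m ≠ 0) : Valued.v (a m • τ ^ m) = WithZero.exp (-m) := by
    rw [Algebra.smul_def, map_mul, valued_complex X x hm, one_mul, map_zpow₀, hv,
      ← WithZero.exp_zsmul]
    simp
  have hmem : n ∈ a.support := Finsupp.mem_support_iff.mpr hne
  set m := a.support.min' ⟨n, hmem⟩
  have hm : m ∈ a.support := Finset.min'_mem _ _
  have hmn : m ≤ n := Finset.min'_le _ _ hmem
  have hsum : laurentSum τ a = a m • τ ^ m + ∑ i ∈ a.support.erase m, a i • τ ^ i := by
    rw [Finset.add_sum_erase _ (fun i ↦ a i • τ ^ i) hm]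
    rfl
  have hlt : Valued.v (∑ i ∈ a.support.erase m, a i • τ ^ i) < Valued.v (a m • τ ^ m) := by
    rw [hterm m (Finsupp.mem_support_iff.mp hm)]
    refine Valuation.map_sum_lt _ WithZero.exp_ne_zero fun i hi ↦ ?_
    rw [Finset.mem_erase] at hi
    rw [hterm i (Finsupp.mem_support_iff.mp hi.2), WithZero.exp_lt_exp, neg_lt_neg_iff]
    exact lt_of_le_of_ne (Finset.min'_le _ _ hi.2) (Ne.symm hi.1)
  rw [mem_localIntegers_iff, hsum, Valuation.map_add_eq_of_lt_left _ hlt,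
    hterm m (Finsupp.mem_support_iff.mp hm), ← WithZero.exp_zero, WithZero.exp_le_exp] at h
  omega

theorem exists_complex_valued_sub_lt (x : Point X) (u : LocalField X x)
    (hu : u ∈ localIntegers X x) :
    ∃ c : ℂ, Valued.v (u - algebraMap ℂ (LocalField X x) c) < 1 := by
  obtain ⟨g, hg⟩ : ∃ g : X.functionField,
      Valued.v (u - algebraMap X.functionField (LocalField X x) g) < 1 := by
    have hd := IsDedekindDomain.HeightOneSpectrum.denseRange_algebraMap (K := X.functionField)
      (IsDiscreteValuationRing.maximalIdeal (X.presheaf.stalk x.1))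
    have ho : IsOpen {z : LocalField X x | Valued.v (u - z) < 1} := by
      have h1 := (Valued.isOpen_ball (LocalField X x) 1).preimage
        (continuous_const.sub continuous_id : Continuous fun z ↦ u - z)
      convert! h1 using 1
      ext z
      exact (Valuation.restrict_lt_one_iff (v := (Valued.v : Valuation (LocalField X x) _))).symm
    exact hd.exists_mem_open ho ⟨u, by simp⟩
  have hgm : algebraMap X.functionField (LocalField X x) g ∈ localIntegers X x := by
    have := sub_mem hu ((mem_localIntegers_iff X x _).mpr hg.le)
    rwa [sub_sub_cancel] at this
  obtain ⟨a, rfl⟩ := (algebraMap_mem_localIntegers_iff X x g).mp hgm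
  obtain ⟨c, hc⟩ := exists_sub_algebraMap_mem X x.1 x.2 a
  refine ⟨c, ?_⟩
  have h2 := (valued_lt_one_iff X x _).mpr hc
  rw [map_sub, ← IsScalarTower.algebraMap_apply] at h2
  rw [← IsScalarTower.algebraMap_apply] at hg
  have := Valuation.map_add_lt _ hg h2
  rwa [sub_add_sub_cancel] at this

theorem exists_laurentSum (x : Point X) {t : X.presheaf.stalk x.1}
    (ht : Irreducible t) (f : LocalField X x) : ∃ a : ℤ →₀ ℂ,
    f - laurentSum (algebraMap (X.presheaf.stalk x.1) (LocalField X x) t) a ∈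
      localIntegers X x := by
  have hv := valued_parameter X x ht
  set τ := algebraMap (X.presheaf.stalk x.1) (LocalField X x) t
  have hτ : τ ≠ 0 := by
    intro h
    rw [h, map_zero] at hv
    exact WithZero.exp_ne_zero hv.symm
  have key (N : ℕ) : ∀ f : LocalField X x, f * τ ^ N ∈ localIntegers X x →
      ∃ a : ℤ →₀ ℂ, f - laurentSum τ a ∈ localIntegers X x := by
    induction N with
    | zero => exact fun f hf ↦ ⟨0, by simpa using hf⟩
    | succ N ih =>
      intro f hf
      obtain ⟨c, hc⟩ := exists_complex_valued_sub_lt X x _ hf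
      obtain ⟨a, ha⟩ := ih (f - c • τ ^ (-(N + 1 : ℕ) : ℤ)) (by
        have h1 : (f - c • τ ^ (-(N + 1 : ℕ) : ℤ)) * τ ^ N =
            (f * τ ^ (N + 1) - algebraMap ℂ (LocalField X x) c) * τ⁻¹ := by
          rw [zpow_neg, zpow_natCast, Algebra.smul_def]
          field_simp
          ring
        rw [h1, mem_localIntegers_iff, map_mul, map_inv₀, hv, ← WithZero.exp_neg, neg_neg]
        have hc' := le_exp_neg_one hc
        calc _ ≤ WithZero.exp (-1 : ℤ) * WithZero.exp (1 : ℤ) := by gcongr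
          _ = 1 := by rw [← WithZero.exp_add]; simp)
      refine ⟨Finsupp.single (-(N + 1 : ℕ) : ℤ) c + a, ?_⟩
      have h2 : laurentSum τ (Finsupp.single (-(N + 1 : ℕ) : ℤ) c) = c • τ ^ (-(N + 1 : ℕ) : ℤ) := by
        simp [laurentSum]
      rw [map_add, h2, ← sub_sub]
      exact ha
  obtain ⟨N, hN⟩ : ∃ N : ℕ, Valued.v f ≤ WithZero.exp (N : ℤ) :=
    ⟨(WithZero.log (Valued.v f)).toNat, WithZero.le_exp_of_log_le (Int.self_le_toNat _)⟩
  refine key N f ?_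
  rw [mem_localIntegers_iff, map_mul, map_pow, hv, ← WithZero.exp_nsmul]
  calc _ ≤ WithZero.exp (N : ℤ) * WithZero.exp (N • (-1 : ℤ)) := by gcongr
    _ = 1 := by rw [← WithZero.exp_add]; simp

theorem exists_laurentSum_functionField (x : Point X) {t : X.presheaf.stalk x.1}
    (ht : Irreducible t) (g : X.functionField) : ∃ (b : ℤ →₀ ℂ) (p : X.presheaf.stalk x.1),
    g = laurentSum (algebraMap (X.presheaf.stalk x.1) X.functionField t) b +
      algebraMap (X.presheaf.stalk x.1) X.functionField p := by
  obtain ⟨b, hb⟩ := exists_laurentSum X x ht (algebraMap X.functionField (LocalField X x) g)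
  have h := map_laurentSum (IsScalarTower.toAlgHom ℂ X.functionField (LocalField X x))
    (algebraMap (X.presheaf.stalk x.1) X.functionField t) b
  simp only [IsScalarTower.coe_toAlgHom', ← IsScalarTower.algebraMap_apply] at h
  rw [← h, ← map_sub, algebraMap_mem_localIntegers_iff] at hb
  obtain ⟨p, hp⟩ := hb
  exact ⟨b, p, by rw [hp]; ring⟩

theorem coeff_eq_zero_of_mem_stalk (x : Point X) {t : X.presheaf.stalk x.1}
    (ht : Irreducible t) (a : ℤ →₀ ℂ)
    (h : laurentSum (algebraMap (X.presheaf.stalk x.1) X.functionField t) a ∈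
      (algebraMap (X.presheaf.stalk x.1) X.functionField).range)
    (n : ℤ) (hn : n < 0) : a n = 0 := by
  refine coeff_eq_zero_of_mem_localIntegers X x ht a ?_ n hn
  rw [← algebraMap_mem_localIntegers_iff] at h
  have h2 := map_laurentSum (IsScalarTower.toAlgHom ℂ X.functionField (LocalField X x))
    (algebraMap (X.presheaf.stalk x.1) X.functionField t) a
  simp only [IsScalarTower.coe_toAlgHom', ← IsScalarTower.algebraMap_apply] at h2
  rwa [← h2]

section
variable {L : Type*} [Field L] [Algebra ℂ L]

theorem laurentSum_single (t : L) (n : ℤ) (c : ℂ) :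
    laurentSum t (Finsupp.single n c) = c • t ^ n := by simp [laurentSum]

theorem D_zpow (t : L) (n : ℤ) :
    D ℂ L (t ^ n) = ((n : ℂ) • t ^ (n - 1)) • D ℂ L t := by
  rw [Derivation.leibniz_zpow, ← smul_assoc, Int.cast_smul_eq_zsmul]

theorem exists_D_laurentSum (t : L) (b : ℤ →₀ ℂ) : ∃ b' : ℤ →₀ ℂ, b' (-1) = 0 ∧
    D ℂ L (laurentSum t b) = laurentSum t b' • D ℂ L t := by
  induction b using Finsupp.induction_linear with
  | zero => exact ⟨0, rfl, by simp⟩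
  | add f g hf hg =>
    obtain ⟨f', hf0, hf⟩ := hf
    obtain ⟨g', hg0, hg⟩ := hg
    exact ⟨f' + g', by simp [hf0, hg0], by rw [map_add, map_add, map_add, hf, hg, add_smul]⟩
  | single n c =>
    refine ⟨Finsupp.single (n - 1) (c * n), ?_, ?_⟩
    · by_cases hn : n = 0
      · simp [hn]
      · exact Finsupp.single_eq_of_ne (by omega)
    · rw [laurentSum_single, laurentSum_single, Derivation.map_smul, D_zpow t, ← smul_assoc,
        smul_smul]

theorem exists_antiderivative (t : L) (a : ℤ →₀ ℂ) : ∃ g : L,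
    laurentSum t a • D ℂ L t = D ℂ L g + (a (-1) • t⁻¹) • D ℂ L t := by
  induction a using Finsupp.induction_linear with
  | zero => exact ⟨0, by simp⟩
  | add f g hf hg =>
    obtain ⟨u, hu⟩ := hf
    obtain ⟨w, hw⟩ := hg
    refine ⟨u + w, ?_⟩
    rw [map_add, add_smul, hu, hw, map_add, Finsupp.add_apply, add_smul, add_smul]
    abel
  | single n c =>
    by_cases hn : n = -1
    · subst hn
      exact ⟨0, by rw [laurentSum_single]; simp⟩
    · have hn' : ((n + 1 : ℤ) : ℂ) ≠ 0 := by
        rw [Int.cast_ne_zero]; omega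
      refine ⟨(c / ((n + 1 : ℤ) : ℂ)) • t ^ (n + 1), ?_⟩
      rw [laurentSum_single, Derivation.map_smul, D_zpow t, ← smul_assoc, smul_smul,
        div_mul_cancel₀ _ hn', Finsupp.single_eq_of_ne (by omega), add_sub_cancel_right]
      simp
end

theorem residue_unique_aux (x : Point X) {t t' : X.presheaf.stalk x.1} (ht : Irreducible t)
    (ht' : Irreducible t') (a a' : ℤ →₀ ℂ) (r : X.presheaf.stalk x.1)
    (h : laurentSum (algebraMap (X.presheaf.stalk x.1) X.functionField t) a • differential X x t -
      laurentSum (algebraMap (X.presheaf.stalk x.1) X.functionField t') a' • differential X x t' =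
      algebraMap (X.presheaf.stalk x.1) X.functionField r • differential X x t') :
    a (-1) = a' (-1) := by
  set ι := algebraMap (X.presheaf.stalk x.1) X.functionField
  have hι : Function.Injective ι := IsFractionRing.injective _ _
  have ht0 : ι t ≠ 0 := by rw [map_ne_zero_iff _ hι]; exact ht.ne_zero
  have ht0' : ι t' ≠ 0 := by rw [map_ne_zero_iff _ hι]; exact ht'.ne_zero
  obtain ⟨g, hg⟩ := exists_antiderivative (ι t) a
  obtain ⟨g', hg'⟩ := exists_antiderivative (ι t') a'
  obtain ⟨u, hu⟩ := IsDiscreteValuationRing.associated_of_irreducible _ ht' ht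
  have hu0 : ι u ≠ 0 := (u.isUnit.map ι).ne_zero
  obtain ⟨s, hs⟩ := exists_differential_eq X x ht' (u : X.presheaf.stalk x.1)
  obtain ⟨b, p, hG⟩ := exists_laurentSum_functionField X x ht' (g - g')
  obtain ⟨q, hq⟩ := exists_differential_eq X x ht' p
  obtain ⟨b', hb0, hb⟩ := exists_D_laurentSum (ι t') b
  have hdt : differential X x t = ι u • differential X x t' + ι t' • differential X x u := by
    change D ℂ _ (ι t) = ι u • D ℂ _ (ι t') + ι t' • D ℂ _ (ι u)
    rw [← hu, map_mul, Derivation.leibniz, add_comm]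
  change laurentSum (ι t) a • differential X x t = D ℂ _ g + _ • differential X x t at hg
  change laurentSum (ι t') a' • differential X x t' = D ℂ _ g' + _ • differential X x t' at hg'
  have hDg : D ℂ _ g - D ℂ _ g' = (laurentSum (ι t') b' + ι q) • differential X x t' := by
    rw [← map_sub, hG, map_add, hb, add_smul]
    exact congrArg _ hq
  have hut : ι t = ι t' * ι u := by rw [← hu, map_mul]
  have main : (laurentSum (ι t') (b' + Finsupp.single (-1) (a (-1) - a' (-1))) -
      (ι r - ι q - a (-1) • (ι ((u⁻¹ : (X.presheaf.stalk x.1)ˣ) : X.presheaf.stalk x.1) * ι s))) • differential X x t' = 0 := by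
    have hui : ι ((u⁻¹ : (X.presheaf.stalk x.1)ˣ) : X.presheaf.stalk x.1) = (ι u)⁻¹ := by
      exact eq_inv_of_mul_eq_one_left (by rw [← map_mul, Units.inv_mul, map_one])
    have hsum : (laurentSum (ι t') b' + ι q) • differential X x t' +
        (a (-1) • (ι t)⁻¹) • (ι u • differential X x t' + ι t' • ι s • differential X x t') -
        (a' (-1) • (ι t')⁻¹) • differential X x t' - ι r • differential X x t' = 0 := by
      rw [← hDg, ← hs, ← hdt, ← h, hg, hg']
      abel
    rw [← hsum, map_add, laurentSum_single, hui, hut]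
    simp only [← smul_assoc, ← add_smul, ← sub_smul]
    congr 1
    simp only [Algebra.smul_def, Algebra.algebraMap_self, RingHom.id_apply, map_sub, zpow_neg_one]
    field_simp
    ring
  have h0 := (smul_eq_zero.mp main).resolve_right (differential_ne_zero X x ht')
  have h1 := coeff_eq_zero_of_mem_stalk X x ht' (b' + Finsupp.single (-1) (a (-1) - a' (-1)))
    (by
      rw [sub_eq_zero.mp h0]
      refine sub_mem (sub_mem ⟨_, rfl⟩ ⟨_, rfl⟩) ?_
      rw [Algebra.smul_def, IsScalarTower.algebraMap_apply ℂ (X.presheaf.stalk x.1) X.functionField]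
      exact mul_mem ⟨_, rfl⟩ (mul_mem ⟨_, rfl⟩ ⟨_, rfl⟩)) (-1) (by omega)
  simpa [hb0, sub_eq_zero] using h1

/-- `c` is the residue at `x` of `f ω`, where `f` belongs to the local field at `x`: for a local
parameter `t` at `x`, writing `ω = h dt` with `h` a rational function, `f h` is the sum of
`∑ a n • t ^ n` and of a formal power series in `t`, and `c` is the coefficient of `t ^ (-1)`. -/
def IsResidue (x : Point X) (ω : Ω[X.functionField⁄ℂ]) (f : LocalField X x) (c : ℂ) : Prop :=
  ∃ (t : X.presheaf.stalk x.1) (h : X.functionField) (a : ℤ →₀ ℂ), Irreducible t ∧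
    ω = h • D ℂ X.functionField (algebraMap (X.presheaf.stalk x.1) X.functionField t) ∧
    f * algebraMap X.functionField (LocalField X x) h -
      laurentSum (algebraMap (X.presheaf.stalk x.1) (LocalField X x) t) a ∈ localIntegers X x ∧
    c = a (-1)

theorem existsUnique_isResidue (x : Point X) (ω : Ω[X.functionField⁄ℂ]) (f : LocalField X x) :
    ∃! c, IsResidue X x ω f c := by
  obtain ⟨t, ht⟩ := IsDiscreteValuationRing.exists_irreducible (X.presheaf.stalk x.1)
  obtain ⟨h, hh⟩ := exists_eq_smul_differential X x ht ω
  obtain ⟨a, ha⟩ := exists_laurentSum X x ht (f * algebraMap X.functionField (LocalField X x) h)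
  refine ⟨a (-1), ⟨t, h, a, ht, hh, ha, rfl⟩, ?_⟩
  rintro _ ⟨t', h', a', ht', hh', ha', rfl⟩
  obtain ⟨w, hw⟩ := exists_differential_eq X x ht t'
  have hw' : h = h' * algebraMap (X.presheaf.stalk x.1) X.functionField w := by
    have h1 : (h - h' * algebraMap (X.presheaf.stalk x.1) X.functionField w) •
        differential X x t = 0 := by
      rw [sub_smul, mul_smul, ← hw, ← hh]
      exact sub_eq_zero.mpr hh'
    exact sub_eq_zero.mp ((smul_eq_zero.mp h1).resolve_right (differential_ne_zero X x ht))
  set ι := algebraMap (X.presheaf.stalk x.1) X.functionField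
  set φ := algebraMap X.functionField (LocalField X x)
  have hφ (u : X.presheaf.stalk x.1) (b : ℤ →₀ ℂ) :
      laurentSum (algebraMap (X.presheaf.stalk x.1) (LocalField X x) u) b =
        φ (laurentSum (ι u) b) := by
    have h2 := map_laurentSum (IsScalarTower.toAlgHom ℂ X.functionField (LocalField X x)) (ι u) b
    simp only [IsScalarTower.coe_toAlgHom', ι, ← IsScalarTower.algebraMap_apply] at h2
    exact h2.symm
  rw [hφ] at ha ha'
  have hφw : φ (ι w) ∈ localIntegers X x :=
    (algebraMap_mem_localIntegers_iff X x _).mpr ⟨w, rfl⟩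
  have h3 := sub_mem ha (mul_mem ha' hφw)
  have h4 : f * φ h - φ (laurentSum (ι t) a) - (f * φ h' - φ (laurentSum (ι t') a')) * φ (ι w) =
      φ (laurentSum (ι t') a' * ι w - laurentSum (ι t) a) := by
    rw [hw', map_sub, map_mul, map_mul]
    ring
  rw [h4, algebraMap_mem_localIntegers_iff] at h3
  obtain ⟨r, hr⟩ := h3
  refine residue_unique_aux X x ht' ht a' a r ?_
  rw [hw, hr, sub_smul, mul_smul]

theorem isResidue_add (x : Point X) (ω : Ω[X.functionField⁄ℂ]) {f g : LocalField X x} {c d : ℂ}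
    (hf : IsResidue X x ω f c) (hg : IsResidue X x ω g d) : IsResidue X x ω (f + g) (c + d) := by
  obtain ⟨t, ht⟩ := IsDiscreteValuationRing.exists_irreducible (X.presheaf.stalk x.1)
  obtain ⟨h, hh⟩ := exists_eq_smul_differential X x ht ω
  obtain ⟨a, ha⟩ := exists_laurentSum X x ht (f * algebraMap X.functionField (LocalField X x) h)
  obtain ⟨b, hb⟩ := exists_laurentSum X x ht (g * algebraMap X.functionField (LocalField X x) h)
  rw [(existsUnique_isResidue X x ω f).unique hf ⟨t, h, a, ht, hh, ha, rfl⟩,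
    (existsUnique_isResidue X x ω g).unique hg ⟨t, h, b, ht, hh, hb, rfl⟩]
  refine ⟨t, h, a + b, ht, hh, ?_, by simp⟩
  rw [add_mul, map_add, add_sub_add_comm]
  exact add_mem ha hb

theorem isResidue_smul (x : Point X) (ω : Ω[X.functionField⁄ℂ]) (r : ℂ) {f : LocalField X x}
    {c : ℂ} (hf : IsResidue X x ω f c) : IsResidue X x ω (r • f) (r * c) := by
  obtain ⟨t, h, a, ht, hh, ha, rfl⟩ := hf
  refine ⟨t, h, r • a, ht, hh, ?_, by simp⟩
  rw [smul_mul_assoc, map_smul, ← smul_sub]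
  exact Subalgebra.smul_mem _ ha r

theorem isResidue_choose (x : Point X) (ω : Ω[X.functionField⁄ℂ]) (f : LocalField X x) :
    IsResidue X x ω f (existsUnique_isResidue X x ω f).choose :=
  (existsUnique_isResidue X x ω f).choose_spec.1

/-- The residue at `x` of `f ω`, as a linear form in `f`. -/
def residue (x : Point X) (ω : Ω[X.functionField⁄ℂ]) : LocalField X x →ₗ[ℂ] ℂ where
  toFun f := (existsUnique_isResidue X x ω f).choose
  map_add' f g := (existsUnique_isResidue X x ω (f + g)).unique (isResidue_choose X x ω _)
    (isResidue_add X x ω (isResidue_choose X x ω f) (isResidue_choose X x ω g))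
  map_smul' r f := (existsUnique_isResidue X x ω (r • f)).unique (isResidue_choose X x ω _)
    (isResidue_smul X x ω r (isResidue_choose X x ω f))

theorem residue_eq_iff (x : Point X) (ω : Ω[X.functionField⁄ℂ]) (f : LocalField X x) (c : ℂ) :
    residue X x ω f = c ↔ IsResidue X x ω f c :=
  ⟨fun h ↦ h ▸ isResidue_choose X x ω f,
    fun h ↦ (existsUnique_isResidue X x ω f).unique (isResidue_choose X x ω f) h⟩

theorem eventually_regular (ω : Ω[X.functionField⁄ℂ]) : ∀ᶠ x : Point X in Filter.cofinite,
    ∀ t : X.presheaf.stalk x.1, Irreducible t → ∃ a : X.presheaf.stalk x.1,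
      ω = algebraMap (X.presheaf.stalk x.1) X.functionField a • differential X x t := by
  have hω : ω ∈ Submodule.span X.functionField (Set.range (D ℂ X.functionField)) :=
    span_range_derivation ℂ X.functionField ▸ trivial
  induction hω using Submodule.span_induction with
  | mem y hy =>
    obtain ⟨g, rfl⟩ := hy
    filter_upwards [eventually_mem_localIntegers X g] with x hx t ht
    obtain ⟨a, rfl⟩ := (algebraMap_mem_localIntegers_iff X x g).mp hx
    exact exists_differential_eq X x ht a
  | zero => exact .of_forall fun x t _ ↦ ⟨0, by simp⟩
  | add y z _ _ hy hz =>
    filter_upwards [hy, hz] with x hy hz t ht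
    obtain ⟨a, ha⟩ := hy t ht
    obtain ⟨b, hb⟩ := hz t ht
    exact ⟨a + b, by rw [map_add, add_smul, ← ha, ← hb]⟩
  | smul h y _ hy =>
    filter_upwards [hy, eventually_mem_localIntegers X h] with x hy hx t ht
    obtain ⟨a, ha⟩ := hy t ht
    obtain ⟨b, hb⟩ := (algebraMap_mem_localIntegers_iff X x h).mp hx
    exact ⟨b * a, by rw [map_mul, mul_smul, ← ha, hb]⟩

theorem finite_support_residue (ω : Ω[X.functionField⁄ℂ]) (f g : Adele X) :
    (Function.support fun x ↦ residue X x ω (f x * g x)).Finite := by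
  have h : ∀ᶠ x in Filter.cofinite, residue X x ω (f x * g x) = 0 := by
    filter_upwards [eventually_regular X ω, f.eventually, g.eventually] with x hω hf hg
    obtain ⟨t, ht⟩ := IsDiscreteValuationRing.exists_irreducible (X.presheaf.stalk x.1)
    obtain ⟨a, ha⟩ := hω t ht
    rw [residue_eq_iff]
    refine ⟨t, _, 0, ht, ha, ?_, rfl⟩
    rw [map_zero, sub_zero]
    exact mul_mem (mul_mem hf hg) ((algebraMap_mem_localIntegers_iff X x _).mpr ⟨a, rfl⟩)
  exact h

/-- The bilinear form `⟨f, g⟩ = ∑ s ∈ S, res_s (f g ω)` on `k`. -/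
def localPairing (ω : Ω[X.functionField⁄ℂ]) (S : Finset (Point X)) :
    LinearMap.BilinForm ℂ (LocalProduct X S) :=
  LinearMap.mk₂ ℂ (fun f g ↦ ∑ s : S, residue X s.1 ω (f s * g s))
    (fun f₁ f₂ g ↦ by simp [add_mul, Finset.sum_add_distrib])
    (fun c f g ↦ by simp [Finset.mul_sum])
    (fun f g₁ g₂ ↦ by simp [mul_add, Finset.sum_add_distrib])
    (fun c f g ↦ by simp [Finset.mul_sum])

/-- The bilinear form `⟨f, g⟩ = ∑ x, res_x (f g ω)` on the adeles; only finitely many residues are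
nonzero. -/
def adelePairing (ω : Ω[X.functionField⁄ℂ]) : LinearMap.BilinForm ℂ (Adele X) :=
  LinearMap.mk₂ ℂ (fun f g ↦ ∑ᶠ x : Point X, residue X x ω (f x * g x))
    (fun f₁ f₂ g ↦ by
      rw [← finsum_add_distrib (finite_support_residue X ω f₁ g)
        (finite_support_residue X ω f₂ g)]
      simp [add_mul])
    (fun c f g ↦ by
      rw [smul_finsum' c (finite_support_residue X ω f g)]
      simp)
    (fun f g₁ g₂ ↦ by
      rw [← finsum_add_distrib (finite_support_residue X ω f g₁)
        (finite_support_residue X ω f g₂)]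
      simp [mul_add])
    (fun c f g ↦ by
      rw [smul_finsum' c (finite_support_residue X ω f g)]
      simp)

/-- The meromorphic differential `ω` vanishes at `x`: `ω = h dt` with `t` a local parameter at `x`
and `h` in the maximal ideal of the local ring. -/
def HasZeroAt (ω : Ω[X.functionField⁄ℂ]) (x : Point X) : Prop :=
  ∃ t h : X.presheaf.stalk x.1, Irreducible t ∧
    h ∈ IsLocalRing.maximalIdeal (X.presheaf.stalk x.1) ∧
    ω = algebraMap (X.presheaf.stalk x.1) X.functionField h • differential X x t

/-- The meromorphic differential `ω` has a pole at `x`: `ω = h dt` with `t` a local parameter at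
`x` and `h` a rational function which is not regular at `x`. -/
def HasPoleAt (ω : Ω[X.functionField⁄ℂ]) (x : Point X) : Prop :=
  ∃ (t : X.presheaf.stalk x.1) (h : X.functionField), Irreducible t ∧
    h ∉ (algebraMap (X.presheaf.stalk x.1) X.functionField).range ∧
    ω = h • differential X x t

end Curve

/-- A subspace on which the bilinear form vanishes identically. -/
def IsIsotropic {V : Type*} [AddCommGroup V] [Module ℂ V] (B : LinearMap.BilinForm ℂ V)
    (L : Submodule ℂ V) : Prop :=
  ∀ u ∈ L, ∀ v ∈ L, B u v = 0

/-- A Lagrangian subspace: isotropic, maximal for inclusion among the isotropic subspaces, and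
equal to its own orthogonal. -/
structure IsLagrangian {V : Type*} [AddCommGroup V] [Module ℂ V] (B : LinearMap.BilinForm ℂ V)
    (L : Submodule ℂ V) : Prop where
  maximal : Maximal (IsIsotropic B) L
  orthogonal_eq : B.orthogonal L = L

end ResiduePairing

end

open ResiduePairing

/-! Write K for the function field. A subspace equal to its own orthogonal is Lagrangian, so (b)
says two things: K is isotropic, which is the residue theorem, and an adele orthogonal to K lies in
K, which is duality. Both are brought down to the projective line by a function t with dt ≠ 0. Then
K is finite separable over ℂ(t), of degree n say, and the points of X are grouped into the fibres of
t. Residues on the line itself never occur: they are replaced by sums of residues of X over a fibre,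
which accounts for the factors n.

The bridge is `sum_formResidue_traceTo`: over the zeros of a function u with du ≠ 0, the residues of
tr(f) du add up to n times those of f du. Modulo u the integral closure of ℂ[u] splits into one
factor for each zero x of u, of dimension the order e_x of u at x; let ε_x be the corresponding
idempotents. Up to a combination of the ε_x / u and a derivative dh/du, the function f is regular at
the zeros of u. Traces commute with d/du, they preserve regularity along the fibre, and tr(ε_x) ≡
e_x modulo u, while the sum of the e_x is n (`sum_order`).

For the residue theorem it is then enough to treat f in ℂ(t). By partial fractions only dt/(t - a)
is not exact, and its residues add up to n over a and to -n over infinity.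

For duality, let the adele a be orthogonal to K. On the line a rational function is determined by
its principal parts, constants being counted at infinity, and these can be prescribed freely. Hence
an adele orthogonal to ℂ(t) acts on ℂ(t), fibre by fibre, as a single function of t
(`exists_fibrePairing_sub_eq_zero`). Applied to ab for each b in K, this gives a ℂ(t)-linear map r
from K to ℂ(t). The trace form is nondegenerate, so n r(b) = tr(gb) for some g in K, and by the
bridge a and g have the same pairing with K on every fibre. Weak approximation and the nondegeneracy
of local residues give a = g.

Part (a) follows from (b). Let f in k be orthogonal to R. The form g ↦ ⟨f, g⟩ on K vanishes on R,
which is the kernel of the map from K to the adeles modulo those integral outside S, so it extends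
to a linear form on that quotient. Outside S this form is given by residues against integral
elements h_x, because ω is there a unit times the differential of a parameter. The adele with
components -f on S and h_x elsewhere is orthogonal to K, hence is a function; it is regular outside
S and its opposite expands to f.

The geometry enters through `exists_point_of_valuationSubring` (properness) and
`point_eq_of_integers_le` (separatedness): the points of X are the proper valuation rings of K that
contain ℂ. -/

noncomputable section

namespace ResiduePairing

variable (X : Scheme.{0}) [X.Over SpecC] [IsSmoothCompleteCurve X]

open KaehlerDifferential

/-! ### Points of the curve as valuations of the function field -/

/-- The valuation of the function field attached to a point of the curve. -/
abbrev pointValuation (x : Point X) : Valuation X.functionField (WithZero (Multiplicative ℤ)) :=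
  (IsDiscreteValuationRing.maximalIdeal (X.presheaf.stalk x.1)).valuation X.functionField

theorem pointValuation_le_one_iff (x : Point X) (g : X.functionField) :
    pointValuation X x g ≤ 1 ↔ ∃ a, algebraMap (X.presheaf.stalk x.1) X.functionField a = g := by
  rw [← valued_functionField, ← mem_localIntegers_iff, algebraMap_mem_localIntegers_iff]
  rfl

theorem pointValuation_algebraMap_le_one (x : Point X) (a : X.presheaf.stalk x.1) :
    pointValuation X x (algebraMap (X.presheaf.stalk x.1) X.functionField a) ≤ 1 :=
  (pointValuation_le_one_iff X x _).mpr ⟨a, rfl⟩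

theorem pointValuation_algebraMap_lt_one_iff (x : Point X) (a : X.presheaf.stalk x.1) :
    pointValuation X x (algebraMap (X.presheaf.stalk x.1) X.functionField a) < 1 ↔
      a ∈ IsLocalRing.maximalIdeal (X.presheaf.stalk x.1) := by
  rw [IsDedekindDomain.HeightOneSpectrum.valuation_of_algebraMap]
  exact IsDedekindDomain.HeightOneSpectrum.intValuation_lt_one_iff_mem _ a

theorem pointValuation_uniformizer (x : Point X) {t : X.presheaf.stalk x.1} (ht : Irreducible t) :
    pointValuation X x (algebraMap (X.presheaf.stalk x.1) X.functionField t) =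
      WithZero.exp (-1 : ℤ) := by
  rw [IsDedekindDomain.HeightOneSpectrum.valuation_of_algebraMap]
  exact IsDedekindDomain.HeightOneSpectrum.intValuation_singleton _ ht.ne_zero ht.maximalIdeal_eq

theorem pointValuation_complex (x : Point X) {c : ℂ} (hc : c ≠ 0) :
    pointValuation X x (algebraMap ℂ X.functionField c) = 1 := by
  rw [← valued_functionField, ← IsScalarTower.algebraMap_apply, valued_complex X x hc]

theorem pointValuation_complex_le_one (x : Point X) (c : ℂ) :
    pointValuation X x (algebraMap ℂ X.functionField c) ≤ 1 := by
  rcases eq_or_ne c 0 with rfl | hc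
  · simp
  · exact (pointValuation_complex X x hc).le

/-- Every point specialises to a closed point y, so it comes from a prime of the discrete valuation
ring at y, and such a ring has only two primes. -/
theorem isClosed_or_eq_genericPoint (x : X) : IsClosed {x} ∨ x = genericPoint X := by
  obtain ⟨y, hxy, hy⟩ := exists_specializes_isClosed X (isClosed_closure (s := {x}))
    ⟨x, subset_closure rfl⟩
  have hs : x ⤳ y := specializes_iff_mem_closure.mpr hxy
  have := stalk_isDiscreteValuationRing X y hy
  have hxr : x ∈ Set.range (X.fromSpecStalk y) := by rwa [Scheme.range_fromSpecStalk]
  have hηr : genericPoint X ∈ Set.range (X.fromSpecStalk y) := by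
    rw [Scheme.range_fromSpecStalk]
    exact genericPoint_specializes y
  obtain ⟨p, rfl⟩ := hxr
  obtain ⟨q, hq⟩ := hηr
  by_cases hp : p.asIdeal = ⊥
  · right
    have hpq : p ⤳ q := (PrimeSpectrum.le_iff_specializes p q).mp
      (show p.asIdeal ≤ q.asIdeal from hp ▸ bot_le)
    have h1 := hpq.map (X.fromSpecStalk y).continuous
    rw [hq] at h1
    exact (h1.antisymm (genericPoint_specializes _)).eq
  · left
    have hpm : p = IsLocalRing.closedPoint (X.presheaf.stalk y) :=
      PrimeSpectrum.ext (IsLocalRing.eq_maximalIdeal (p.isPrime.isMaximal hp))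
    rwa [hpm, Scheme.fromSpecStalk_closedPoint]

theorem exists_mul_pow_le_one {a b : WithZero (Multiplicative ℤ)} (ha : a < 1) :
    ∃ N : ℕ, b * a ^ N ≤ 1 := by
  obtain ⟨N, hN⟩ : ∃ N : ℕ, b ≤ WithZero.exp (N : ℤ) :=
    ⟨(WithZero.log b).toNat, WithZero.le_exp_of_log_le (Int.self_le_toNat _)⟩
  refine ⟨N, ?_⟩
  calc b * a ^ N ≤ WithZero.exp (N : ℤ) * (WithZero.exp (-1 : ℤ)) ^ N := by
        gcongr
        exact le_exp_neg_one ha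
    _ = 1 := by rw [← WithZero.exp_nsmul, ← WithZero.exp_add]; simp

/-- A discrete valuation ring is a maximal proper subring of its fraction field: if g has a pole at
x, then f g⁻ᴺ is integral for large N. -/
theorem mem_of_integers_le (x : Point X) (V : Subring X.functionField)
    (h : ∀ g, pointValuation X x g ≤ 1 → g ∈ V) {g : X.functionField}
    (hg : 1 < pointValuation X x g) (hgV : g ∈ V) (f : X.functionField) : f ∈ V := by
  have hg0 : g ≠ 0 := by
    rintro rfl
    simp at hg
  obtain ⟨N, hN⟩ := exists_mul_pow_le_one (a := pointValuation X x g⁻¹)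
    (b := pointValuation X x f) (by rw [map_inv₀]; exact inv_lt_one_of_one_lt₀ hg)
  rw [← map_pow, ← map_mul] at hN
  have h2 := V.mul_mem (h _ hN) (V.pow_mem hgV N)
  rwa [inv_pow, inv_mul_cancel_right₀ (pow_ne_zero _ hg0)] at h2

/-! ### Completeness and separatedness in terms of valuations -/

/-- The inclusion of the generic point. -/
def fromSpecFunctionField : Spec (CommRingCat.of X.functionField) ⟶ X :=
  X.fromSpecStalk (genericPoint X)

theorem fromSpecFunctionField_comp : fromSpecFunctionField X ≫ (X ↘ SpecC) =
    Spec.map (CommRingCat.ofHom (algebraMap ℂ X.functionField)) :=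
  (spec_map_stalkAlgebra X (genericPoint X)).symm

theorem spec_map_algebraMap_comp (x : X) :
    Spec.map (CommRingCat.ofHom (algebraMap (X.presheaf.stalk x) X.functionField)) ≫
      X.fromSpecStalk x = fromSpecFunctionField X :=
  Scheme.SpecMap_stalkSpecializes_fromSpecStalk (genericPoint_specializes x)

theorem algebraMap_surjective_of_eq_genericPoint {x : X} (hx : x = genericPoint X) :
    Function.Surjective (algebraMap (X.presheaf.stalk x) X.functionField) := by
  subst hx
  intro a
  refine ⟨a, ?_⟩
  change (X.presheaf.stalkSpecializes (genericPoint_specializes _)).hom a = a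
  rw [TopCat.Presheaf.stalkSpecializes_refl]
  rfl

/-- Completeness of the curve: a proper valuation ring of the function field which contains `ℂ` is
the local ring at a point. -/
theorem exists_point_of_valuationSubring (V : ValuationSubring X.functionField)
    (hC : ∀ c : ℂ, algebraMap ℂ X.functionField c ∈ V) (hV : V ≠ ⊤) :
    ∃ x : Point X, ∀ g, g ∈ V ↔ pointValuation X x g ≤ 1 := by
  let i : ℂ →+* V := (algebraMap ℂ X.functionField).codRestrict V.toSubring hC
  have hi : CommRingCat.ofHom i ≫ CommRingCat.ofHom (algebraMap V X.functionField) =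
    CommRingCat.ofHom (algebraMap ℂ X.functionField) := rfl
  have w : CommSq (fromSpecFunctionField X)
      (Spec.map (CommRingCat.ofHom (algebraMap V X.functionField))) (X ↘ SpecC)
      (Spec.map (CommRingCat.ofHom i)) := ⟨by
    rw [← Spec.map_comp, hi, fromSpecFunctionField_comp]⟩
  have hex : ValuativeCriterion.Existence (X ↘ SpecC) := by
    have h : IsProper (X ↘ SpecC) := inferInstance
    rw [IsProper.eq_valuativeCriterion] at h
    exact h.1.1.1.existence
  -- The valuative criterion extends the generic point to a morphism from Spec V. The image x of the
  -- closed point has its local ring inside V, compatibly with the inclusions in the function field.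
  obtain ⟨l, hl, -⟩ := (hex { R := V, K := X.functionField, commSq := w, .. }).exists_lift
  dsimp only at l hl
  set x := l (IsLocalRing.closedPoint V)
  let φ : X.presheaf.stalk x ⟶ CommRingCat.of V := Scheme.stalkClosedPointTo l
  have hφ : φ ≫ CommRingCat.ofHom (algebraMap V X.functionField) =
      CommRingCat.ofHom (algebraMap (X.presheaf.stalk x) X.functionField) := by
    apply Spec.map_injective
    rw [← cancel_mono (X.fromSpecStalk x), spec_map_algebraMap_comp, Spec.map_comp, Category.assoc]
    exact (congrArg _ (Scheme.Spec_stalkClosedPointTo_fromSpecStalk l)).trans hl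
  have hle (a : X.presheaf.stalk x) :
      algebraMap (X.presheaf.stalk x) X.functionField a ∈ V := by
    have : algebraMap (X.presheaf.stalk x) X.functionField a = (φ.hom a : X.functionField) :=
      congrArg (fun ψ ↦ ψ.hom a) hφ.symm
    rw [this]
    exact (φ.hom a).2
  rcases isClosed_or_eq_genericPoint X x with hx | hx
  · refine ⟨⟨x, hx⟩, fun g ↦ ⟨fun hg ↦ ?_, fun hg ↦ ?_⟩⟩
    · by_contra! h
      refine hV (eq_top_iff.mpr fun f _ ↦ ?_)
      refine mem_of_integers_le X ⟨x, hx⟩ V.toSubring (fun g hg ↦ ?_) h hg f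
      obtain ⟨a, rfl⟩ := (pointValuation_le_one_iff X ⟨x, hx⟩ g).mp hg
      exact hle a
    · obtain ⟨a, rfl⟩ := (pointValuation_le_one_iff X ⟨x, hx⟩ g).mp hg
      exact hle a
  · refine absurd (eq_top_iff.mpr fun f _ ↦ ?_) hV
    obtain ⟨a, rfl⟩ := algebraMap_surjective_of_eq_genericPoint X hx f
    exact hle a

/-- Separatedness of the curve: distinct points have incomparable local rings. -/
theorem point_eq_of_integers_le (x y : Point X)
    (h : ∀ g, pointValuation X x g ≤ 1 → pointValuation X y g ≤ 1) : x = y := by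
  -- Domination. If g vanishes at x but not at y, then gᴺ / t, with t a parameter at y, is regular
  -- at x for large N and still has a pole at y.
  have hlt (g : X.functionField) (hg : pointValuation X x g < 1) : pointValuation X y g < 1 := by
    by_contra! hgy
    obtain ⟨t, ht⟩ := IsDiscreteValuationRing.exists_irreducible (X.presheaf.stalk y.1)
    obtain ⟨N, hN⟩ := exists_mul_pow_le_one (b := pointValuation X x
      (algebraMap (X.presheaf.stalk y.1) X.functionField t)⁻¹) hg
    rw [← map_pow, ← map_mul] at hN
    have h2 := h _ hN
    rw [map_mul, map_inv₀, map_pow, pointValuation_uniformizer X y ht, ← WithZero.exp_neg,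
      neg_neg] at h2
    have h3 : WithZero.exp (1 : ℤ) ≤ 1 :=
      (le_mul_of_one_le_right' (one_le_pow₀ hgy)).trans h2
    rw [← WithZero.exp_zero, WithZero.exp_le_exp] at h3
    omega
  let ιx := algebraMap (X.presheaf.stalk x.1) X.functionField
  let ιy := algebraMap (X.presheaf.stalk y.1) X.functionField
  have hιy : Function.Injective ιy := IsFractionRing.injective _ _
  have hex (a : X.presheaf.stalk x.1) : ∃ b, ιy b = ιx a :=
    (pointValuation_le_one_iff X y _).mp (h _ (pointValuation_algebraMap_le_one X x a))
  choose ψ hψ using hex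
  let φ : X.presheaf.stalk x.1 →+* X.presheaf.stalk y.1 :=
    { toFun := ψ
      map_one' := hιy (by rw [hψ, map_one, map_one])
      map_zero' := hιy (by rw [hψ, map_zero, map_zero])
      map_mul' := fun a b ↦ hιy (by rw [map_mul, hψ, hψ, hψ, map_mul])
      map_add' := fun a b ↦ hιy (by rw [map_add, hψ, hψ, hψ, map_add]) }
  have hφ : CommRingCat.ofHom φ ≫ CommRingCat.ofHom ιy = CommRingCat.ofHom ιx := by
    ext a
    exact hψ a
  have hloc : IsLocalHom φ := by
    refine ⟨fun a ha ↦ ?_⟩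
    by_contra hna
    have h1 := hlt _ ((pointValuation_algebraMap_lt_one_iff X x a).mpr hna)
    rw [show algebraMap (X.presheaf.stalk x.1) X.functionField a = ιy (φ a) from (hψ a).symm] at h1
    exact (pointValuation_algebraMap_lt_one_iff X y _).mp h1 ha
  let f : Spec (CommRingCat.of (X.presheaf.stalk y.1)) ⟶ X := X.fromSpecStalk y.1
  let g : Spec (CommRingCat.of (X.presheaf.stalk y.1)) ⟶ X :=
    Spec.map (CommRingCat.ofHom φ) ≫ X.fromSpecStalk x.1
  have hφC : φ.comp (algebraMap ℂ _) = algebraMap ℂ _ := by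
    ext c
    refine hιy ((hψ _).trans ?_)
    rw [← IsScalarTower.algebraMap_apply, ← IsScalarTower.algebraMap_apply]
  -- The two morphisms from the spectrum of the local ring at y agree at the generic point, hence
  -- everywhere since X is separated. Their values at the closed point are y and x, because `φ` is
  -- local.
  have hfg : f = g := by
    have : IsDominant (Spec.map (CommRingCat.ofHom ιy)) :=
      ⟨(PrimeSpectrum.denseRange_comap_iff_ker_le_nilRadical ιy).mpr (by
        rw [(RingHom.injective_iff_ker_eq_bot ιy).mp hιy]
        exact bot_le)⟩
    refine ext_of_isDominant_of_isSeparated (X ↘ SpecC) ?_ (Spec.map (CommRingCat.ofHom ιy)) ?_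
    · change X.fromSpecStalk y.1 ≫ _ = (Spec.map (CommRingCat.ofHom φ) ≫ X.fromSpecStalk x.1) ≫ _
      rw [Category.assoc, ← spec_map_stalkAlgebra, ← spec_map_stalkAlgebra, ← hφC,
        CommRingCat.ofHom_comp, Spec.map_comp]
    · change _ = Spec.map (CommRingCat.ofHom ιy) ≫ Spec.map (CommRingCat.ofHom φ) ≫ _
      rw [← Spec.map_comp_assoc, hφ]
      exact (spec_map_algebraMap_comp X y.1).trans (spec_map_algebraMap_comp X x.1).symm
  have h1 : f (IsLocalRing.closedPoint (X.presheaf.stalk y.1)) = y.1 :=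
    Scheme.fromSpecStalk_closedPoint
  have h2 : g (IsLocalRing.closedPoint (X.presheaf.stalk y.1)) = x.1 := by
    have h3 : Spec.map (CommRingCat.ofHom φ) (IsLocalRing.closedPoint (X.presheaf.stalk y.1)) =
      IsLocalRing.closedPoint (X.presheaf.stalk x.1) := IsLocalRing.comap_closedPoint φ
    exact (congrArg (X.fromSpecStalk x.1) h3).trans Scheme.fromSpecStalk_closedPoint
  exact Subtype.ext (by rw [← h1, ← h2, hfg])

/-! ### The function field as a finite separable extension of ℂ(u) -/

instance : Algebra.EssFiniteType ℂ X.functionField := by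
  obtain ⟨V, hV, hx, φ, hφ, h⟩ := exists_standardSmooth_chart X (genericPoint X)
  algebraize [φ]
  let : Algebra Γ(X, V) (X.presheaf.stalk (genericPoint X)) :=
    (X.presheaf.germ V (genericPoint X) hx).hom.toAlgebra
  have : IsScalarTower ℂ Γ(X, V) (X.presheaf.stalk (genericPoint X)) := .of_algebraMap_eq' h.symm
  have := hV.isLocalization_stalk ⟨genericPoint X, hx⟩
  have : Algebra.EssFiniteType Γ(X, V) (X.presheaf.stalk (genericPoint X)) :=
    .of_isLocalization _ (hV.primeIdealOf ⟨genericPoint X, hx⟩).asIdeal.primeCompl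
  have : Algebra.IsStandardSmooth ℂ Γ(X, V) :=
    Algebra.IsStandardSmoothOfRelativeDimension.isStandardSmooth 1
  exact Algebra.EssFiniteType.comp ℂ Γ(X, V) (X.presheaf.stalk (genericPoint X))

theorem finrank_kaehler : Module.finrank X.functionField Ω[X.functionField⁄ℂ] = 1 :=
  (kaehler_stalk X (genericPoint X)).2.1

theorem span_D_eq_top {u : X.functionField} (hu : D ℂ X.functionField u ≠ 0) :
    Submodule.span X.functionField {D ℂ X.functionField u} = ⊤ :=
  (finrank_eq_one_iff_of_nonzero _ hu).mp (finrank_kaehler X)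

-- Differentials of K form a line spanned by du, and du becomes zero over ℂ(u).
open IntermediateField in
theorem formallyUnramified_adjoin {u : X.functionField} (hu : D ℂ X.functionField u ≠ 0) :
    Algebra.FormallyUnramified ℂ⟮u⟯ X.functionField := by
  refine ⟨⟨?_⟩⟩
  suffices h : ∀ a : Ω[X.functionField⁄ℂ⟮u⟯], a = 0 from fun a b ↦ (h a).trans (h b).symm
  intro a
  have ha : a ∈ Submodule.span X.functionField (Set.range (D ℂ⟮u⟯ X.functionField)) :=
    span_range_derivation ℂ⟮u⟯ X.functionField ▸ trivial
  induction ha using Submodule.span_induction with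
  | mem y hy =>
    obtain ⟨g, rfl⟩ := hy
    have hg : D ℂ X.functionField g ∈ Submodule.span X.functionField {D ℂ X.functionField u} :=
      span_D_eq_top X hu ▸ trivial
    obtain ⟨c, hc⟩ := Submodule.mem_span_singleton.mp hg
    have h2 := congrArg (KaehlerDifferential.map ℂ ℂ⟮u⟯ X.functionField X.functionField) hc
    rw [map_smul, map_D, map_D] at h2
    have h3 : D ℂ⟮u⟯ X.functionField u = 0 :=
      (D ℂ⟮u⟯ X.functionField).map_algebraMap (AdjoinSimple.gen ℂ u)
    simpa [h3] using h2.symm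
  | zero => rfl
  | add y z _ _ hy hz => rw [hy, hz, add_zero]
  | smul h y _ hy => rw [hy, smul_zero]

-- A field extension that is essentially of finite type and formally unramified is finite and
-- separable; this is where du ≠ 0 is needed.
open IntermediateField in
theorem finite_separable_adjoin {u : X.functionField} (hu : D ℂ X.functionField u ≠ 0) :
    FiniteDimensional ℂ⟮u⟯ X.functionField ∧ Algebra.IsSeparable ℂ⟮u⟯ X.functionField := by
  have := formallyUnramified_adjoin X hu
  have : Algebra.EssFiniteType ℂ⟮u⟯ X.functionField := .of_comp ℂ ℂ⟮u⟯ X.functionField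
  exact ⟨Algebra.FormallyUnramified.finite_of_free _ _,
    Algebra.FormallyUnramified.isSeparable _ _⟩

theorem transcendental_of_D_ne_zero {u : X.functionField} (hu : D ℂ X.functionField u ≠ 0) :
    Transcendental ℂ u := by
  intro h
  have hd := IsAlgClosed.degree_eq_one_of_irreducible ℂ (minpoly.irreducible h.isIntegral)
  obtain ⟨c, rfl⟩ := minpoly.mem_range_of_degree_eq_one ℂ u hd
  exact hu ((D ℂ X.functionField).map_algebraMap c)

/-! ### The integral closure of ℂ[u]: its maximal ideals and approximation -/

/-- The ring of polynomials in `u`. -/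
abbrev polyRing (u : X.functionField) : Subalgebra ℂ X.functionField := Algebra.adjoin ℂ {u}

/-- The integral closure of the ring of polynomials in `u`: the functions which are regular where
`u` is regular. -/
abbrev affineRing (u : X.functionField) : Subalgebra (polyRing X u) X.functionField :=
  integralClosure (polyRing X u) X.functionField

theorem polyRing_le (u : X.functionField) {V : ValuationSubring X.functionField}
    (hC : ∀ c : ℂ, algebraMap ℂ X.functionField c ∈ V) (hu : u ∈ V) {g : X.functionField}
    (hg : g ∈ polyRing X u) : g ∈ V := by
  induction hg using Algebra.adjoin_induction with
  | mem y hy => obtain rfl := hy; exact hu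
  | algebraMap c => exact hC c
  | add _ _ _ _ h1 h2 => exact V.add_mem _ _ h1 h2
  | mul _ _ _ _ h1 h2 => exact V.mul_mem _ _ h1 h2

/-- An integrally closed subring is the intersection of the valuation rings containing it. By
completeness those that contain ℂ[u] and omit a given element are the local rings at points where u
is regular. -/
theorem mem_affineRing_iff (u g : X.functionField) :
    g ∈ affineRing X u ↔ ∀ x, pointValuation X x u ≤ 1 → pointValuation X x g ≤ 1 := by
  have hint : IsIntegrallyClosedIn (affineRing X u).toSubring X.functionField :=
    inferInstanceAs (IsIntegrallyClosedIn (affineRing X u) X.functionField)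
  constructor
  · intro hg x hx
    have : IsIntegrallyClosedIn (pointValuation X x).valuationSubring.toSubring X.functionField :=
      inferInstanceAs (IsIntegrallyClosedIn (pointValuation X x).valuationSubring X.functionField)
    have hle (r : X.functionField) (hr : r ∈ polyRing X u) :
        r ∈ (pointValuation X x).valuationSubring :=
      polyRing_le X u (pointValuation_complex_le_one X x) hx hr
    let : Algebra (polyRing X u) (pointValuation X x).valuationSubring.toSubring :=
      RingHom.toAlgebra ((polyRing X u).val.toRingHom.codRestrict _ fun r ↦ hle r r.2)
    have : IsScalarTower (polyRing X u) (pointValuation X x).valuationSubring.toSubring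
      X.functionField := .of_algebraMap_eq fun _ ↦ rfl
    have hg' : IsIntegral (polyRing X u) g := hg
    exact Subring.isIntegrallyClosedIn_iff.mp ‹_›
      (hg'.tower_top (A := (pointValuation X x).valuationSubring.toSubring))
  · intro h
    by_contra hg
    obtain ⟨V, hV, hgV⟩ :=
      (affineRing X u).toSubring.exists_le_valuationSubring_of_isIntegrallyClosedIn hg
    have hA (r : X.functionField) (hr : r ∈ polyRing X u) : r ∈ V :=
      hV ((affineRing X u).algebraMap_mem ⟨r, hr⟩)
    obtain ⟨x, hx⟩ := exists_point_of_valuationSubring X V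
      (fun c ↦ hA _ (Subalgebra.algebraMap_mem _ c)) (fun h ↦ hgV (h ▸ trivial))
    exact hgV ((hx g).mpr (h x ((hx u).mp (hA u (Algebra.self_mem_adjoin_singleton ℂ u)))))

section
variable {u : X.functionField} (hu : Transcendental ℂ u)
include hu

theorem isPrincipalIdealRing_polyRing : IsPrincipalIdealRing (polyRing X u) :=
  let e := Polynomial.algEquivOfTranscendental ℂ u hu
  IsPrincipalIdealRing.of_surjective (e : Polynomial ℂ →+* polyRing X u) e.surjective

theorem prime_polyRing_self :
    Prime (⟨u, Algebra.self_mem_adjoin_singleton ℂ u⟩ : polyRing X u) := by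
  let e := Polynomial.algEquivOfTranscendental ℂ u hu
  have : e Polynomial.X = ⟨u, Algebra.self_mem_adjoin_singleton ℂ u⟩ := by
    simp [e, Polynomial.algEquivOfTranscendental_apply]
  rw [← this]
  exact (MulEquiv.prime_iff e.toMulEquiv).mpr Polynomial.prime_X
end

section
variable {u : X.functionField} (hu : D ℂ X.functionField u ≠ 0)
include hu

-- ℂ[u] is a polynomial ring, hence principal, and K is finite separable over its fraction field
-- ℂ(u).
open IntermediateField.algebraAdjoinAdjoin in
theorem affineRing_facts : IsDedekindDomain (affineRing X u) ∧
    Module.Finite (polyRing X u) (affineRing X u) ∧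
    IsFractionRing (affineRing X u) X.functionField := by
  obtain ⟨_, _⟩ := finite_separable_adjoin X hu
  have := isPrincipalIdealRing_polyRing X (transcendental_of_D_ne_zero X hu)
  have : IsScalarTower (polyRing X u) (IntermediateField.adjoin ℂ {u}) X.functionField :=
    inferInstance
  refine ⟨integralClosure.isDedekindDomain (polyRing X u) (IntermediateField.adjoin ℂ {u}) _,
    IsIntegralClosure.finite (polyRing X u) (IntermediateField.adjoin ℂ {u}) X.functionField
      (affineRing X u),
    IsIntegralClosure.isFractionRing_of_finite_extension (polyRing X u)
      (IntermediateField.adjoin ℂ {u}) X.functionField (affineRing X u)⟩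
end

theorem affineRing_le_one {u : X.functionField} {x : Point X} (hx : pointValuation X x u ≤ 1)
    (b : affineRing X u) : pointValuation X x (b : X.functionField) ≤ 1 :=
  (mem_affineRing_iff X u b).mp b.2 x hx

/-- The maximal ideal of the affine ring of `u` given by a point where `u` is regular. -/
def pointIdeal (u : X.functionField) (x : Point X) (hx : pointValuation X x u ≤ 1) :
    Ideal (affineRing X u) where
  carrier := {b | pointValuation X x (b : X.functionField) < 1}
  add_mem' {a b} ha hb := by
    rw [Set.mem_ofPred_eq] at ha hb ⊢
    exact Valuation.map_add_lt _ ha hb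
  zero_mem' := by simp
  smul_mem' c b hb := by
    simp only [Set.mem_ofPred_eq, smul_eq_mul, MulMemClass.coe_mul, map_mul] at hb ⊢
    rw [mul_comm]
    exact mul_lt_one_of_lt_of_le hb (affineRing_le_one X hx c)

theorem mem_pointIdeal {u : X.functionField} {x : Point X} (hx : pointValuation X x u ≤ 1)
    (b : affineRing X u) : b ∈ pointIdeal X u x hx ↔ pointValuation X x (b : X.functionField) < 1 := by
  change b ∈ {b : affineRing X u | pointValuation X x (b : X.functionField) < 1} ↔ _
  rw [Set.mem_ofPred_eq]

instance isPrime_pointIdeal (u : X.functionField) (x : Point X)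
    (hx : pointValuation X x u ≤ 1) : (pointIdeal X u x hx).IsPrime where
  ne_top' := by
    rw [Ideal.ne_top_iff_one, mem_pointIdeal]
    simp
  mem_or_mem' {a b} hab := by
    simp only [mem_pointIdeal, MulMemClass.coe_mul, map_mul] at hab ⊢
    by_contra! h
    exact absurd hab (not_lt.mpr (one_le_mul h.1 h.2))

theorem valuation_le_of_mem_pointIdeal_pow {u : X.functionField} {x : Point X}
    (hx : pointValuation X x u ≤ 1) (N : ℕ) {b : affineRing X u}
    (hb : b ∈ pointIdeal X u x hx ^ N) :
    pointValuation X x (b : X.functionField) ≤ WithZero.exp (-N : ℤ) := by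
  induction N generalizing b with
  | zero => simpa using affineRing_le_one X hx b
  | succ N ih =>
    rw [pow_succ] at hb
    refine Submodule.mul_induction_on hb (fun a ha c hc ↦ ?_)
      fun a c ha hc ↦ Valuation.map_add_le _ ha hc
    rw [MulMemClass.coe_mul, map_mul, Nat.cast_add, neg_add, WithZero.exp_add]
    exact mul_le_mul' (ih ha) (le_exp_neg_one ((mem_pointIdeal X hx c).mp hc))

section
variable {u : X.functionField} (hu : D ℂ X.functionField u ≠ 0)
include hu

theorem exists_affineRing_div (f : X.functionField) :
    ∃ a b : affineRing X u, (b : X.functionField) ≠ 0 ∧ f = a / b := by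
  have := (affineRing_facts X hu).2.2
  obtain ⟨a, b, hb, rfl⟩ := IsFractionRing.div_surjective (affineRing X u) f
  exact ⟨a, b, fun h ↦ nonZeroDivisors.ne_zero hb (Subtype.ext h), rfl⟩

theorem exists_ne_zero_mem_pointIdeal {x : Point X} (hx : pointValuation X x u ≤ 1) :
    pointIdeal X u x hx ≠ ⊥ := by
  obtain ⟨t, ht⟩ := IsDiscreteValuationRing.exists_irreducible (X.presheaf.stalk x.1)
  have hv := pointValuation_uniformizer X x ht
  obtain ⟨a, b, hb, hab⟩ := exists_affineRing_div X hu
    (algebraMap (X.presheaf.stalk x.1) X.functionField t)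
  have ha : pointValuation X x (a : X.functionField) < 1 := by
    rw [show (a : X.functionField) = algebraMap (X.presheaf.stalk x.1) X.functionField t * b by
      rw [hab, div_mul_cancel₀ _ hb], map_mul, hv]
    refine mul_lt_one_of_lt_of_le ?_ (affineRing_le_one X hx b)
    rw [← WithZero.exp_zero, WithZero.exp_lt_exp]
    omega
  intro h
  have h0 : a ∈ pointIdeal X u x hx := (mem_pointIdeal X hx a).mpr ha
  rw [h, Ideal.mem_bot] at h0
  rw [h0, ZeroMemClass.coe_zero, zero_div] at hab
  rw [hab, map_zero] at hv
  exact WithZero.exp_ne_zero hv.symm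

/-- The ideal P of x determines the local ring at x as the fractions r / n with n outside P. Equal
ideals thus give comparable local rings, and separatedness identifies the points. -/
theorem pointIdeal_injective {x y : Point X} (hx : pointValuation X x u ≤ 1)
    (hy : pointValuation X y u ≤ 1) (h : pointIdeal X u x hx = pointIdeal X u y hy) : x = y := by
  obtain ⟨_, _, _⟩ := affineRing_facts X hu
  refine point_eq_of_integers_le X x y fun g hg ↦ ?_
  let P : IsDedekindDomain.HeightOneSpectrum (affineRing X u) :=
    ⟨pointIdeal X u x hx, inferInstance, exists_ne_zero_mem_pointIdeal X hu hx⟩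
  have hout {z : Point X} (hz : pointValuation X z u ≤ 1)
      (hzP : pointIdeal X u z hz = P.asIdeal) {n : affineRing X u} (hn : n ∈ P.asIdeal.primeCompl) :
      pointValuation X z (n : X.functionField) = 1 := by
    refine (affineRing_le_one X hz n).antisymm (not_lt.mp fun h ↦ hn ?_)
    rw [← hzP]
    exact (mem_pointIdeal X hz n).mpr h
  -- Otherwise g⁻¹ = r / n with r in P and n outside P, so g⁻¹ would vanish at x, where g is
  -- regular.
  have hg' : P.valuation X.functionField g ≤ 1 := by
    by_contra! hlt
    have hinv : P.valuation X.functionField g⁻¹ < 1 := by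
      rw [map_inv₀]
      exact inv_lt_one_of_one_lt₀ hlt
    obtain ⟨r, ⟨n, hn⟩, hr⟩ := P.exists_primeCompl_mul_eq_of_integer _ hinv.le
    have hr1 : r ∈ P.asIdeal := by
      refine (P.valuation_lt_one_iff_mem (K := X.functionField) r).mp
        (lt_of_eq_of_lt (congrArg (P.valuation X.functionField) hr.symm) ?_)
      rw [map_mul]
      exact mul_lt_one_of_lt_of_le hinv (P.valuation_le_one _)
    have hr2 := (mem_pointIdeal X hx r).mp hr1
    have hr3 : g⁻¹ * (n : X.functionField) = r := hr
    rw [← hr3, map_mul, hout hx rfl hn, mul_one, map_inv₀] at hr2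
    have hg0 : pointValuation X x g ≠ 0 := by
      rw [Valuation.ne_zero_iff]
      rintro rfl
      simp at hlt
    exact absurd ((one_le_inv₀ (zero_lt_iff.mpr hg0)).mpr hg) (not_le.mpr hr2)
  obtain ⟨r, ⟨n, hn⟩, hr⟩ := P.exists_primeCompl_mul_eq_of_integer _ hg'
  have hr3 : g * (n : X.functionField) = r := hr
  have hr4 := affineRing_le_one X hy r
  rwa [← hr3, map_mul, hout hy h.symm hn, mul_one] at hr4

/-- Chinese remainder theorem for the powers of the distinct maximal ideals of the points of `T`. -/
theorem exists_approx_one (T : Finset (Point X)) (hT : ∀ x ∈ T, pointValuation X x u ≤ 1)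
    (x : Point X) (hxT : x ∈ T) (N : ℕ) : ∃ b : affineRing X u,
      pointValuation X x (1 - b : X.functionField) ≤ WithZero.exp (-N : ℤ) ∧
      ∀ y ∈ T, y ≠ x → pointValuation X y (b : X.functionField) ≤ WithZero.exp (-N : ℤ) := by
  obtain ⟨_, _, _⟩ := affineRing_facts X hu
  classical
  obtain ⟨b, hb⟩ := IsDedekindDomain.exists_forall_sub_mem_ideal (s := (Finset.univ : Finset T))
    (fun y : T ↦ pointIdeal X u y.1 (hT _ y.2)) (fun _ ↦ N)
    (fun y _ ↦ Ideal.prime_of_isPrime (exists_ne_zero_mem_pointIdeal X hu _) inferInstance)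
    (fun y _ z _ hyz h ↦ hyz (Subtype.ext (pointIdeal_injective X hu _ _ h)))
    (fun y ↦ if y.1.1 = x then 1 else 0)
  refine ⟨b, ?_, fun y hy hyx ↦ ?_⟩
  · have h := valuation_le_of_mem_pointIdeal_pow X _ N (hb ⟨x, hxT⟩ (Finset.mem_univ _))
    rw [Valuation.map_sub_swap]
    simpa using h
  · have h := valuation_le_of_mem_pointIdeal_pow X _ N (hb ⟨y, hy⟩ (Finset.mem_univ _))
    simpa [hyx] using h
end

/-! ### Residues of rational differentials -/

theorem residue_smul_form (x : Point X) (h : X.functionField) (η : Ω[X.functionField⁄ℂ])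
    (f : LocalField X x) :
    residue X x (h • η) f = residue X x η (f * algebraMap X.functionField (LocalField X x) h) := by
  rw [residue_eq_iff]
  obtain ⟨t, h', a, ht, rfl, ha, hc⟩ := (residue_eq_iff X x η _ _).mp
    (rfl : residue X x η (f * algebraMap X.functionField (LocalField X x) h) = _)
  refine ⟨t, h * h', a, ht, by rw [mul_smul], ?_, hc⟩
  rwa [map_mul, ← mul_assoc]

theorem residue_eq_of_laurentSum (x : Point X) {t : X.presheaf.stalk x.1} (ht : Irreducible t)
    (h : X.functionField) (f : LocalField X x) (a : ℤ →₀ ℂ)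
    (ha : f * algebraMap X.functionField (LocalField X x) h -
      laurentSum (algebraMap (X.presheaf.stalk x.1) (LocalField X x) t) a ∈ localIntegers X x) :
    residue X x (h • differential X x t) f = a (-1) :=
  (residue_eq_iff X x _ _ _).mpr ⟨t, h, a, ht, rfl, ha, rfl⟩

theorem residue_add_form (x : Point X) (η θ : Ω[X.functionField⁄ℂ]) (f : LocalField X x) :
    residue X x (η + θ) f = residue X x η f + residue X x θ f := by
  obtain ⟨t, ht⟩ := IsDiscreteValuationRing.exists_irreducible (X.presheaf.stalk x.1)
  obtain ⟨h, rfl⟩ := exists_eq_smul_differential X x ht η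
  obtain ⟨k, rfl⟩ := exists_eq_smul_differential X x ht θ
  rw [← add_smul, residue_smul_form, residue_smul_form, residue_smul_form, map_add, mul_add,
    map_add]

/-- The residue at `x` of a meromorphic differential. -/
def formResidue (x : Point X) : Ω[X.functionField⁄ℂ] →ₗ[ℂ] ℂ where
  toFun η := residue X x η 1
  map_add' η θ := residue_add_form X x η θ 1
  map_smul' c η := by
    rw [← algebraMap_smul X.functionField c η, residue_smul_form, one_mul,
      ← IsScalarTower.algebraMap_apply, Algebra.algebraMap_eq_smul_one, map_smul]
    rfl

theorem formResidue_smul (x : Point X) (f : X.functionField) (η : Ω[X.functionField⁄ℂ]) :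
    formResidue X x (f • η) = residue X x η (algebraMap X.functionField (LocalField X x) f) := by
  change residue X x _ _ = _
  rw [residue_smul_form, one_mul]

theorem algebraMap_laurentSum (x : Point X) (t : X.presheaf.stalk x.1) (a : ℤ →₀ ℂ) :
    algebraMap X.functionField (LocalField X x)
      (laurentSum (algebraMap (X.presheaf.stalk x.1) X.functionField t) a) =
    laurentSum (algebraMap (X.presheaf.stalk x.1) (LocalField X x) t) a := by
  have h := map_laurentSum (IsScalarTower.toAlgHom ℂ X.functionField (LocalField X x))
    (algebraMap (X.presheaf.stalk x.1) X.functionField t) a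
  simpa only [IsScalarTower.coe_toAlgHom', ← IsScalarTower.algebraMap_apply] using h

theorem algebraMap_mem_localIntegers (x : Point X) {g : X.functionField}
    (hg : pointValuation X x g ≤ 1) :
    algebraMap X.functionField (LocalField X x) g ∈ localIntegers X x := by
  rwa [mem_localIntegers_iff, valued_functionField]

theorem formResidue_eq_of_laurentSum (x : Point X) {t : X.presheaf.stalk x.1} (ht : Irreducible t)
    (h : X.functionField) (a : ℤ →₀ ℂ) (ha : pointValuation X x
      (h - laurentSum (algebraMap (X.presheaf.stalk x.1) X.functionField t) a) ≤ 1) :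
    formResidue X x (h • differential X x t) = a (-1) := by
  refine residue_eq_of_laurentSum X x ht h 1 a ?_
  rw [one_mul, ← algebraMap_laurentSum, ← map_sub]
  exact algebraMap_mem_localIntegers X x ha

/-- No derivative of a power of t is a nonzero multiple of t⁻¹, and the differential of a regular
germ is regular. -/
theorem formResidue_D (x : Point X) (g : X.functionField) :
    formResidue X x (D ℂ X.functionField g) = 0 := by
  obtain ⟨t, ht⟩ := IsDiscreteValuationRing.exists_irreducible (X.presheaf.stalk x.1)
  obtain ⟨b, p, rfl⟩ := exists_laurentSum_functionField X x ht g
  obtain ⟨q, hq⟩ := exists_differential_eq X x ht p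
  obtain ⟨b', hb0, hb⟩ := exists_D_laurentSum
    (algebraMap (X.presheaf.stalk x.1) X.functionField t) b
  have h1 : D ℂ X.functionField (laurentSum (algebraMap (X.presheaf.stalk x.1) X.functionField t) b
      + algebraMap (X.presheaf.stalk x.1) X.functionField p) =
      (laurentSum (algebraMap (X.presheaf.stalk x.1) X.functionField t) b' +
        algebraMap (X.presheaf.stalk x.1) X.functionField q) • differential X x t := by
    rw [map_add, hb, add_smul]
    exact congrArg _ hq
  rw [h1, formResidue_eq_of_laurentSum X x ht _ b', hb0]
  rw [add_sub_cancel_left]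
  exact pointValuation_algebraMap_le_one X x q

theorem exists_D_eq_of_integral (x : Point X) {t : X.presheaf.stalk x.1} (ht : Irreducible t)
    {u : X.functionField} (hu : pointValuation X x u ≤ 1) : ∃ w : X.functionField,
    pointValuation X x w ≤ 1 ∧ D ℂ X.functionField u = w • differential X x t := by
  obtain ⟨a, rfl⟩ := (pointValuation_le_one_iff X x u).mp hu
  obtain ⟨b, hb⟩ := exists_differential_eq X x ht a
  exact ⟨_, pointValuation_algebraMap_le_one X x b, hb⟩

theorem residue_eq_zero_of_integral (x : Point X) {u : X.functionField}
    (hu : pointValuation X x u ≤ 1) {f : LocalField X x} (hf : f ∈ localIntegers X x) :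
    residue X x (D ℂ X.functionField u) f = 0 := by
  obtain ⟨t, ht⟩ := IsDiscreteValuationRing.exists_irreducible (X.presheaf.stalk x.1)
  obtain ⟨w, hw, h⟩ := exists_D_eq_of_integral X x ht hu
  rw [h, residue_eq_of_laurentSum X x ht w f 0]
  · rfl
  · rw [map_zero, sub_zero]
    exact mul_mem hf (algebraMap_mem_localIntegers X x hw)

theorem formResidue_eq_zero_of_integral (x : Point X) {u f : X.functionField}
    (hu : pointValuation X x u ≤ 1) (hf : pointValuation X x f ≤ 1) :
    formResidue X x (f • D ℂ X.functionField u) = 0 := by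
  rw [formResidue_smul]
  exact residue_eq_zero_of_integral X x hu (algebraMap_mem_localIntegers X x hf)

/-- The order of vanishing at `x` of a rational function. -/
def order (x : Point X) (u : X.functionField) : ℤ := -WithZero.log (pointValuation X x u)

theorem pointValuation_eq_exp (x : Point X) {u : X.functionField} (hu : u ≠ 0) :
    pointValuation X x u = WithZero.exp (-order X x u) := by
  rw [order, neg_neg, WithZero.exp_log]
  exact (Valuation.ne_zero_iff _).mpr hu

theorem algebraMap_uniformizer_ne_zero (x : Point X) {t : X.presheaf.stalk x.1}
    (ht : Irreducible t) : algebraMap (X.presheaf.stalk x.1) X.functionField t ≠ 0 := by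
  rw [map_ne_zero_iff _ (IsFractionRing.injective _ _)]
  exact ht.ne_zero

theorem pointValuation_uniformizer_zpow (x : Point X) {t : X.presheaf.stalk x.1}
    (ht : Irreducible t) (n : ℤ) : pointValuation X x
      (algebraMap (X.presheaf.stalk x.1) X.functionField t ^ n) = WithZero.exp (-n) := by
  rw [map_zpow₀, pointValuation_uniformizer X x ht, ← WithZero.exp_zsmul]
  simp

/-- The logarithmic differential of `u` is `(e / t + r) dt` with `e` the order of `u`. -/
theorem exists_logarithmic_D (x : Point X) {t : X.presheaf.stalk x.1} (ht : Irreducible t)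
    {u : X.functionField} (hu : u ≠ 0) : ∃ r : X.functionField, pointValuation X x r ≤ 1 ∧
    D ℂ X.functionField u = (u * ((order X x u : ℂ) •
      (algebraMap (X.presheaf.stalk x.1) X.functionField t)⁻¹ + r)) • differential X x t := by
  have hτ0 := algebraMap_uniformizer_ne_zero X x ht
  have hτe := pointValuation_uniformizer_zpow X x ht (order X x u)
  set τ := algebraMap (X.presheaf.stalk x.1) X.functionField t
  set e := order X x u
  have hτe0 : τ ^ e ≠ 0 := zpow_ne_zero _ hτ0
  have hw : pointValuation X x (u / τ ^ e) = 1 := by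
    rw [map_div₀, hτe, pointValuation_eq_exp X x hu, div_self WithZero.exp_ne_zero]
  obtain ⟨r, hr, hD⟩ := exists_D_eq_of_integral X x ht hw.le
  refine ⟨r * (u / τ ^ e)⁻¹, by rw [map_mul, map_inv₀, hw, inv_one, mul_one]; exact hr, ?_⟩
  have h1 : u = τ ^ e * (u / τ ^ e) := by field_simp
  have h2 : D ℂ X.functionField τ = differential X x t := rfl
  conv_lhs => rw [h1, Derivation.leibniz, hD, D_zpow, h2, smul_smul, smul_smul, ← add_smul]
  congr 1
  rw [zpow_sub_one₀ hτ0, Algebra.smul_def, Algebra.smul_def]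
  field_simp
  ring

theorem pointValuation_order_pos (x : Point X) {u : X.functionField} (hu : u ≠ 0)
    (hx : pointValuation X x u < 1) : 1 ≤ order X x u := by
  rw [pointValuation_eq_exp X x hu, ← WithZero.exp_zero, WithZero.exp_lt_exp] at hx
  omega

theorem le_one_of_sub_lt_one (x : Point X) {f : X.functionField} {c : ℂ}
    (hf : pointValuation X x (f - algebraMap ℂ X.functionField c) < 1) :
    pointValuation X x f ≤ 1 := by
  have := Valuation.map_add_le _ hf.le (pointValuation_complex_le_one X x c)
  rwa [sub_add_cancel] at this

/-- The residue of f du / u is f(x) times the order of u. The hypothesis expresses f(x) = c. -/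
theorem formResidue_logarithmic (x : Point X) {u f : X.functionField} (hu : u ≠ 0) {c : ℂ}
    (hf : pointValuation X x (f - algebraMap ℂ X.functionField c) < 1) :
    formResidue X x ((f * u⁻¹) • D ℂ X.functionField u) = c * order X x u := by
  obtain ⟨t, ht⟩ := IsDiscreteValuationRing.exists_irreducible (X.presheaf.stalk x.1)
  obtain ⟨r, hr, hD⟩ := exists_logarithmic_D X x ht hu
  have hτ0 := algebraMap_uniformizer_ne_zero X x ht
  have hτv := pointValuation_uniformizer X x ht
  rw [hD, smul_smul, formResidue_eq_of_laurentSum X x ht _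
    (Finsupp.single (-1) (c * order X x u)), Finsupp.single_eq_same]
  rw [laurentSum_single]
  set τ := algebraMap (X.presheaf.stalk x.1) X.functionField t
  have h1 : f * u⁻¹ * (u * ((order X x u : ℂ) • τ⁻¹ + r)) - (c * (order X x u : ℂ)) • τ ^ (-1 : ℤ) =
      ((f - algebraMap ℂ X.functionField c) * τ⁻¹) *
        algebraMap ℂ X.functionField (order X x u) + f * r := by
    rw [Algebra.smul_def, Algebra.smul_def, map_mul, zpow_neg_one]
    field_simp
    ring
  rw [h1]
  refine Valuation.map_add_le _ ?_ ?_
  · rw [map_mul]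
    refine mul_le_one' ?_ (pointValuation_complex_le_one X x _)
    rw [map_mul, map_inv₀, hτv, ← WithZero.exp_neg, neg_neg]
    calc _ ≤ WithZero.exp (-1 : ℤ) * WithZero.exp (1 : ℤ) := by
          gcongr
          exact le_exp_neg_one hf
      _ = 1 := by rw [← WithZero.exp_add]; simp
  · rw [map_mul]
    exact mul_le_one' (le_one_of_sub_lt_one X x hf) hr

/-- In characteristic zero the term e / t of the logarithmic differential is not cancelled, so du
vanishes to order exactly e - 1. -/
theorem exists_D_eq_of_lt_one (x : Point X) {t : X.presheaf.stalk x.1} (ht : Irreducible t)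
    {u : X.functionField} (hu : u ≠ 0) (hx : pointValuation X x u < 1) : ∃ w : X.functionField,
    pointValuation X x w = WithZero.exp (1 - order X x u) ∧
    D ℂ X.functionField u = w • differential X x t := by
  obtain ⟨r, hr, hD⟩ := exists_logarithmic_D X x ht hu
  refine ⟨_, ?_, hD⟩
  have he := pointValuation_order_pos X x hu hx
  have h1 : pointValuation X x ((order X x u : ℂ) •
      (algebraMap (X.presheaf.stalk x.1) X.functionField t)⁻¹) = WithZero.exp (1 : ℤ) := by
    rw [Algebra.smul_def, map_mul, pointValuation_complex X x (by
      rw [Int.cast_ne_zero]; omega), one_mul, map_inv₀, pointValuation_uniformizer X x ht,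
      ← WithZero.exp_neg, neg_neg]
  have hlt : pointValuation X x r < pointValuation X x ((order X x u : ℂ) •
      (algebraMap (X.presheaf.stalk x.1) X.functionField t)⁻¹) := by
    rw [h1]
    refine hr.trans_lt ?_
    rw [← WithZero.exp_zero, WithZero.exp_lt_exp]
    omega
  rw [map_mul, Valuation.map_add_eq_of_lt_left _ hlt, h1, pointValuation_eq_exp X x hu,
    ← WithZero.exp_add]
  congr 1
  ring

theorem exists_zpow_mul_laurentSum {L : Type*} [Field L] [Algebra ℂ L] {t : L} (ht : t ≠ 0) (m : ℤ)
    (a : ℤ →₀ ℂ) : ∃ b : ℤ →₀ ℂ, t ^ m * laurentSum t a = laurentSum t b := by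
  induction a using Finsupp.induction_linear with
  | zero => exact ⟨0, by simp⟩
  | add f g hf hg =>
    obtain ⟨f', hf⟩ := hf
    obtain ⟨g', hg⟩ := hg
    exact ⟨f' + g', by rw [map_add, map_add, mul_add, hf, hg]⟩
  | single n c =>
    refine ⟨Finsupp.single (m + n) c, ?_⟩
    rw [laurentSum_single, laurentSum_single, mul_smul_comm, zpow_add₀ ht]

/-- A form without residue at a zero of `u` is exact up to a regular multiple of `du`. -/
theorem exists_local_antiderivative (x : Point X) {u : X.functionField} (hu : u ≠ 0)
    (hx : pointValuation X x u < 1) (f : X.functionField)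
    (hf : formResidue X x (f • D ℂ X.functionField u) = 0) :
    ∃ g f₀ : X.functionField, pointValuation X x f₀ ≤ 1 ∧
      f • D ℂ X.functionField u = D ℂ X.functionField g + f₀ • D ℂ X.functionField u := by
  obtain ⟨t, ht⟩ := IsDiscreteValuationRing.exists_irreducible (X.presheaf.stalk x.1)
  obtain ⟨w, hw, hD⟩ := exists_D_eq_of_lt_one X x ht hu hx
  have he := pointValuation_order_pos X x hu hx
  have hτ0 := algebraMap_uniformizer_ne_zero X x ht
  have hτe := pointValuation_uniformizer_zpow X x ht (order X x u - 1)
  -- The expansion is cut after division by the power of τ that matches the order e - 1 of w. The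
  -- remainder is then w times a regular function, not merely regular.
  obtain ⟨b, p, hb⟩ := exists_laurentSum_functionField X x ht
    (f * w / algebraMap (X.presheaf.stalk x.1) X.functionField t ^ (order X x u - 1))
  have hp := pointValuation_algebraMap_le_one X x p
  obtain ⟨b', hb'⟩ := exists_zpow_mul_laurentSum hτ0 (order X x u - 1) b
  have hdt : D ℂ X.functionField (algebraMap (X.presheaf.stalk x.1) X.functionField t) =
    differential X x t := rfl
  have hres := formResidue_eq_of_laurentSum X x ht (f * w) b'
  obtain ⟨g, hg⟩ := exists_antiderivative (algebraMap (X.presheaf.stalk x.1) X.functionField t) b'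
  set τ := algebraMap (X.presheaf.stalk x.1) X.functionField t
  set q := algebraMap (X.presheaf.stalk x.1) X.functionField p
  have hw0 : w ≠ 0 := by
    rintro rfl
    rw [map_zero] at hw
    exact WithZero.exp_ne_zero hw.symm
  have hfw : f * w = laurentSum τ b' + τ ^ (order X x u - 1) * q := by
    rw [div_eq_iff (zpow_ne_zero _ hτ0)] at hb
    rw [hb, ← hb']
    ring
  -- This coefficient is the residue, zero by assumption, so the Laurent part has an antiderivative.
  have hb0 : b' (-1) = 0 := by
    rw [← hres, ← hf, hD, smul_smul]
    rw [hfw, add_sub_cancel_left, map_mul, hτe]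
    refine mul_le_one' ?_ hp
    rw [← WithZero.exp_zero, WithZero.exp_le_exp]
    omega
  refine ⟨g, τ ^ (order X x u - 1) * q / w, ?_, ?_⟩
  · rw [map_div₀, map_mul, hτe, hw, mul_comm, mul_div_assoc, neg_sub,
      div_self WithZero.exp_ne_zero, mul_one]
    exact hp
  · rw [hb0, zero_smul, zero_smul, add_zero, hdt] at hg
    rw [hD, smul_smul, smul_smul, div_mul_cancel₀ _ hw0, hfw, add_smul, hg]

/-- With z = u b and b regular, dz = b du + u db; as du has order e - 1, the quotient u db / du is
still regular. -/
theorem exists_D_eq_smul_of_le (x : Point X) {u : X.functionField} (hu : u ≠ 0)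
    (hx : pointValuation X x u < 1) {z : X.functionField}
    (hz : pointValuation X x z ≤ pointValuation X x u) : ∃ f : X.functionField,
    pointValuation X x f ≤ 1 ∧ D ℂ X.functionField z = f • D ℂ X.functionField u := by
  obtain ⟨t, ht⟩ := IsDiscreteValuationRing.exists_irreducible (X.presheaf.stalk x.1)
  obtain ⟨w, hw, hD⟩ := exists_D_eq_of_lt_one X x ht hu hx
  have hu0 : pointValuation X x u ≠ 0 := (Valuation.ne_zero_iff _).mpr hu
  have hb : pointValuation X x (z / u) ≤ 1 := by
    rw [map_div₀]
    exact div_le_one_of_le₀ hz zero_le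
  obtain ⟨r, hr, hDb⟩ := exists_D_eq_of_integral X x ht hb
  have hw0 : w ≠ 0 := by
    rintro rfl
    rw [map_zero] at hw
    exact WithZero.exp_ne_zero hw.symm
  refine ⟨z / u + u * r / w, Valuation.map_add_le _ hb ?_, ?_⟩
  · rw [map_div₀, map_mul, hw, pointValuation_eq_exp X x hu, mul_comm, mul_div_assoc,
      ← WithZero.exp_sub]
    refine mul_le_one' hr ?_
    rw [← WithZero.exp_zero, WithZero.exp_le_exp]
    omega
  · have h1 : z = u * (z / u) := by field_simp
    conv_lhs => rw [h1, Derivation.leibniz, hDb, smul_smul]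
    rw [add_smul, add_comm]
    congr 1
    rw [hD, smul_smul, div_mul_cancel₀ _ hw0]

/-! ### Traces of functions -/

/-- The trace of a finite extension commutes with derivations preserving the base field. -/
theorem trace_derivation {F K : Type*} [Field F] [Field K] [Algebra F K] [FiniteDimensional F K]
    {R : Type*} [CommRing R] [Algebra R K] (δ : Derivation R K K) (d : F → F)
    (hd : ∀ c, δ (algebraMap F K c) = algebraMap F K (d c)) (f : K) :
    δ (algebraMap F K (Algebra.trace F K f)) = algebraMap F K (Algebra.trace F K (δ f)) := by
  classical
  let b := Module.finBasis F K
  let N : Matrix _ _ F := fun i j ↦ b.repr (δ (b j)) i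
  let M := Algebra.leftMulMatrix b
  have hinj : Function.Injective (algebraMap F K) := (algebraMap F K).injective
  have hM (g : K) (j) : ∑ i, M g i j • b i = g * b j := by
    rw [← b.sum_repr (g * b j)]
    simp [M, Algebra.leftMulMatrix_eq_repr_mul]
  have hN (j) : ∑ i, N i j • b i = δ (b j) := b.sum_repr _
  have hsmul (c : F) (k : K) : δ (c • k) = d c • k + c • δ k := by
    simp only [Algebra.smul_def, Derivation.leibniz, hd]
    simp only [Algebra.algebraMap_self, RingHom.id_apply]
    ring
  -- Matrix form of δ(f b_j) = δ(f) b_j + f δ(b_j), with N the matrix of δ on the basis. After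
  -- taking traces, N M(f) and M(f) N cancel.
  have key : (M f).map d + N * M f = M (δ f) + M f * N := by
    ext i j
    have h1 : ∑ i, ((M f).map d + N * M f) i j • b i = δ (f * b j) := by
      rw [← hM f j, map_sum]
      simp only [hsmul, Matrix.add_apply, add_smul, Finset.sum_add_distrib, Matrix.map_apply,
        Matrix.mul_apply, Finset.sum_smul, add_right_inj]
      rw [Finset.sum_comm]
      refine Finset.sum_congr rfl fun k _ ↦ ?_
      rw [← hN, Finset.smul_sum]
      exact Finset.sum_congr rfl fun l _ ↦ by rw [smul_smul, mul_comm]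
    have h2 : ∑ i, (M (δ f) + M f * N) i j • b i = δ (f * b j) := by
      rw [Derivation.leibniz, smul_eq_mul, smul_eq_mul, mul_comm (b j), ← hM (δ f) j, ← hN,
        Finset.mul_sum, add_comm]
      simp only [Matrix.add_apply, add_smul, Finset.sum_add_distrib,
        Matrix.mul_apply, Finset.sum_smul, add_left_inj]
      rw [Finset.sum_comm]
      refine Finset.sum_congr rfl fun k _ ↦ ?_
      rw [mul_smul_comm, ← hM, Finset.smul_sum]
      exact Finset.sum_congr rfl fun l _ ↦ by rw [smul_smul, mul_comm]
    exact congrFun (b.linearIndependent.fintypeLinearCombination_injective (h1.trans h2.symm)) i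
  have htr := congrArg Matrix.trace key
  rw [Matrix.trace_add, Matrix.trace_add, Matrix.trace_mul_comm, add_left_inj] at htr
  rw [Algebra.trace_eq_matrix_trace b, Algebra.trace_eq_matrix_trace b, ← htr, Matrix.trace,
    Matrix.trace, map_sum, map_sum, map_sum]
  exact Finset.sum_congr rfl fun i _ ↦ hd _

theorem algebraMap_trace_mem {F K : Type*} [Field F] [Field K] [Algebra F K]
    [FiniteDimensional F K] (R : Subring F) (S : Subring K) [IsIntegrallyClosedIn S K]
    (hRS : ∀ r ∈ R, algebraMap F K r ∈ S) {f : K} (hf : IsIntegral R f) :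
    algebraMap F K (Algebra.trace F K f) ∈ S := by
  have htr := (Algebra.isIntegral_trace (L := F) hf).map (IsScalarTower.toAlgHom R F K)
  let : Algebra R S := RingHom.toAlgebra
    (((algebraMap F K).comp R.subtype).codRestrict _ fun r ↦ hRS r r.2)
  have : IsScalarTower R S K := .of_algebraMap_eq fun _ ↦ rfl
  exact Subring.isIntegrallyClosedIn_iff.mp ‹_› (htr.tower_top (A := S))

/-- Differentiation with respect to `u`. -/
theorem exists_derivation {u : X.functionField} (hu : D ℂ X.functionField u ≠ 0) :
    ∃ δ : Derivation ℂ X.functionField X.functionField,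
      ∀ f, D ℂ X.functionField f = δ f • D ℂ X.functionField u := by
  have hex (f : X.functionField) : ∃ c : X.functionField,
      c • D ℂ X.functionField u = D ℂ X.functionField f :=
    Submodule.mem_span_singleton.mp (span_D_eq_top X hu ▸ trivial)
  choose δ hδ using hex
  have hinj {a b : X.functionField} (h : a • D ℂ X.functionField u = b • D ℂ X.functionField u) :
      a = b := smul_left_injective _ hu h
  refine ⟨{ toFun := δ, map_add' := ?_, map_smul' := ?_, map_one_eq_zero' := ?_, leibniz' := ?_ },
    fun f ↦ (hδ f).symm⟩
  · exact fun a b ↦ hinj (by rw [add_smul, hδ, hδ, hδ, map_add])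
  · exact fun c a ↦ hinj (by rw [hδ, RingHom.id_apply, smul_assoc, hδ, Derivation.map_smul])
  · exact hinj (by
      change δ 1 • _ = _
      rw [hδ, Derivation.map_one_eq_zero, zero_smul])
  · exact fun a b ↦ hinj (by
      change δ (a * b) • _ = _
      rw [hδ, Derivation.leibniz, add_smul, smul_eq_mul, smul_eq_mul, mul_smul, mul_smul]
      exact congrArg₂ _ (congrArg _ (hδ b).symm) (congrArg _ (hδ a).symm))

open IntermediateField in
theorem derivation_mem_adjoin {K : Type*} [Field K] [Algebra ℂ K] {u : K} (δ : Derivation ℂ K K)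
    (hδ : δ u = 1) (c : ℂ⟮u⟯) : δ c ∈ ℂ⟮u⟯ := by
  obtain ⟨c, hc⟩ := c
  change δ c ∈ _
  induction hc using adjoin_induction with
  | mem y hy =>
    obtain rfl : y = u := hy
    rw [hδ]
    exact one_mem _
  | algebraMap r =>
    rw [Derivation.map_algebraMap]
    exact zero_mem _
  | add _ _ _ _ h1 h2 =>
    rw [map_add]
    exact add_mem h1 h2
  | inv y hy h =>
    rw [Derivation.leibniz_inv, smul_eq_mul, neg_mul]
    exact neg_mem (mul_mem (pow_mem (inv_mem hy) _) h)
  | mul y z hy hz h1 h2 =>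
    rw [Derivation.leibniz, smul_eq_mul, smul_eq_mul]
    exact add_mem (mul_mem hy h2) (mul_mem hz h1)

/-- The trace to the field of rational functions in `u`, as a function on the curve. -/
def traceTo (u : X.functionField) : X.functionField →ₗ[ℂ] X.functionField :=
  ((IsScalarTower.toAlgHom ℂ (IntermediateField.adjoin ℂ {u}) X.functionField).toLinearMap ∘ₗ
    (Algebra.trace (IntermediateField.adjoin ℂ {u}) X.functionField).restrictScalars ℂ)

theorem traceTo_apply (u f : X.functionField) : traceTo X u f =
    (Algebra.trace (IntermediateField.adjoin ℂ {u}) X.functionField f : X.functionField) := rfl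

section
variable {u : X.functionField} (hu : D ℂ X.functionField u ≠ 0)
include hu

/-- d/du preserves ℂ(u), so it commutes with the trace to ℂ(u). -/
theorem D_traceTo {g f : X.functionField}
    (h : D ℂ X.functionField g = f • D ℂ X.functionField u) :
    D ℂ X.functionField (traceTo X u g) = traceTo X u f • D ℂ X.functionField u := by
  obtain ⟨_, _⟩ := finite_separable_adjoin X hu
  obtain ⟨δ, hδ⟩ := exists_derivation X hu
  have hinj {a b : X.functionField} (h : a • D ℂ X.functionField u = b • D ℂ X.functionField u) :
      a = b := smul_left_injective _ hu h
  have h1 : δ u = 1 := hinj (by rw [← hδ, one_smul])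
  have h2 : δ g = f := hinj (by rw [← hδ, h])
  rw [hδ, traceTo_apply, traceTo_apply, ← h2]
  congr 1
  exact trace_derivation (F := IntermediateField.adjoin ℂ {u}) δ
    (fun c ↦ ⟨δ c, derivation_mem_adjoin δ h1 c⟩) (fun _ ↦ rfl) g

omit hu in
theorem exists_value (x : Point X) {g : X.functionField} (hg : pointValuation X x g ≤ 1) :
    ∃ c : ℂ, pointValuation X x (g - algebraMap ℂ X.functionField c) < 1 := by
  obtain ⟨a, rfl⟩ := (pointValuation_le_one_iff X x g).mp hg
  obtain ⟨c, hc⟩ := exists_sub_algebraMap_mem X x.1 x.2 a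
  refine ⟨c, ?_⟩
  rwa [IsScalarTower.algebraMap_apply ℂ (X.presheaf.stalk x.1) X.functionField, ← map_sub,
    pointValuation_algebraMap_lt_one_iff]

/-- The trace of a function which is regular on the fibre `u = 0` is regular there. -/
theorem traceTo_le_one {f : X.functionField}
    (hf : ∀ x, pointValuation X x u < 1 → pointValuation X x f ≤ 1) (x : Point X)
    (hx : pointValuation X x u < 1) : pointValuation X x (traceTo X u f) ≤ 1 := by
  obtain ⟨_, _⟩ := finite_separable_adjoin X hu
  let F := IntermediateField.adjoin ℂ {u}
  let V (y : Point X) : ValuationSubring X.functionField := (pointValuation X y).valuationSubring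
  -- R consists of the functions of u regular at all zeros of u. If f is integral over R, so is its
  -- trace, which is therefore regular at every zero of u.
  let R : Subring F := ⨅ y : {y // pointValuation X y u < 1},
    (V y).toSubring.comap (algebraMap F X.functionField)
  have hR (r : F) : r ∈ R ↔
      ∀ y, pointValuation X y u < 1 → pointValuation X y (r : X.functionField) ≤ 1 := by
    simp only [R, Subring.mem_iInf, Subtype.forall]
    rfl
  have hint : IsIntegral R f := by
    by_contra hg
    have : IsIntegrallyClosedIn (integralClosure R X.functionField).toSubring X.functionField :=
      inferInstanceAs (IsIntegrallyClosedIn (integralClosure R X.functionField) X.functionField)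
    obtain ⟨W, hW, hgW⟩ := (integralClosure R
      X.functionField).toSubring.exists_le_valuationSubring_of_isIntegrallyClosedIn hg
    have hA (r : F) (hr : r ∈ R) : (r : X.functionField) ∈ W :=
      hW ((integralClosure R X.functionField).algebraMap_mem ⟨r, hr⟩)
    have huR : IntermediateField.AdjoinSimple.gen ℂ u ∈ R := (hR _).mpr fun y hy ↦ hy.le
    obtain ⟨y, hy⟩ := exists_point_of_valuationSubring X W
      (fun c ↦ hA (algebraMap ℂ F c) ((hR _).mpr fun y hy ↦ pointValuation_complex_le_one X y c))
      (fun h ↦ hgW (h ▸ trivial))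
    refine hgW ((hy f).mpr (hf y ?_))
    -- A valuation ring containing R but not f belongs to a point y where u is finite with value c.
    -- If c ≠ 0, then (u - c)⁻¹ lies in R and has a pole at y; so c = 0, and f is regular at y by
    -- hypothesis.
    obtain ⟨c, hc⟩ := exists_value X y ((hy u).mp (hA _ huR))
    obtain rfl | hc0 := eq_or_ne c 0
    · simpa using hc
    have hinv : (IntermediateField.AdjoinSimple.gen ℂ u - algebraMap ℂ F c)⁻¹ ∈ R := by
      refine (hR _).mpr fun z hz ↦ ?_
      change pointValuation X z (u - algebraMap ℂ X.functionField c)⁻¹ ≤ 1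
      rw [map_inv₀, Valuation.map_sub_eq_of_lt_right, pointValuation_complex X z hc0, inv_one]
      rwa [pointValuation_complex X z hc0]
    have h1 := (hy _).mp (hA _ hinv)
    change pointValuation X y (u - algebraMap ℂ X.functionField c)⁻¹ ≤ 1 at h1
    have h2 : pointValuation X y (u - algebraMap ℂ X.functionField c) ≠ 0 := by
      rw [Valuation.ne_zero_iff, sub_ne_zero]
      rintro rfl
      exact hu ((D ℂ X.functionField).map_algebraMap c)
    rw [map_inv₀] at h1
    exact absurd h1 (not_le.mpr ((one_lt_inv₀ (zero_lt_iff.mpr h2)).mpr hc))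
  have : IsIntegrallyClosedIn (V x).toSubring X.functionField :=
    inferInstanceAs (IsIntegrallyClosedIn (V x) X.functionField)
  exact algebraMap_trace_mem R (V x).toSubring (fun r hr ↦ (hR r).mp hr x hx) hint

end

/-! ### Approximation by regular functions and Taylor expansions -/

theorem finite_one_lt (f : X.functionField) : {x | 1 < pointValuation X x f}.Finite := by
  refine (Filter.eventually_cofinite.mp (eventually_mem_localIntegers X f)).subset fun x hx ↦ ?_
  rw [Set.mem_ofPred_eq] at hx ⊢
  rwa [mem_localIntegers_iff, valued_functionField, not_le]

theorem finite_lt_one {f : X.functionField} (hf : f ≠ 0) :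
    {x | pointValuation X x f < 1}.Finite := by
  refine (finite_one_lt X f⁻¹).subset fun x hx ↦ ?_
  rw [Set.mem_ofPred_eq] at hx ⊢
  rwa [map_inv₀, one_lt_inv₀ (zero_lt_iff.mpr ((Valuation.ne_zero_iff _).mpr hf))]

theorem exists_le_exp {ι : Type*} (T : Finset ι) (φ : ι → WithZero (Multiplicative ℤ)) (N : ℕ) :
    ∃ M : ℕ, N ≤ M ∧ ∀ y ∈ T, φ y ≤ WithZero.exp (M : ℤ) := by
  refine ⟨max N (T.sup fun y ↦ (WithZero.log (φ y)).toNat), le_max_left _ _, fun y hy ↦ ?_⟩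
  refine WithZero.le_exp_of_log_le ((Int.self_le_toNat _).trans ?_)
  exact_mod_cast (Finset.le_sup (f := fun y ↦ (WithZero.log (φ y)).toNat) hy).trans
    (le_max_right _ _)

section
variable {u : X.functionField} (hu : D ℂ X.functionField u ≠ 0)
include hu

theorem exists_affineRing_approx {x : Point X} (hx : pointValuation X x u ≤ 1)
    {f : X.functionField} (hf : pointValuation X x f ≤ 1) (N : ℕ) : ∃ b : affineRing X u,
    pointValuation X x (b - f) ≤ WithZero.exp (-N : ℤ) := by
  classical
  -- The poles of f where u is regular. Multiplication by ε, close to 1 at x and small at the other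
  -- points of `T₀`, removes them without changing f much at x.
  let T₀ : Finset (Point X) := (finite_one_lt X f).toFinset.filter fun y ↦ pointValuation X y u ≤ 1
  obtain ⟨M, hNM, hM⟩ := exists_le_exp (insert x T₀) (fun y ↦ pointValuation X y f) N
  obtain ⟨ε, h1, h2⟩ := exists_approx_one X hu (insert x T₀) (by
    intro y hy
    rcases Finset.mem_insert.mp hy with rfl | hy
    · exact hx
    · exact (Finset.mem_filter.mp hy).2) x (Finset.mem_insert_self _ _) M
  have hmem : (ε * f : X.functionField) ∈ affineRing X u := by
    rw [mem_affineRing_iff]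
    intro y hy
    by_cases hyx : y = x
    · subst hyx
      rw [map_mul]
      exact mul_le_one' (affineRing_le_one X hx ε) hf
    rw [map_mul]
    by_cases hfy : pointValuation X y f ≤ 1
    · exact mul_le_one' (affineRing_le_one X hy ε) hfy
    have hyT : y ∈ insert x T₀ := Finset.mem_insert_of_mem (Finset.mem_filter.mpr
      ⟨(finite_one_lt X f).mem_toFinset.mpr (not_le.mp hfy), hy⟩)
    calc _ ≤ WithZero.exp (-M : ℤ) * WithZero.exp (M : ℤ) := mul_le_mul' (h2 y hyT hyx) (hM y hyT)
      _ = 1 := by rw [← WithZero.exp_add]; simp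
  refine ⟨⟨_, hmem⟩, ?_⟩
  have h3 : (ε * f : X.functionField) - f = -((1 - ε) * f) := by ring
  change pointValuation X x ((ε * f : X.functionField) - f) ≤ _
  rw [h3, Valuation.map_neg, map_mul]
  calc _ ≤ WithZero.exp (-M : ℤ) * 1 := mul_le_mul' h1 hf
    _ ≤ _ := by
      rw [mul_one, WithZero.exp_le_exp]
      omega

end

section taylor
variable (x : Point X) {s : X.functionField} (hs : pointValuation X x s = WithZero.exp (-1 : ℤ))
include hs

/-- The next coefficient is the value at x of the remainder divided by sⁿ. With
`eq_zero_of_aeval_le` this identifies germs modulo order n with polynomials of degree less than n in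
the parameter s. -/
theorem exists_taylor {f : X.functionField} (hf : pointValuation X x f ≤ 1) (n : ℕ) :
    ∃ p ∈ Polynomial.degreeLT ℂ n,
      pointValuation X x (f - Polynomial.aeval s p) ≤ WithZero.exp (-n : ℤ) := by
  have hs0 : s ≠ 0 := by
    rintro rfl
    rw [map_zero] at hs
    exact WithZero.exp_ne_zero hs.symm
  induction n with
  | zero => exact ⟨0, zero_mem _, by simpa using hf⟩
  | succ n ih =>
    obtain ⟨p, hp, hpv⟩ := ih
    have h1 : pointValuation X x ((f - Polynomial.aeval s p) / s ^ n) ≤ 1 := by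
      rw [map_div₀, map_pow, hs, ← WithZero.exp_nsmul]
      refine div_le_one_of_le₀ (hpv.trans (le_of_eq ?_)) zero_le
      simp
    obtain ⟨c, hc⟩ := exists_value X x h1
    refine ⟨p + Polynomial.monomial n c, add_mem (Polynomial.degreeLT_mono n.le_succ hp) ?_, ?_⟩
    · rw [Polynomial.mem_degreeLT]
      exact (Polynomial.degree_monomial_le n c).trans_lt (by exact_mod_cast n.lt_succ_self)
    · have h2 : f - Polynomial.aeval s (p + Polynomial.monomial n c) =
          ((f - Polynomial.aeval s p) / s ^ n - algebraMap ℂ X.functionField c) * s ^ n := by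
        rw [map_add, Polynomial.aeval_monomial]
        field_simp
        ring
      rw [h2, map_mul, map_pow, hs, ← WithZero.exp_nsmul]
      calc _ ≤ WithZero.exp (-1 : ℤ) * WithZero.exp (n • (-1 : ℤ)) := by
            gcongr
            exact le_exp_neg_one hc
        _ = _ := by rw [← WithZero.exp_add]; congr 1; push_cast; simp

/-- A nonzero p is Xᵏ q with k < n and q(0) ≠ 0, so p(s) vanishes to order exactly k at x. -/
theorem eq_zero_of_aeval_le {n : ℕ} {p : Polynomial ℂ} (hp : p ∈ Polynomial.degreeLT ℂ n)
    (h : pointValuation X x (Polynomial.aeval s p) ≤ WithZero.exp (-n : ℤ)) : p = 0 := by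
  by_contra hp0
  obtain ⟨q, hq, hq0⟩ := Polynomial.exists_eq_pow_rootMultiplicity_mul_and_not_dvd p hp0 0
  rw [Polynomial.C_0, sub_zero] at hq hq0
  set k := p.rootMultiplicity 0
  have hk : k < n := by
    have h1 : p.natDegree < n := by
      rw [Polynomial.mem_degreeLT, Polynomial.degree_eq_natDegree hp0] at hp
      exact_mod_cast hp
    have h2 := Polynomial.natDegree_le_of_dvd (Dvd.intro _ hq.symm) hp0
    rw [Polynomial.natDegree_X_pow] at h2
    omega
  rw [Polynomial.X_dvd_iff] at hq0
  obtain ⟨r, hr⟩ := Polynomial.X_dvd_sub_C (p := q)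
  have hr' : q = Polynomial.X * r + Polynomial.C (q.coeff 0) := by rw [← hr]; ring
  have hint (r : Polynomial ℂ) : pointValuation X x (Polynomial.aeval s r) ≤ 1 := by
    have hs1 : s ∈ (pointValuation X x).valuationSubring := by
      rw [Valuation.mem_valuationSubring_iff, hs, ← WithZero.exp_zero, WithZero.exp_le_exp]
      omega
    exact polyRing_le X s (V := (pointValuation X x).valuationSubring)
      (pointValuation_complex_le_one X x) hs1 (Polynomial.aeval_mem_adjoin_singleton ℂ s)
  have hqv : pointValuation X x (Polynomial.aeval s q) = 1 := by
    rw [hr', map_add, Polynomial.aeval_C, map_mul, Polynomial.aeval_X,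
      Valuation.map_add_eq_of_lt_right, pointValuation_complex X x hq0]
    rw [pointValuation_complex X x hq0, map_mul, hs]
    refine mul_lt_one_of_lt_of_le ?_ (hint r)
    rw [← WithZero.exp_zero, WithZero.exp_lt_exp]
    omega
  rw [hq, map_mul, map_pow, Polynomial.aeval_X, map_mul, hqv, map_pow, hs, mul_one,
    ← WithZero.exp_nsmul, WithZero.exp_le_exp] at h
  simp at h
  omega
end taylor

-- The trace of an idempotent modulo u is the order of vanishing

attribute [local instance] Ideal.Quotient.field in
-- Trace commutes with reduction modulo I, and A / I = ℂ. Modulo I the element ε is idempotent, so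
-- multiplication by it is a projection, whose trace is the dimension of its image. The last three
-- hypotheses say that Φ identifies V with this image.
theorem intTrace_sub_finrank_mem {A B : Type*} [CommRing A] [IsDedekindDomain A] [CommRing B]
    [IsDomain B] [IsIntegrallyClosed B] [Algebra ℂ A] [Algebra A B] [Algebra ℂ B]
    [IsScalarTower ℂ A B] [Module.Finite A B] [Module.IsTorsionFree A B] (I : Ideal A)
    [I.IsMaximal] (hI : Function.Surjective (algebraMap ℂ (A ⧸ I))) (ε : B)
    {V : Type*} [AddCommGroup V] [Module ℂ V] (Φ : V →ₗ[ℂ] B)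
    (hidem : ε * ε - ε ∈ I.map (algebraMap A B))
    (hinj : ∀ p, Φ p ∈ I.map (algebraMap A B) → p = 0)
    (hΦ : ∀ p, ε * Φ p - Φ p ∈ I.map (algebraMap A B))
    (hsurj : ∀ b, ∃ p, ε * b - Φ p ∈ I.map (algebraMap A B)) :
    Algebra.intTrace A B ε - algebraMap ℂ A (Module.finrank ℂ V) ∈ I := by
  let J := I.map (algebraMap A B)
  have hbij : Function.Bijective (algebraMap ℂ (A ⧸ I)) := ⟨RingHom.injective _, hI⟩
  have : IsScalarTower ℂ (A ⧸ I) (B ⧸ J) := by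
    refine .of_algebraMap_eq fun c ↦ ?_
    rw [IsScalarTower.algebraMap_apply ℂ A (A ⧸ I), IsScalarTower.algebraMap_apply ℂ A (B ⧸ J)]
    rfl
  have hA : Module.Finite ℂ (A ⧸ I) :=
    Module.Finite.of_surjective (Algebra.linearMap ℂ (A ⧸ I)) hI
  have : Module.Finite A (B ⧸ J) := Module.Finite.of_surjective
    (IsScalarTower.toAlgHom A B (B ⧸ J)).toLinearMap Ideal.Quotient.mk_surjective
  have : Module.Finite (A ⧸ I) (B ⧸ J) := .of_restrictScalars_finite A (A ⧸ I) (B ⧸ J)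
  have : Module.Finite ℂ (B ⧸ J) := .trans (A ⧸ I) (B ⧸ J)
  let ε' : B ⧸ J := Ideal.Quotient.mk J ε
  have hidem' : ε' * ε' = ε' := by
    rw [← map_mul]
    exact Ideal.Quotient.eq.mpr hidem
  have hproj : LinearMap.IsProj (LinearMap.range (LinearMap.mul ℂ (B ⧸ J) ε'))
      (LinearMap.mul ℂ (B ⧸ J) ε') := by
    refine ⟨fun y ↦ ⟨y, rfl⟩, ?_⟩
    rintro _ ⟨y, rfl⟩
    rw [LinearMap.mul_apply', LinearMap.mul_apply', ← mul_assoc, hidem']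
  let Ψ : V →ₗ[ℂ] B ⧸ J := (Ideal.Quotient.mkₐ ℂ J).toLinearMap ∘ₗ Φ
  have hΨ : Function.Injective Ψ := by
    rw [injective_iff_map_eq_zero]
    exact fun p hp ↦ hinj p (Ideal.Quotient.eq_zero_iff_mem.mp hp)
  have hrange : LinearMap.range Ψ = LinearMap.range (LinearMap.mul ℂ (B ⧸ J) ε') := by
    ext q
    constructor
    · rintro ⟨p, rfl⟩
      exact ⟨Ψ p, ((map_mul _ _ _).symm.trans (Ideal.Quotient.eq.mpr (hΦ p)))⟩
    · rintro ⟨q, rfl⟩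
      obtain ⟨b, rfl⟩ := Ideal.Quotient.mk_surjective q
      obtain ⟨p, hp⟩ := hsurj b
      exact ⟨p, ((map_mul _ _ _).symm.trans (Ideal.Quotient.eq.mpr hp)).symm⟩
  have htr : Algebra.trace ℂ (B ⧸ J) ε' = Module.finrank ℂ V := by
    rw [Algebra.trace_apply]
    change LinearMap.trace ℂ (B ⧸ J) (LinearMap.mul ℂ (B ⧸ J) ε') = _
    rw [hproj.trace, ← hrange, LinearMap.finrank_range_of_inj hΨ]
  have h3 := Algebra.trace_eq_of_equiv_equiv (RingEquiv.ofBijective _ hbij)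
    (RingEquiv.refl (B ⧸ J)) (by ext c; exact (IsScalarTower.algebraMap_apply ℂ (A ⧸ I) (B ⧸ J) c).symm) ε'
  rw [htr, eq_comm, RingEquiv.symm_apply_eq] at h3
  have h4 := Algebra.trace_quotient_eq_of_isDedekindDomain (S := B) I ε
  rw [← Ideal.Quotient.eq, ← h4]
  exact h3

theorem exists_eq_add_mul (u : X.functionField) {a : X.functionField} (ha : a ∈ polyRing X u) :
    ∃ c : ℂ, ∃ b ∈ polyRing X u, a = algebraMap ℂ X.functionField c + u * b := by
  induction ha using Algebra.adjoin_induction with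
  | mem y hy =>
    obtain rfl := hy
    exact ⟨0, 1, one_mem _, by simp⟩
  | algebraMap c => exact ⟨c, 0, zero_mem _, by simp⟩
  | add _ _ _ _ h1 h2 =>
    obtain ⟨c, b, hb, rfl⟩ := h1
    obtain ⟨c', b', hb', rfl⟩ := h2
    exact ⟨c + c', b + b', add_mem hb hb', by rw [map_add]; ring⟩
  | mul y z _ hz h1 h2 =>
    obtain ⟨c, b, hb, rfl⟩ := h1
    obtain ⟨c', b', hb', h2⟩ := h2
    refine ⟨c * c', b * z + algebraMap ℂ X.functionField c * b',
      add_mem (mul_mem hb hz) (mul_mem (Subalgebra.algebraMap_mem _ c) hb'), ?_⟩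
    rw [map_mul]
    linear_combination algebraMap ℂ X.functionField c * h2

theorem finrank_degreeLT (n : ℕ) : Module.finrank ℂ (Polynomial.degreeLT ℂ n) = n := by
  rw [(Polynomial.degreeLTEquiv ℂ n).finrank_eq, Module.finrank_fin_fun]

section
variable {u : X.functionField} (hu : D ℂ X.functionField u ≠ 0)
include hu

/-- `u` as an element of the ring of polynomials in `u`. -/
abbrev polyRingGen (u : X.functionField) : polyRing X u :=
  ⟨u, Algebra.self_mem_adjoin_singleton ℂ u⟩

/-- Divisibility by u is tested at the points: b / u is regular wherever u is, the zeros of u being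
the only places in question. -/
theorem mem_map_span_of_le (b : affineRing X u)
    (hb : ∀ y, pointValuation X y u < 1 → pointValuation X y (b : X.functionField) ≤ pointValuation X y u) :
    b ∈ (Ideal.span {polyRingGen X u}).map (algebraMap (polyRing X u) (affineRing X u)) := by
  have hu0 : u ≠ 0 := by
    rintro rfl
    exact hu (map_zero _)
  have hmem : (b / u : X.functionField) ∈ affineRing X u := by
    rw [mem_affineRing_iff]
    intro y hy
    rw [map_div₀]
    refine div_le_one_of_le₀ ?_ zero_le
    rcases hy.lt_or_eq with hy' | hy'
    · exact hb y hy'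
    · rw [hy']
      exact affineRing_le_one X hy b
  rw [Ideal.map_span, Set.image_singleton, Ideal.mem_span_singleton]
  refine ⟨⟨_, hmem⟩, Subtype.ext ?_⟩
  change (b : X.functionField) = u * (b / u)
  field_simp

omit hu in
theorem le_of_mem_map_span {b : affineRing X u}
    (hb : b ∈ (Ideal.span {polyRingGen X u}).map (algebraMap (polyRing X u) (affineRing X u)))
    {y : Point X} (hy : pointValuation X y u ≤ 1) :
    pointValuation X y (b : X.functionField) ≤ pointValuation X y u := by
  rw [Ideal.map_span, Set.image_singleton, Ideal.mem_span_singleton] at hb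
  obtain ⟨c, rfl⟩ := hb
  change pointValuation X y (u * (c : X.functionField)) ≤ _
  rw [map_mul]
  exact mul_le_of_le_one_right' (affineRing_le_one X hy c)

omit hu in
theorem pointValuation_eq_one_of_one_sub {x : Point X} (hx : pointValuation X x u < 1)
    (ε : X.functionField) (h1 : pointValuation X x (1 - ε) ≤ pointValuation X x u) :
    pointValuation X x ε = 1 := by
  rw [← map_one (pointValuation X x)]
  refine Valuation.map_eq_of_sub_lt _ ?_
  rw [Valuation.map_sub_swap, map_one]
  exact h1.trans_lt hx

theorem idempotent_mod {x : Point X} (hx : pointValuation X x u < 1) (ε : affineRing X u)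
    (h1 : pointValuation X x (1 - ε : X.functionField) ≤ pointValuation X x u)
    (h2 : ∀ y, y ≠ x → pointValuation X y u < 1 →
      pointValuation X y (ε : X.functionField) ≤ pointValuation X y u) :
    ε * ε - ε ∈ (Ideal.span {polyRingGen X u}).map
      (algebraMap (polyRing X u) (affineRing X u)) := by
  refine mem_map_span_of_le X hu _ fun y hy ↦ ?_
  change pointValuation X y ((ε : X.functionField) * ε - ε) ≤ _
  by_cases hyx : y = x
  · subst hyx
    rw [show (ε : X.functionField) * ε - ε = -(ε * (1 - ε)) by ring, Valuation.map_neg, map_mul,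
      pointValuation_eq_one_of_one_sub X hx _ h1, one_mul]
    exact h1
  · rw [show (ε : X.functionField) * ε - ε = ε * (ε - 1) by ring, map_mul]
    exact (mul_le_of_le_one_right' (affineRing_le_one X hy.le (ε - 1))).trans (h2 y hyx hy)

-- ε is, modulo u, the idempotent of the factor of x in the affine ring, and that factor has
-- dimension the order n of u at x, a basis being 1, s, …, sⁿ⁻¹ for a parameter s. Hence tr(ε) ≡ n
-- modulo u.
open IntermediateField.algebraAdjoinAdjoin in
theorem traceTo_eq_add_mul {x : Point X} (hx : pointValuation X x u < 1) (ε : affineRing X u)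
    (h1 : pointValuation X x (1 - ε : X.functionField) ≤ pointValuation X x u)
    (h2 : ∀ y, y ≠ x → pointValuation X y u < 1 →
      pointValuation X y (ε : X.functionField) ≤ pointValuation X y u) :
    ∃ a ∈ polyRing X u, traceTo X u ε =
      algebraMap ℂ X.functionField (order X x u) + u * a := by
  obtain ⟨_, _⟩ := finite_separable_adjoin X hu
  obtain ⟨_, _, _⟩ := affineRing_facts X hu
  have hPID := isPrincipalIdealRing_polyRing X (transcendental_of_D_ne_zero X hu)
  have hprime := prime_polyRing_self X (transcendental_of_D_ne_zero X hu)
  have hmax : (Ideal.span {polyRingGen X u}).IsMaximal :=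
    PrincipalIdealRing.isMaximal_of_irreducible hprime.irreducible
  have hI : Function.Surjective (algebraMap ℂ (polyRing X u ⧸ Ideal.span {polyRingGen X u})) := by
    intro q
    obtain ⟨a, rfl⟩ := Ideal.Quotient.mk_surjective q
    obtain ⟨c, b, hb, hab⟩ := exists_eq_add_mul X u a.2
    refine ⟨c, ?_⟩
    rw [IsScalarTower.algebraMap_apply ℂ (polyRing X u), Ideal.Quotient.algebraMap_eq, eq_comm,
      Ideal.Quotient.eq, Ideal.mem_span_singleton]
    refine ⟨⟨b, hb⟩, Subtype.ext ?_⟩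
    change (a : X.functionField) - algebraMap ℂ X.functionField c = u * b
    rw [hab, add_sub_cancel_left]
  have hu0 : u ≠ 0 := by
    rintro rfl
    exact hu (map_zero _)
  obtain ⟨n, hn⟩ : ∃ n : ℕ, order X x u = n :=
    ⟨(order X x u).toNat, (Int.toNat_of_nonneg (by
      have := pointValuation_order_pos X x hu0 hx
      omega)).symm⟩
  have hvu : pointValuation X x u = WithZero.exp (-n : ℤ) := by
    rw [pointValuation_eq_exp X x hu0, hn]
  obtain ⟨t, ht⟩ := IsDiscreteValuationRing.exists_irreducible (X.presheaf.stalk x.1)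
  -- Agreement with t to order 2 is enough for s to be a parameter at x; it is moreover regular
  -- wherever u is.
  obtain ⟨s, hs⟩ := exists_affineRing_approx X hu hx.le (pointValuation_algebraMap_le_one X x t) 2
  have hs1 : pointValuation X x (s : X.functionField) = WithZero.exp (-1 : ℤ) := by
    rw [← pointValuation_uniformizer X x ht]
    refine Valuation.map_eq_of_sub_lt _ (hs.trans_lt ?_)
    rw [pointValuation_uniformizer X x ht, WithZero.exp_lt_exp]
    simp
  -- Taylor polynomials at x, carried to the factor of x by ε: injectivity is uniqueness of the
  -- Taylor expansion, surjectivity its existence. At the other zeros of u the factor ε already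
  -- gives divisibility by u.
  let Φ : Polynomial.degreeLT ℂ n →ₗ[ℂ] affineRing X u :=
    LinearMap.mulLeft ℂ ε ∘ₗ (Polynomial.aeval s).toLinearMap ∘ₗ (Polynomial.degreeLT ℂ n).subtype
  have hΦ (p : Polynomial.degreeLT ℂ n) : Φ p = ε * Polynomial.aeval s (p : Polynomial ℂ) := rfl
  have hcoe (p : Polynomial ℂ) : ((Polynomial.aeval s p : affineRing X u) : X.functionField) =
      Polynomial.aeval (s : X.functionField) p :=
    (Polynomial.aeval_algebraMap_apply X.functionField s p).symm
  have hε1 := pointValuation_eq_one_of_one_sub X hx (ε : X.functionField) h1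
  have hidem := idempotent_mod X hu hx ε h1 h2
  have hmem := intTrace_sub_finrank_mem (B := affineRing X u) (Ideal.span {polyRingGen X u}) hI ε Φ
    hidem ?_ ?_ ?_
  · have hint := Algebra.algebraMap_intTrace (A := polyRing X u) (B := affineRing X u)
      (K := IntermediateField.adjoin ℂ {u}) (L := X.functionField) ε
    obtain ⟨a, ha⟩ := Ideal.mem_span_singleton.mp hmem
    refine ⟨a, a.2, ?_⟩
    have h4 : ((Algebra.intTrace (polyRing X u) (affineRing X u) ε : polyRing X u) :
      X.functionField) = traceTo X u ε := congrArg Subtype.val hint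
    have h5 : ((Algebra.intTrace (polyRing X u) (affineRing X u) ε : polyRing X u) :
      X.functionField) - algebraMap ℂ X.functionField (Module.finrank ℂ (Polynomial.degreeLT ℂ n)) =
      u * a := congrArg Subtype.val ha
    rw [finrank_degreeLT, h4] at h5
    rw [hn, Int.cast_natCast]
    exact sub_eq_iff_eq_add'.mp h5
  · intro p hp
    have h3 := le_of_mem_map_span X hp hx.le
    rw [hΦ, MulMemClass.coe_mul, map_mul, hε1, one_mul, hcoe, hvu] at h3
    exact Subtype.ext (eq_zero_of_aeval_le X x hs1 p.2 h3)
  · intro p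
    rw [hΦ, ← mul_assoc, ← sub_mul]
    exact Ideal.mul_mem_right _ _ hidem
  · intro b
    obtain ⟨p, hp, hpb⟩ := exists_taylor X x hs1 (affineRing_le_one X hx.le b) n
    refine ⟨⟨p, hp⟩, ?_⟩
    rw [hΦ, ← mul_sub]
    refine mem_map_span_of_le X hu _ fun y hy ↦ ?_
    rw [MulMemClass.coe_mul, map_mul]
    by_cases hyx : y = x
    · subst hyx
      rw [hε1, one_mul, hvu]
      refine le_of_eq_of_le (congrArg _ ?_) hpb
      exact congrArg (fun z ↦ (b : X.functionField) - z) (hcoe p)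
    · exact (mul_le_of_le_one_right' (affineRing_le_one X hy.le _)).trans (h2 y hyx hy)
end

/-! ### The degree formula, and residues of a trace over the zeros of u -/

theorem traceTo_mul (u : X.functionField) {c : X.functionField}
    (hc : c ∈ IntermediateField.adjoin ℂ {u}) (f : X.functionField) :
    traceTo X u (c * f) = c * traceTo X u f := by
  rw [traceTo_apply, traceTo_apply]
  exact congrArg Subtype.val
    ((Algebra.trace (IntermediateField.adjoin ℂ {u}) X.functionField).map_smul ⟨c, hc⟩ f)

theorem mem_adjoin_self (u : X.functionField) : u ∈ IntermediateField.adjoin ℂ {u} :=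
  IntermediateField.mem_adjoin_simple_self ℂ u

section
variable {u : X.functionField} (hu : D ℂ X.functionField u ≠ 0)
include hu

theorem ne_zero_of_D_ne_zero : u ≠ 0 := by
  rintro rfl
  exact hu (map_zero _)

theorem traceTo_one : traceTo X u 1 =
    (Module.finrank (IntermediateField.adjoin ℂ {u}) X.functionField : X.functionField) := by
  obtain ⟨_, _⟩ := finite_separable_adjoin X hu
  rw [traceTo_apply, ← map_one (algebraMap (IntermediateField.adjoin ℂ {u}) X.functionField),
    Algebra.trace_algebraMap]
  simp

open IntermediateField.algebraAdjoinAdjoin in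
theorem traceTo_mem_polyRing (b : affineRing X u) : traceTo X u b ∈ polyRing X u := by
  obtain ⟨_, _⟩ := finite_separable_adjoin X hu
  obtain ⟨_, _, _⟩ := affineRing_facts X hu
  have := isPrincipalIdealRing_polyRing X (transcendental_of_D_ne_zero X hu)
  have hint := Algebra.algebraMap_intTrace (A := polyRing X u) (B := affineRing X u)
    (K := IntermediateField.adjoin ℂ {u}) (L := X.functionField) b
  have h4 : ((Algebra.intTrace (polyRing X u) (affineRing X u) b : polyRing X u) :
      X.functionField) = traceTo X u b := congrArg Subtype.val hint
  rw [← h4]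
  exact Subtype.prop _

/-- Weak approximation at finitely many points. -/
theorem weak_approximation (T : Finset (Point X)) (hT : ∀ x ∈ T, pointValuation X x u ≤ 1)
    (g : Point X → X.functionField) (N : ℕ) :
    ∃ h : X.functionField, ∀ y ∈ T, pointValuation X y (h - g y) ≤ WithZero.exp (-N : ℤ) := by
  classical
  -- M bounds the poles that the functions `g x` may have at the points of `T`; approximate
  -- idempotents of precision N + M absorb them.
  obtain ⟨M, -, hM⟩ := exists_le_exp (T ×ˢ T) (fun p ↦ pointValuation X p.1 (g p.2)) 0
  have hex (x : Point X) : ∃ ε : X.functionField, x ∈ T →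
      pointValuation X x (1 - ε) ≤ WithZero.exp (-(N + M : ℕ) : ℤ) ∧
      ∀ y ∈ T, y ≠ x → pointValuation X y ε ≤ WithZero.exp (-(N + M : ℕ) : ℤ) := by
    by_cases hx : x ∈ T
    · obtain ⟨b, hb⟩ := exists_approx_one X hu T hT x hx (N + M)
      exact ⟨b, fun _ ↦ hb⟩
    · exact ⟨0, fun h ↦ absurd h hx⟩
  choose ε hε using hex
  refine ⟨∑ x ∈ T, ε x * g x, fun y hy ↦ ?_⟩
  have hbound {a : X.functionField} {x : Point X} (hx : x ∈ T)
      (ha : pointValuation X y a ≤ WithZero.exp (-(N + M : ℕ) : ℤ)) :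
      pointValuation X y (a * g x) ≤ WithZero.exp (-N : ℤ) := by
    rw [map_mul]
    calc _ ≤ WithZero.exp (-(N + M : ℕ) : ℤ) * WithZero.exp (M : ℤ) :=
          mul_le_mul' ha (hM (y, x) (Finset.mk_mem_product hy hx))
      _ = _ := by rw [← WithZero.exp_add]; congr 1; push_cast; ring
  rw [← Finset.add_sum_erase T _ hy, show ε y * g y + ∑ x ∈ T.erase y, ε x * g x - g y =
    ∑ x ∈ T.erase y, ε x * g x - (1 - ε y) * g y by ring]
  refine Valuation.map_sub_le _ ?_ (hbound hy (hε y hy).1)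
  refine Valuation.map_sum_le _ fun x hx ↦ ?_
  obtain ⟨hxy, hx⟩ := Finset.mem_erase.mp hx
  exact hbound hx ((hε x hx).2 y hy hxy.symm)

/-- The precision M exceeds the order of every zero of u, so closeness to 1 or 0 becomes congruence
modulo u. -/
theorem exists_idempotents (T : Finset (Point X)) (hT : ∀ x, x ∈ T ↔ pointValuation X x u < 1) :
    ∃ ε : Point X → affineRing X u, ∀ x ∈ T,
      pointValuation X x (1 - ε x : X.functionField) ≤ pointValuation X x u ∧
      ∀ y, y ≠ x → pointValuation X y u < 1 →
        pointValuation X y (ε x : X.functionField) ≤ pointValuation X y u := by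
  have hu0 := ne_zero_of_D_ne_zero X hu
  obtain ⟨M, -, hM⟩ := exists_le_exp T (fun x ↦ pointValuation X x u⁻¹) 0
  have hM' (y : Point X) (hy : y ∈ T) : WithZero.exp (-M : ℤ) ≤ pointValuation X y u := by
    have := hM y hy
    rw [map_inv₀] at this
    rw [WithZero.exp_neg]
    exact inv_le_of_inv_le₀ (zero_lt_iff.mpr ((Valuation.ne_zero_iff _).mpr hu0)) this
  have hex (x : Point X) : ∃ ε : affineRing X u, x ∈ T →
      pointValuation X x (1 - ε : X.functionField) ≤ WithZero.exp (-M : ℤ) ∧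
      ∀ y ∈ T, y ≠ x → pointValuation X y (ε : X.functionField) ≤ WithZero.exp (-M : ℤ) := by
    by_cases hx : x ∈ T
    · obtain ⟨b, hb⟩ := exists_approx_one X hu T (fun x hx ↦ ((hT x).mp hx).le) x hx M
      exact ⟨b, fun _ ↦ hb⟩
    · exact ⟨0, fun h ↦ absurd h hx⟩
  choose ε hε using hex
  exact ⟨ε, fun x hx ↦ ⟨(hε x hx).1.trans (hM' x hx), fun y hyx hy ↦
    ((hε x hx).2 y ((hT y).mpr hy) hyx).trans (hM' y ((hT y).mpr hy))⟩⟩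

/-- The number of zeros of `u`, with multiplicities, is the degree over the field of rational
functions in `u`. -/
theorem sum_order (T : Finset (Point X)) (hT : ∀ x, x ∈ T ↔ pointValuation X x u < 1) :
    ∑ x ∈ T, (order X x u : ℂ) =
      Module.finrank (IntermediateField.adjoin ℂ {u}) X.functionField := by
  classical
  obtain ⟨ε, hε⟩ := exists_idempotents X hu T hT
  have hex (x : Point X) : ∃ a : X.functionField, x ∈ T → a ∈ polyRing X u ∧
      traceTo X u (ε x) = algebraMap ℂ X.functionField (order X x u) + u * a := by
    by_cases hx : x ∈ T
    · obtain ⟨a, ha⟩ := traceTo_eq_add_mul X hu ((hT x).mp hx) (ε x) (hε x hx).1 (hε x hx).2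
      exact ⟨a, fun _ ↦ ha⟩
    · exact ⟨0, fun h ↦ absurd h hx⟩
  choose a ha using hex
  -- The ε add up to 1 modulo u. The trace of this relation is n ≡ ∑ e_x modulo u.
  have hmem := mem_map_span_of_le X hu (1 - ∑ x ∈ T, ε x) (by
    intro y hy
    have hyT := (hT y).mpr hy
    rw [← Finset.add_sum_erase T _ hyT, ← sub_sub]
    change pointValuation X y ((1 - ε y : X.functionField) -
      (affineRing X u).val (∑ x ∈ T.erase y, ε x)) ≤ _
    rw [map_sum]
    refine Valuation.map_sub_le _ (hε y hyT).1 (Valuation.map_sum_le _ fun x hx ↦ ?_)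
    obtain ⟨hxy, hx⟩ := Finset.mem_erase.mp hx
    exact (hε x hx).2 y hxy.symm hy)
  rw [Ideal.map_span, Set.image_singleton, Ideal.mem_span_singleton] at hmem
  obtain ⟨c, hc⟩ := hmem
  have hc' : (1 : X.functionField) = ∑ x ∈ T, (ε x : X.functionField) + u * c := by
    have h := congrArg (affineRing X u).val hc
    rw [map_sub, map_sum, map_one, map_mul] at h
    exact sub_eq_iff_eq_add'.mp h
  set n := Module.finrank (IntermediateField.adjoin ℂ {u}) X.functionField
  have htr := congrArg (traceTo X u) hc'
  rw [traceTo_one X hu, map_add, map_sum, traceTo_mul X u (mem_adjoin_self X u)] at htr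
  have h2 : algebraMap ℂ X.functionField (n - ∑ x ∈ T, (order X x u : ℂ)) =
      u * (∑ x ∈ T, a x + traceTo X u c) := by
    rw [map_sub, map_natCast, htr, Finset.sum_congr rfl fun x hx ↦ (ha x hx).2,
      Finset.sum_add_distrib, ← Finset.mul_sum, map_sum]
    ring
  by_contra hne
  -- A nonzero constant divisible by u in ℂ[u] would make the prime u a unit.
  have hk : (n - ∑ x ∈ T, (order X x u : ℂ)) ≠ 0 := sub_ne_zero.mpr (Ne.symm hne)
  set k := (n - ∑ x ∈ T, (order X x u : ℂ))
  refine (prime_polyRing_self X (transcendental_of_D_ne_zero X hu)).not_isUnit ?_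
  refine IsUnit.of_mul_eq_one
    (algebraMap ℂ (polyRing X u) k⁻¹ * ⟨∑ x ∈ T, a x + traceTo X u c,
      add_mem (sum_mem fun x hx ↦ (ha x hx).1) (traceTo_mem_polyRing X hu c)⟩) (Subtype.ext ?_)
  change u * (algebraMap ℂ X.functionField k⁻¹ * (∑ x ∈ T, a x + traceTo X u c)) = 1
  rw [mul_left_comm, ← h2, ← map_mul, inv_mul_cancel₀ hk, map_one]

/-- Residues of `f du` over the zeros of `u` can be computed after taking the trace of `f`. -/
theorem sum_formResidue_traceTo (T : Finset (Point X))
    (hT : ∀ x, x ∈ T ↔ pointValuation X x u < 1) (f : X.functionField) :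
    ∑ x ∈ T, formResidue X x (traceTo X u f • D ℂ X.functionField u) =
      Module.finrank (IntermediateField.adjoin ℂ {u}) X.functionField *
        ∑ x ∈ T, formResidue X x (f • D ℂ X.functionField u) := by
  classical
  have hu0 := ne_zero_of_D_ne_zero X hu
  have hinj {a b : X.functionField} (h : a • D ℂ X.functionField u = b • D ℂ X.functionField u) :
      a = b := smul_left_injective _ hu h
  obtain ⟨ε, hε⟩ := exists_idempotents X hu T hT
  have he0 (x : Point X) (hx : x ∈ T) : (order X x u : ℂ) ≠ 0 := by
    have := pointValuation_order_pos X x hu0 ((hT x).mp hx)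
    rw [Int.cast_ne_zero]
    omega
  -- ε_x du / u has residue e_x at x and 0 at the other zeros of u, so subtracting the α_x ε_x / u
  -- removes every residue of f du over the fibre.
  let α (x : Point X) : ℂ := formResidue X x (f • D ℂ X.functionField u) / order X x u
  have hα (x : Point X) (hx : x ∈ T) :
      α x * order X x u = formResidue X x (f • D ℂ X.functionField u) :=
    div_mul_cancel₀ _ (he0 x hx)
  let f₁ : X.functionField := f - ∑ x ∈ T, α x • ((ε x : X.functionField) * u⁻¹)
  have hres (y : Point X) (hy : y ∈ T) : formResidue X y (f₁ • D ℂ X.functionField u) = 0 := by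
    have h1 (x : Point X) (hx : x ∈ T) :
        formResidue X y (((ε x : X.functionField) * u⁻¹) • D ℂ X.functionField u) =
          if x = y then (order X y u : ℂ) else 0 := by
      split_ifs with hxy
      · subst hxy
        rw [formResidue_logarithmic X x hu0 (c := 1), one_mul]
        rw [map_one, Valuation.map_sub_swap]
        exact (hε x hx).1.trans_lt ((hT x).mp hx)
      · rw [formResidue_logarithmic X y hu0 (c := 0), zero_mul]
        rw [map_zero, sub_zero]
        exact ((hε x hx).2 y (Ne.symm hxy) ((hT y).mp hy)).trans_lt ((hT y).mp hy)
    rw [sub_smul, Finset.sum_smul, map_sub, map_sum, sub_eq_zero,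
      Finset.sum_congr rfl fun x hx ↦ by
        rw [smul_assoc, map_smul, h1 x hx, smul_eq_mul, mul_ite, mul_zero],
      Finset.sum_ite_eq' T y, if_pos hy, hα y hy]
  have hloc (y : Point X) : ∃ g f₀ : X.functionField, y ∈ T → pointValuation X y f₀ ≤ 1 ∧
      f₁ • D ℂ X.functionField u = D ℂ X.functionField g + f₀ • D ℂ X.functionField u := by
    by_cases hy : y ∈ T
    · obtain ⟨g, f₀, h⟩ := exists_local_antiderivative X y hu0 ((hT y).mp hy) f₁ (hres y hy)
      exact ⟨g, f₀, fun _ ↦ h⟩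
    · exact ⟨0, 0, fun h ↦ absurd h hy⟩
  choose g f₀ hg using hloc
  obtain ⟨M, -, hM⟩ := exists_le_exp T (fun x ↦ pointValuation X x u⁻¹) 0
  have hM' (y : Point X) (hy : y ∈ T) : WithZero.exp (-M : ℤ) ≤ pointValuation X y u := by
    have := hM y hy
    rw [map_inv₀] at this
    rw [WithZero.exp_neg]
    exact inv_le_of_inv_le₀ (zero_lt_iff.mpr ((Valuation.ne_zero_iff _).mpr hu0)) this
  -- One global h replaces the local antiderivatives. Precision M makes h - g_y divisible by u at y,
  -- so that d(h - g_y) is a regular multiple of du.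
  obtain ⟨h, hh⟩ := weak_approximation X hu T (fun x hx ↦ ((hT x).mp hx).le) g M
  obtain ⟨δ, hδ⟩ := exists_derivation X hu
  have hf₂ (y : Point X) (hy : pointValuation X y u < 1) : pointValuation X y (f₁ - δ h) ≤ 1 := by
    have hyT := (hT y).mpr hy
    obtain ⟨w, hw, hDw⟩ := exists_D_eq_smul_of_le X y hu0 hy ((hh y hyT).trans (hM' y hyT))
    have h2 : f₁ - δ h = f₀ y - w := hinj (by
      rw [sub_smul f₁, ← hδ, (hg y hyT).2, sub_smul (f₀ y), ← hDw, map_sub]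
      abel)
    rw [h2]
    exact Valuation.map_sub_le _ (hg y hyT).1 hw
  -- Only the first sum contributes to residues of the trace: the trace of δ h is a derivative and
  -- that of f₁ - δ h is regular over u = 0.
  have hf : f = ∑ x ∈ T, α x • (u⁻¹ * (ε x : X.functionField)) + δ h + (f₁ - δ h) := by
    simp only [f₁, mul_comm u⁻¹]
    ring
  have hex (x : Point X) : ∃ a : X.functionField, x ∈ T → a ∈ polyRing X u ∧
      traceTo X u (ε x) = algebraMap ℂ X.functionField (order X x u) + u * a := by
    by_cases hx : x ∈ T
    · obtain ⟨a, ha⟩ := traceTo_eq_add_mul X hu ((hT x).mp hx) (ε x) (hε x hx).1 (hε x hx).2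
      exact ⟨a, fun _ ↦ ha⟩
    · exact ⟨0, fun h ↦ absurd h hx⟩
  choose a ha using hex
  -- tr(ε_x / u) = e_x / u plus a polynomial in u, and du / u has residue e_y at y. Summation over y
  -- brings in ∑ e_y = n.
  have hmain (y : Point X) (hy : y ∈ T) :
      formResidue X y (traceTo X u f • D ℂ X.functionField u) =
        (∑ x ∈ T, α x * order X x u) * order X y u := by
    have hyu := (hT y).mp hy
    have h1 (x : Point X) (hx : x ∈ T) : formResidue X y
        (traceTo X u (u⁻¹ * (ε x : X.functionField)) • D ℂ X.functionField u) =
          order X x u * order X y u := by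
      rw [traceTo_mul X u (inv_mem (mem_adjoin_self X u)), mul_comm,
        formResidue_logarithmic X y hu0]
      rw [(ha x hx).2, add_sub_cancel_left, map_mul]
      exact mul_lt_one_of_lt_of_le hyu (polyRing_le X u
        (V := (pointValuation X y).valuationSubring) (pointValuation_complex_le_one X y) hyu.le
        (ha x hx).1)
    rw [hf, map_add, map_add, add_smul, add_smul, map_add, map_add,
      ← D_traceTo X hu (hδ h), formResidue_D, add_zero,
      formResidue_eq_zero_of_integral X y hyu.le (traceTo_le_one X hu hf₂ y hyu), add_zero,
      map_sum, Finset.sum_smul, map_sum, Finset.sum_mul]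
    refine Finset.sum_congr rfl fun x hx ↦ ?_
    rw [LinearMap.map_smul (traceTo X u), smul_assoc, LinearMap.map_smul (formResidue X y),
      h1 x hx, smul_eq_mul, mul_assoc]
  rw [Finset.sum_congr rfl hmain, ← Finset.mul_sum, sum_order X hu T hT,
    Finset.sum_congr rfl hα, mul_comm]

end

/-! ### Coordinates and partial fractions on the projective line -/

section
variable {L : Type*} [Field L] [Algebra ℂ L] (t : L)

/-- The coordinate on the projective line, with coordinate `t`, which vanishes at the given point;
`none` is the point at infinity. -/
def coord : Option ℂ → L
  | none => t⁻¹
  | some a => t - algebraMap ℂ L a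

/-- The rational functions of `t` with a single pole, at the given point. -/
def polar : Option ℂ → ℕ → L
  | none, k => t ^ k
  | some a, k => ((t - algebraMap ℂ L a)⁻¹) ^ (k + 1)

/-- Half the order of the pole of `dt` at a point of the projective line. -/
def shift : Option ℂ → ℕ
  | none => 1
  | some _ => 0

/-- The sign in the expression of `dt` in a local coordinate of the projective line. -/
def coordSign : Option ℂ → ℂ
  | none => -1
  | some _ => 1

theorem coordSign_ne_zero (y : Option ℂ) : coordSign y ≠ 0 := by
  cases y <;> simp [coordSign]

/-- The indexing makes polar parts dual to powers: for v the coordinate at y, `polar t y k * v ^ (j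
+ shift y)` times dt is ± v^(j - k - 1) dv. -/
theorem polar_eq_zpow (y : Option ℂ) (k : ℕ) :
    polar t y k = coord t y ^ ((shift y : ℤ) - k - 1) := by
  cases y with
  | none => simp [polar, coord, shift]
  | some a =>
    simp only [polar, coord, shift, inv_pow]
    rw [← zpow_natCast, ← zpow_neg]
    congr 1
    push_cast
    ring

/-- Induction on k from t / (t - a) = 1 + a / (t - a) and, for b ≠ a, from 1 / ((t - b)(t - a)) = (b
- a)⁻¹ (1 / (t - b) - 1 / (t - a)). -/
theorem span_polar_mul_inv (ht : ∀ a, t - algebraMap ℂ L a ≠ 0) (a : ℂ) {c : L}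
    (hc : c ∈ Submodule.span ℂ (Set.range fun p : Option ℂ × ℕ ↦ polar t p.1 p.2)) :
    c * (t - algebraMap ℂ L a)⁻¹ ∈
      Submodule.span ℂ (Set.range fun p : Option ℂ × ℕ ↦ polar t p.1 p.2) := by
  set N := Submodule.span ℂ (Set.range fun p : Option ℂ × ℕ ↦ polar t p.1 p.2)
  have hmem (y : Option ℂ) (k : ℕ) : polar t y k ∈ N := Submodule.subset_span ⟨(y, k), rfl⟩
  induction hc using Submodule.span_induction with
  | mem z hz =>
    obtain ⟨⟨y, k⟩, rfl⟩ := hz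
    dsimp only
    cases y with
    | none =>
      induction k with
      | zero => simpa [polar] using hmem (some a) 0
      | succ k ih =>
        have : polar t none (k + 1) * (t - algebraMap ℂ L a)⁻¹ =
            polar t none k + a • (polar t none k * (t - algebraMap ℂ L a)⁻¹) := by
          have := ht a
          simp only [polar, Algebra.smul_def]
          field_simp
          ring
        rw [this]
        exact add_mem (hmem _ _) (Submodule.smul_mem _ _ ih)
    | some b =>
      by_cases hab : b = a
      · subst hab
        simpa [polar, pow_succ] using hmem (some b) (k + 1)
      · have h0 : (b - a)  ≠ 0 := sub_ne_zero.mpr hab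
        have h1 : algebraMap ℂ L b - algebraMap ℂ L a ≠ 0 := by
          rw [← map_sub]; exact (map_ne_zero _).mpr h0
        have key : (t - algebraMap ℂ L b)⁻¹ * (t - algebraMap ℂ L a)⁻¹ =
            (b - a)⁻¹ • ((t - algebraMap ℂ L b)⁻¹ - (t - algebraMap ℂ L a)⁻¹) := by
          have := ht a
          have := ht b
          rw [Algebra.smul_def, map_inv₀, map_sub]
          field_simp
          ring
        induction k with
        | zero =>
          simp only [polar, zero_add, pow_one, key]
          have h2 := hmem (some b) 0
          have h3 := hmem (some a) 0
          simp only [polar, zero_add, pow_one] at h2 h3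
          exact Submodule.smul_mem _ _ (sub_mem h2 h3)
        | succ k ih =>
          have : polar t (some b) (k + 1) * (t - algebraMap ℂ L a)⁻¹ =
              (b - a)⁻¹ • (polar t (some b) (k + 1) -
                polar t (some b) k * (t - algebraMap ℂ L a)⁻¹) := by
            simp only [polar]
            rw [pow_succ _ (k + 1), mul_assoc, key, mul_smul_comm, mul_sub]
          rw [this]
          exact Submodule.smul_mem _ _ (sub_mem (hmem _ _) ih)
  | zero => simp
  | add x y _ _ hx hy => rw [add_mul]; exact add_mem hx hy
  | smul r x _ hx => rw [smul_mul_assoc]; exact Submodule.smul_mem _ _ hx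

/-- Partial fractions. -/
theorem mem_span_polar (ht : ∀ a, t - algebraMap ℂ L a ≠ 0) {c : L}
    (hc : c ∈ IntermediateField.adjoin ℂ {t}) :
    c ∈ Submodule.span ℂ (Set.range fun p : Option ℂ × ℕ ↦ polar t p.1 p.2) := by
  obtain ⟨r, s, rfl⟩ := (IntermediateField.mem_adjoin_simple_iff ℂ c).mp hc
  have hr : Polynomial.aeval t r ∈
      Submodule.span ℂ (Set.range fun p : Option ℂ × ℕ ↦ polar t p.1 p.2) := by
    rw [Polynomial.aeval_eq_sum_range]
    exact sum_mem fun i _ ↦ Submodule.smul_mem _ _ (Submodule.subset_span ⟨(none, i), rfl⟩)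
  -- Over ℂ the denominator is a product of linear factors, which are divided out one at a time.
  have hs := (IsAlgClosed.splits s).eq_prod_roots
  have hs' : Polynomial.aeval t s = algebraMap ℂ L s.leadingCoeff *
      (s.roots.map fun a ↦ t - algebraMap ℂ L a).prod := by
    conv_lhs => rw [hs]
    simp [map_multiset_prod]
  rw [hs', div_eq_mul_inv, mul_inv, mul_left_comm, ← map_inv₀, ← Algebra.smul_def]
  refine Submodule.smul_mem _ _ ?_
  induction s.roots using Multiset.induction with
  | empty => simpa using hr
  | cons a m ih =>
    rw [Multiset.map_cons, Multiset.prod_cons, mul_inv, mul_comm (_⁻¹), ← mul_assoc]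
    exact span_polar_mul_inv t ht a ih

/-- A linear form which vanishes on the powers of `u`, and on all highly divisible elements,
vanishes on the products of powers of `u` and powers of a function invertible at the origin. -/
theorem map_mul_inv_pow_eq_zero {u : L} (σ : L →ₗ[ℂ] ℂ) {d e : ℂ} (hd : d ≠ 0)
    (hw : algebraMap ℂ L d + e • u ≠ 0) (h0 : ∀ j : ℕ, σ (u ^ j) = 0)
    {N : ℕ} (hN : ∀ j k, N ≤ j → σ (u ^ j * ((algebraMap ℂ L d + e • u)⁻¹) ^ k) = 0) (j k : ℕ) :
    σ (u ^ j * ((algebraMap ℂ L d + e • u)⁻¹) ^ k) = 0 := by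
  induction k generalizing j with
  | zero => simpa using h0 j
  | succ k ih =>
    -- With w = d + e u, the identity w⁻¹ = d⁻¹ (1 - e u w⁻¹) trades one factor w⁻¹ for one factor
    -- u. Large j is covered by hypothesis, and descending induction on j reaches the rest.
    have step (j : ℕ) (h : σ (u ^ (j + 1) * ((algebraMap ℂ L d + e • u)⁻¹) ^ (k + 1)) = 0) :
        σ (u ^ j * ((algebraMap ℂ L d + e • u)⁻¹) ^ (k + 1)) = 0 := by
      have hd' : algebraMap ℂ L d ≠ 0 := (map_ne_zero _).mpr hd
      have : u ^ j * ((algebraMap ℂ L d + e • u)⁻¹) ^ (k + 1) =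
          d⁻¹ • (u ^ j * ((algebraMap ℂ L d + e • u)⁻¹) ^ k -
            e • (u ^ (j + 1) * ((algebraMap ℂ L d + e • u)⁻¹) ^ (k + 1))) := by
        rw [Algebra.smul_def e u] at hw ⊢
        rw [Algebra.smul_def, Algebra.smul_def, map_inv₀, eq_inv_mul_iff_mul_eq₀ hd']
        have hi := mul_inv_cancel₀ hw
        generalize (algebraMap ℂ L d + algebraMap ℂ L e * u)⁻¹ = i at hi ⊢
        linear_combination (u ^ j * i ^ k) * hi
      rw [this, map_smul, map_sub, map_smul, h, ih j]
      simp
    by_cases hj : N ≤ j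
    · exact hN _ _ hj
    · refine Nat.decreasingInduction (n := N)
        (motive := fun j _ ↦ σ (u ^ j * ((algebraMap ℂ L d + e • u)⁻¹) ^ (k + 1)) = 0)
        (fun j _ h ↦ step j h) (hN _ _ le_rfl) (not_le.mp hj).le
end

/-! ### The fibres of t over the projective line -/

theorem traceTo_congr {u t : X.functionField}
    (h : IntermediateField.adjoin ℂ {u} = IntermediateField.adjoin ℂ {t}) :
    traceTo X u = traceTo X t := by
  refine LinearMap.ext fun f ↦ ?_
  rw [traceTo_apply, traceTo_apply, h]

theorem formResidue_zpow (x : Point X) {u : X.functionField} (hu : u ≠ 0) (m : ℤ) :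
    formResidue X x (u ^ m • D ℂ X.functionField u) = if m = -1 then (order X x u : ℂ) else 0 := by
  split_ifs with hm
  · rw [hm, zpow_neg_one, ← one_mul u⁻¹, formResidue_logarithmic X x hu (c := 1), one_mul]
    rw [map_one, sub_self, map_zero]
    exact zero_lt_one
  · have hm' : ((m + 1 : ℤ) : ℂ) ≠ 0 := by
      rw [Int.cast_ne_zero]
      omega
    have : u ^ m • D ℂ X.functionField u =
        D ℂ X.functionField (((m + 1 : ℤ) : ℂ)⁻¹ • u ^ (m + 1)) := by
      rw [Derivation.map_smul, D_zpow u, ← smul_assoc, smul_smul, inv_mul_cancel₀ hm', one_smul,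
        add_sub_cancel_right]
    rw [this, formResidue_D]

section
variable {t : X.functionField} (ht : D ℂ X.functionField t ≠ 0)
include ht

theorem sub_algebraMap_ne_zero (a : ℂ) : t - algebraMap ℂ X.functionField a ≠ 0 := by
  refine ne_zero_of_D_ne_zero X ?_
  rwa [map_sub, Derivation.map_algebraMap, sub_zero]

theorem coord_ne_zero (y : Option ℂ) : coord t y ≠ 0 := by
  cases y with
  | none => exact inv_ne_zero (ne_zero_of_D_ne_zero X ht)
  | some a => exact sub_algebraMap_ne_zero X ht a

theorem D_eq_smul_D_coord (y : Option ℂ) : D ℂ X.functionField t =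
    (coordSign y • coord t y ^ (-2 * (shift y : ℤ))) • D ℂ X.functionField (coord t y) := by
  cases y with
  | none =>
    have h0 := ne_zero_of_D_ne_zero X ht
    have h := D_zpow t (-1)
    rw [zpow_neg_one] at h
    simp only [coord, coordSign, shift]
    rw [h, smul_smul]
    simp only [Algebra.smul_def, map_neg, map_one, Int.cast_neg, Int.cast_one]
    have : -1 * t⁻¹ ^ (-2 * ((1 : ℕ) : ℤ)) * (-1 * t ^ (-1 - 1 : ℤ)) = 1 := by
      rw [inv_zpow', neg_one_mul, neg_one_mul, neg_mul_neg, ← zpow_add₀ h0]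
      simp
    rw [this, one_smul]
  | some a =>
    simp only [coord, coordSign, shift]
    rw [map_sub, Derivation.map_algebraMap, sub_zero]
    simp

theorem D_coord_ne_zero (y : Option ℂ) : D ℂ X.functionField (coord t y) ≠ 0 := by
  intro h
  have := D_eq_smul_D_coord X ht y
  rw [h, smul_zero] at this
  exact ht this

omit ht in
theorem adjoin_coord (y : Option ℂ) :
    IntermediateField.adjoin ℂ {coord t y} = IntermediateField.adjoin ℂ {t} := by
  refine le_antisymm (IntermediateField.adjoin_simple_le_iff.mpr ?_)
    (IntermediateField.adjoin_simple_le_iff.mpr ?_)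
  · cases y with
    | none => exact inv_mem (mem_adjoin_self X t)
    | some a => exact sub_mem (mem_adjoin_self X t) (algebraMap_mem _ a)
  · cases y with
    | none => simpa [coord] using inv_mem (mem_adjoin_self X (coord t none))
    | some a =>
      have := add_mem (mem_adjoin_self X (coord t (some a)))
        (algebraMap_mem (IntermediateField.adjoin ℂ {coord t (some a)}) a)
      simpa [coord] using this

theorem coord_eq_of_lt_one (x : Point X) {y z : Option ℂ} (hy : pointValuation X x (coord t y) < 1)
    (hz : pointValuation X x (coord t z) < 1) : y = z := by
  have hinf (a : ℂ) (h : pointValuation X x t⁻¹ < 1)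
      (h' : pointValuation X x (t - algebraMap ℂ X.functionField a) < 1) : False := by
    have h1 := le_one_of_sub_lt_one X x h'
    rw [map_inv₀] at h
    by_cases h0 : pointValuation X x t = 0
    · exact ne_zero_of_D_ne_zero X ht ((Valuation.zero_iff _).mp h0)
    · exact absurd ((inv_lt_one₀ (zero_lt_iff.mpr h0)).mp h) (not_lt.mpr h1)
  cases y with
  | none =>
    cases z with
    | none => rfl
    | some b => exact (hinf b hy hz).elim
  | some a =>
    cases z with
    | none => exact (hinf a hz hy).elim
    | some b =>
      by_contra hab
      have hab' : a - b ≠ 0 := sub_ne_zero.mpr fun h ↦ hab (congrArg some h)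
      have h := Valuation.map_sub_lt _ hz hy
      simp only [coord] at h
      rw [sub_sub_sub_cancel_left, ← map_sub] at h
      rw [pointValuation_complex X x hab'] at h
      exact lt_irrefl _ h

omit ht in
theorem exists_coord_lt_one (t : X.functionField) (x : Point X) :
    ∃ y, pointValuation X x (coord t y) < 1 := by
  by_cases h : pointValuation X x t ≤ 1
  · obtain ⟨a, ha⟩ := exists_value X x h
    exact ⟨some a, ha⟩
  · refine ⟨none, ?_⟩
    change pointValuation X x t⁻¹ < 1
    rw [map_inv₀]
    exact inv_lt_one_of_one_lt₀ (not_le.mp h)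

/-- The fibre of the map `t` to the projective line over a point. -/
def fibre (y : Option ℂ) : Finset (Point X) := (finite_lt_one X (coord_ne_zero X ht y)).toFinset

theorem mem_fibre {y : Option ℂ} {x : Point X} :
    x ∈ fibre X ht y ↔ pointValuation X x (coord t y) < 1 := by
  rw [fibre, Set.Finite.mem_toFinset, Set.mem_ofPred_eq]

theorem exists_mem_fibre (x : Point X) : ∃ y, x ∈ fibre X ht y := by
  obtain ⟨y, hy⟩ := exists_coord_lt_one X t x
  exact ⟨y, (mem_fibre X ht).mpr hy⟩

theorem eq_of_mem_fibre {x : Point X} {y z : Option ℂ} (hy : x ∈ fibre X ht y)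
    (hz : x ∈ fibre X ht z) : y = z :=
  coord_eq_of_lt_one X ht x ((mem_fibre X ht).mp hy) ((mem_fibre X ht).mp hz)

theorem finsum_sum_fibre {φ : Point X → ℂ} (hφ : φ.support.Finite) :
    ∑ᶠ y, ∑ x ∈ fibre X ht y, φ x = ∑ᶠ x, φ x := by
  classical
  -- Each point of X lies on exactly one fibre, so the sum can be regrouped.
  choose π hπ using exists_mem_fibre X ht
  have hfib (y : Option ℂ) : (∑ x ∈ fibre X ht y, φ x) =
      ∑ x ∈ hφ.toFinset with π x = y, φ x := by
    have : fibre X ht y = (fibre X ht y).filter fun x ↦ π x = y :=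
      (Finset.filter_true_of_mem fun x hx ↦ eq_of_mem_fibre X ht (hπ x) hx).symm
    rw [← Finset.sum_subset (Finset.inter_subset_left (s₂ := hφ.toFinset))]
    · refine Finset.sum_congr ?_ fun _ _ ↦ rfl
      ext x
      simp only [Finset.mem_inter, Finset.mem_filter]
      exact ⟨fun h ↦ ⟨h.2, eq_of_mem_fibre X ht (hπ x) h.1⟩, fun h ↦ ⟨h.2 ▸ hπ x, h.1⟩⟩
    · intro x hx hx'
      by_contra h0
      exact hx' (Finset.mem_inter.mpr ⟨hx, hφ.mem_toFinset.mpr h0⟩)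
  rw [finsum_congr hfib, finsum_eq_sum_of_support_subset (s := hφ.toFinset.image π),
    Finset.sum_fiberwise_of_maps_to fun x hx ↦ Finset.mem_image_of_mem π hx,
    finsum_eq_sum φ hφ]
  intro y hy
  obtain ⟨x, hx, hx0⟩ := Finset.exists_ne_zero_of_sum_ne_zero hy
  rw [Finset.mem_filter] at hx
  exact Finset.mem_coe.mpr (Finset.mem_image.mpr ⟨x, hx⟩)

theorem residue_eq_zero_of_valued_le {x : Point X} {y : Option ℂ} (hx : x ∈ fibre X ht y)
    {f : LocalField X x}
    (hf : Valued.v f ≤ pointValuation X x (coord t y) ^ (2 * shift y)) :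
    residue X x (D ℂ X.functionField t) f = 0 := by
  have hx' := (mem_fibre X ht).mp hx
  rw [D_eq_smul_D_coord X ht y, residue_smul_form]
  refine residue_eq_zero_of_integral X x hx'.le ((mem_localIntegers_iff X x _).mpr ?_)
  have h0 : pointValuation X x (coord t y) ≠ 0 :=
    (Valuation.ne_zero_iff _).mpr (coord_ne_zero X ht y)
  rw [map_mul, valued_functionField, Algebra.smul_def, map_mul,
    pointValuation_complex X x (coordSign_ne_zero y), one_mul, map_zpow₀]
  calc _ ≤ pointValuation X x (coord t y) ^ (2 * shift y) *
        pointValuation X x (coord t y) ^ (-2 * (shift y : ℤ)) := by gcongr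
    _ = 1 := by
      rw [← zpow_natCast, ← zpow_add₀ h0]
      simp
    _ ≤ 1 := le_rfl

theorem formResidue_eq_zero_of_le {x : Point X} {y : Option ℂ} (hx : x ∈ fibre X ht y)
    {f : X.functionField}
    (hf : pointValuation X x f ≤ pointValuation X x (coord t y) ^ (2 * shift y)) :
    formResidue X x (f • D ℂ X.functionField t) = 0 := by
  rw [formResidue_smul]
  exact residue_eq_zero_of_valued_le X ht hx ((valued_functionField X x f).trans_le hf)

omit ht in
theorem pointValuation_add_smul_eq_one (x : Point X) {u : X.functionField}
    (hu : pointValuation X x u < 1) {d : ℂ} (hd : d ≠ 0) (e : ℂ) :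
    pointValuation X x (algebraMap ℂ X.functionField d + e • u) = 1 := by
  rw [← pointValuation_complex X x hd]
  refine Valuation.map_add_eq_of_lt_left _ ?_
  rw [Algebra.smul_def, map_mul, pointValuation_complex X x hd]
  rw [mul_comm]
  exact mul_lt_one_of_lt_of_le hu (pointValuation_complex_le_one X x e)

/-- The expansion of a polar part in the local coordinate at a different point. -/
theorem exists_polar_eq {y z : Option ℂ} (hyz : y ≠ z) (k : ℕ) : ∃ (d e : ℂ) (p : Polynomial ℂ)
    (m : ℕ), d ≠ 0 ∧ polar t z k = coord t y ^ shift y * Polynomial.aeval (coord t y) p *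
      ((algebraMap ℂ X.functionField d + e • coord t y)⁻¹) ^ m := by
  have h0 := ne_zero_of_D_ne_zero X ht
  cases y with
  | none =>
    cases z with
    | none => exact absurd rfl hyz
    | some b =>
      -- With v = t⁻¹, 1 / (t - b) = v / (1 - b v). One of the k + 1 factors v in the numerator is
      -- the required power `v ^ shift`.
      refine ⟨1, -b, Polynomial.X ^ k, k + 1, one_ne_zero, ?_⟩
      have hb := sub_algebraMap_ne_zero X ht b
      have : algebraMap ℂ X.functionField 1 + (-b) • t⁻¹ = (t - algebraMap ℂ _ b) * t⁻¹ := by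
        rw [Algebra.smul_def, map_neg, map_one, sub_mul, mul_inv_cancel₀ h0]
        ring
      simp only [polar, coord, shift, map_pow, Polynomial.aeval_X]
      rw [this, mul_inv, inv_inv, mul_pow, ← pow_add, add_comm 1 k, mul_left_comm, ← mul_pow,
        inv_mul_cancel₀ h0, one_pow, mul_one]
  | some a =>
    cases z with
    | none =>
      refine ⟨1, 0, (Polynomial.X + Polynomial.C a) ^ k, 0, one_ne_zero, ?_⟩
      simp [polar, coord, shift]
    | some b =>
      -- t - b = (a - b) + v with v = t - a.
      refine ⟨a - b, 1, 1, k + 1, sub_ne_zero.mpr fun h ↦ hyz (congrArg some h), ?_⟩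
      simp [polar, coord, shift]

theorem pointValuation_polar_le {x : Point X} {y z : Option ℂ} (hx : x ∈ fibre X ht y)
    (hyz : y ≠ z) (k : ℕ) :
    pointValuation X x (polar t z k) ≤ pointValuation X x (coord t y) ^ shift y := by
  obtain ⟨d, e, p, m, hd, h⟩ := exists_polar_eq X ht hyz k
  have hx' := (mem_fibre X ht).mp hx
  rw [h, map_mul, map_mul, map_pow, map_pow, map_inv₀,
    pointValuation_add_smul_eq_one X x hx' hd, inv_one, one_pow, mul_one]
  refine mul_le_of_le_one_right' ?_
  exact polyRing_le X (coord t y) (V := (pointValuation X x).valuationSubring)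
    (pointValuation_complex_le_one X x) hx'.le (Polynomial.aeval_mem_adjoin_singleton ℂ _)

/-- The trace formula over the zeros of the coordinate at y. The factor relating dt to the
differential of that coordinate lies in ℂ(t), hence passes through the trace. -/
theorem sum_fibre_traceTo (y : Option ℂ) (f : X.functionField) :
    ∑ x ∈ fibre X ht y, formResidue X x (traceTo X t f • D ℂ X.functionField t) =
      Module.finrank (IntermediateField.adjoin ℂ {t}) X.functionField *
        ∑ x ∈ fibre X ht y, formResidue X x (f • D ℂ X.functionField t) := by
  have h := sum_formResidue_traceTo X (D_coord_ne_zero X ht y) (fibre X ht y)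
    (fun x ↦ mem_fibre X ht) ((coordSign y • coord t y ^ (-2 * (shift y : ℤ))) * f)
  have hmem : coordSign y • coord t y ^ (-2 * (shift y : ℤ)) ∈
      IntermediateField.adjoin ℂ {coord t y} :=
    IntermediateField.smul_mem _ (zpow_mem (mem_adjoin_self X _) _)
  rw [traceTo_mul X _ hmem, traceTo_congr X (adjoin_coord X y), adjoin_coord X y] at h
  simpa only [mul_comm (coordSign y • _), mul_smul, ← D_eq_smul_D_coord X ht y] using h

/-- The residues on the fibre over `y` of the product of a polar part at `y` and of a regular
function. -/
theorem sum_formResidue_polar_mul (y : Option ℂ) (k j : ℕ) :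
    ∑ x ∈ fibre X ht y, formResidue X x
      ((polar t y k * coord t y ^ (j + shift y)) • D ℂ X.functionField t) =
      if j = k then coordSign y *
        Module.finrank (IntermediateField.adjoin ℂ {t}) X.functionField else 0 := by
  have h0 := coord_ne_zero X ht y
  have h (x : Point X) : formResidue X x
      ((polar t y k * coord t y ^ (j + shift y)) • D ℂ X.functionField t) =
        if j = k then coordSign y * (order X x (coord t y) : ℂ) else 0 := by
    rw [D_eq_smul_D_coord X ht y, smul_smul, mul_smul_comm, smul_assoc,
      LinearMap.map_smul (formResidue X x), polar_eq_zpow, ← zpow_natCast, ← zpow_add₀ h0,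
      ← zpow_add₀ h0, formResidue_zpow X x h0, smul_eq_mul, mul_ite, mul_zero]
    refine if_congr ?_ rfl rfl
    push_cast
    omega
  rw [Finset.sum_congr rfl fun x _ ↦ h x]
  split_ifs
  · rw [← Finset.mul_sum, sum_order X (D_coord_ne_zero X ht y) _ fun x ↦ mem_fibre X ht,
      adjoin_coord X y]
  · exact Finset.sum_const_zero

end

/-! ### The residue theorem -/

theorem finite_support_formResidue (η : Ω[X.functionField⁄ℂ]) :
    (Function.support fun x ↦ formResidue X x η).Finite := by
  have h := finite_support_residue X η 1 1
  simp only [RestrictedProduct.one_apply, mul_one] at h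
  exact h

section
variable {t : X.functionField} (ht : D ℂ X.functionField t ≠ 0)
include ht

/-- Apart from (t - a)⁻¹, each polar part times dt is exact. The form dt / (t - a) contributes n on
the fibre over a and -n on the fibre over infinity. -/
theorem finsum_formResidue_polar (z : Option ℂ) (k : ℕ) :
    ∑ᶠ x, formResidue X x (polar t z k • D ℂ X.functionField t) = 0 := by
  classical
  by_cases hz : z.isSome ∧ k = 0
  · obtain ⟨hz, rfl⟩ := hz
    obtain ⟨a, rfl⟩ := Option.isSome_iff_exists.mp hz
    have hfib (y : Option ℂ) : ∑ x ∈ fibre X ht y,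
        formResidue X x (polar t (some a) 0 • D ℂ X.functionField t) =
          ((if y = some a then 1 else 0) + (if y = none then (-1 : ℂ) else 0)) *
            Module.finrank (IntermediateField.adjoin ℂ {t}) X.functionField := by
      match y with
      | none =>
        have h (x : Point X) (hx : x ∈ fibre X ht none) :
            formResidue X x (polar t (some a) 0 • D ℂ X.functionField t) =
              -(order X x (coord t none) : ℂ) := by
          have hx' := (mem_fibre X ht).mp hx
          have h0 := ne_zero_of_D_ne_zero X ht
          have h1 := sub_algebraMap_ne_zero X ht a
          -- With v = t⁻¹, dt / (t - a) = -(1 - a v)⁻¹ v⁻¹ dv, so the residue is minus the order of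
          -- v.
          have h2 : polar t (some a) 0 * (coordSign none • coord t none ^ (-2 * (shift none : ℤ))) =
              (-(1 - a • coord t none)⁻¹) * (coord t none)⁻¹ := by
            have h3 : (1 - a • coord t none : X.functionField) =
                (t - algebraMap ℂ _ a) * t⁻¹ := by
              rw [sub_mul, mul_inv_cancel₀ h0, Algebra.smul_def]
              rfl
            rw [h3]
            simp only [polar, coord, coordSign, shift, neg_smul, one_smul, zero_add, pow_one,
              mul_inv, inv_inv, inv_zpow']
            norm_num
            ring
          have h4 := pointValuation_add_smul_eq_one X x hx' one_ne_zero (-a)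
          rw [map_one, neg_smul, ← sub_eq_add_neg] at h4
          have h5 : (1 - a • coord t none : X.functionField) ≠ 0 := by
            rw [← Valuation.ne_zero_iff (pointValuation X x), h4]
            exact one_ne_zero
          rw [D_eq_smul_D_coord X ht none, smul_smul, h2,
            formResidue_logarithmic X x (coord_ne_zero X ht none) (c := -1), neg_one_mul]
          have h6 : -(1 - a • coord t none)⁻¹ - algebraMap ℂ X.functionField (-1) =
              -(coord t none * (algebraMap ℂ _ a * (1 - a • coord t none)⁻¹)) := by
            rw [map_neg, map_one, mul_left_comm, ← mul_assoc, ← Algebra.smul_def]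
            field_simp
            ring
          rw [h6, Valuation.map_neg, map_mul, map_mul, map_inv₀, h4, inv_one, mul_one]
          exact mul_lt_one_of_lt_of_le hx' (pointValuation_complex_le_one X x a)
        rw [Finset.sum_congr rfl h, Finset.sum_neg_distrib,
          sum_order X (D_coord_ne_zero X ht none) _ fun x ↦ mem_fibre X ht, adjoin_coord X none]
        simp
      | some b =>
        by_cases hab : b = a
        · subst hab
          have := sum_formResidue_polar_mul X ht (some b) 0 0
          simpa [shift, coordSign] using this
        · rw [if_neg (by simpa using hab), if_neg (by simp), add_zero, zero_mul]
          refine Finset.sum_eq_zero fun x hx ↦ formResidue_eq_zero_of_le X ht hx ?_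
          exact pointValuation_polar_le X ht hx (by simpa using hab) 0
    rw [← finsum_sum_fibre X ht (finite_support_formResidue X _), finsum_congr hfib,
      finsum_eq_sum_of_support_subset (s := {some a, none})]
    · rw [Finset.sum_pair (by simp)]
      simp
    · intro y hy
      by_contra h
      simp only [Finset.coe_insert, Finset.coe_singleton, Set.mem_insert_iff,
        Set.mem_singleton_iff, not_or] at h
      exact hy (by simp [h.1, h.2])
  · rw [← finsum_zero]
    refine finsum_congr fun x ↦ ?_
    rw [D_eq_smul_D_coord X ht z, smul_smul, mul_smul_comm, smul_assoc,
      LinearMap.map_smul (formResidue X x), polar_eq_zpow,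
      ← zpow_add₀ (coord_ne_zero X ht z), formResidue_zpow X x (coord_ne_zero X ht z), if_neg,
      smul_zero]
    intro h
    apply hz
    cases z <;> simp [shift] at h ⊢ <;> omega

theorem finsum_formResidue_of_mem_adjoin {c : X.functionField}
    (hc : c ∈ IntermediateField.adjoin ℂ {t}) :
    ∑ᶠ x, formResidue X x (c • D ℂ X.functionField t) = 0 := by
  have h := mem_span_polar t (sub_algebraMap_ne_zero X ht) hc
  clear hc
  induction h using Submodule.span_induction with
  | mem z hz =>
    obtain ⟨⟨y, k⟩, rfl⟩ := hz
    exact finsum_formResidue_polar X ht y k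
  | zero => simp
  | add f g _ _ hf hg =>
    simp only [add_smul, map_add]
    rw [finsum_add_distrib (finite_support_formResidue X _) (finite_support_formResidue X _), hf,
      hg, add_zero]
  | smul r f _ hf =>
    simp only [smul_assoc, LinearMap.map_smul (formResidue X _)]
    rw [← smul_finsum' r (finite_support_formResidue X _), hf, smul_zero]

theorem finrank_adjoin_ne_zero :
    (Module.finrank (IntermediateField.adjoin ℂ {t}) X.functionField : ℂ) ≠ 0 := by
  obtain ⟨_, _⟩ := finite_separable_adjoin X ht
  exact Nat.cast_ne_zero.mpr Module.finrank_pos.ne'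

end

theorem exists_D_ne_zero : ∃ t : X.functionField, D ℂ X.functionField t ≠ 0 := by
  by_contra! h
  have h1 : (⊤ : Submodule X.functionField Ω[X.functionField⁄ℂ]) = ⊥ := by
    rw [← span_range_derivation, Submodule.span_eq_bot]
    rintro _ ⟨f, rfl⟩
    exact h f
  have h2 := finrank_kaehler X
  rw [← finrank_top, h1, finrank_bot] at h2
  exact zero_ne_one h2

/-- The residue theorem. -/
theorem finsum_formResidue (η : Ω[X.functionField⁄ℂ]) : ∑ᶠ x, formResidue X x η = 0 := by
  obtain ⟨t, ht⟩ := exists_D_ne_zero X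
  obtain ⟨f, rfl⟩ := Submodule.mem_span_singleton.mp (span_D_eq_top X ht ▸ trivial :
    η ∈ Submodule.span X.functionField {D ℂ X.functionField t})
  have h := finsum_formResidue_of_mem_adjoin X ht (c := traceTo X t f) (SetLike.coe_mem _)
  -- Regrouped by fibres, the sum for tr(f) dt, which is zero, is n times the sum for f dt.
  rw [← finsum_sum_fibre X ht (finite_support_formResidue X _),
    finsum_congr fun y ↦ sum_fibre_traceTo X ht y f, ← mul_finsum,
    finsum_sum_fibre X ht (finite_support_formResidue X _)] at h
  exact (mul_eq_zero.mp h).resolve_left (finrank_adjoin_ne_zero X ht)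

/-! ### Adeles acting on functions of t, fibre by fibre -/

theorem diagonal_apply (f : X.functionField) (x : Point X) :
    diagonal X f x = algebraMap X.functionField (LocalField X x) f := rfl

theorem adelePairing_apply (ω : Ω[X.functionField⁄ℂ]) (f g : Adele X) :
    adelePairing X ω f g = ∑ᶠ x, residue X x ω (f x * g x) := rfl

theorem adelePairing_diagonal (ω : Ω[X.functionField⁄ℂ]) (f g : X.functionField) :
    adelePairing X ω (diagonal X f) (diagonal X g) = 0 := by
  rw [adelePairing_apply, ← finsum_formResidue X ((f * g) • ω)]
  refine finsum_congr fun x ↦ ?_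
  rw [formResidue_smul, map_mul (algebraMap _ _)]
  rfl

/-- Multiplication by a function of high order at `x` kills residues. -/
theorem exists_residue_eq_zero (x : Point X) {t : X.functionField} (f : LocalField X x) :
    ∃ N : ℕ, ∀ c : X.functionField, pointValuation X x c ≤ WithZero.exp (-N : ℤ) →
      residue X x (D ℂ X.functionField t) (f * algebraMap X.functionField _ c) = 0 := by
  obtain ⟨s, hs⟩ := IsDiscreteValuationRing.exists_irreducible (X.presheaf.stalk x.1)
  obtain ⟨h, hh⟩ := exists_eq_smul_differential X x hs (D ℂ X.functionField t)
  obtain ⟨N, -, hN⟩ := exists_le_exp {()}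
    (fun _ ↦ Valued.v (f * algebraMap X.functionField (LocalField X x) h)) 0
  refine ⟨N, fun c hc ↦ ?_⟩
  rw [hh, residue_eq_of_laurentSum X x hs h _ 0, Finsupp.zero_apply]
  rw [map_zero, sub_zero, mem_localIntegers_iff, mul_right_comm, map_mul, valued_functionField]
  calc _ ≤ WithZero.exp (N : ℤ) * WithZero.exp (-N : ℤ) :=
        mul_le_mul' (hN () (Finset.mem_singleton_self _)) hc
    _ = 1 := by rw [← WithZero.exp_add, add_neg_cancel, WithZero.exp_zero]
    _ ≤ 1 := le_rfl

section
variable {t : X.functionField} (ht : D ℂ X.functionField t ≠ 0)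

/-- The part of the pairing of adeles with functions which comes from a fibre. -/
def fibrePairing (y : Option ℂ) : Adele X →ₗ[ℂ] X.functionField →ₗ[ℂ] ℂ :=
  LinearMap.mk₂ ℂ (fun a c ↦ ∑ x ∈ fibre X ht y, residue X x (D ℂ X.functionField t)
      (a x * diagonal X c x))
    (fun a b c ↦ by simp [add_mul, Finset.sum_add_distrib])
    (fun r a c ↦ by simp [Finset.mul_sum])
    (fun a c d ↦ by simp [mul_add, Finset.sum_add_distrib])
    (fun r a c ↦ by simp [Finset.mul_sum])

theorem fibrePairing_apply (y : Option ℂ) (a : Adele X) (c : X.functionField) :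
    fibrePairing X ht y a c = ∑ x ∈ fibre X ht y, residue X x (D ℂ X.functionField t)
      (a x * algebraMap X.functionField _ c) := rfl

theorem fibrePairing_diagonal (y : Option ℂ) (f c : X.functionField) :
    fibrePairing X ht y (diagonal X f) c =
      ∑ x ∈ fibre X ht y, formResidue X x ((f * c) • D ℂ X.functionField t) := by
  rw [fibrePairing_apply]
  refine Finset.sum_congr rfl fun x _ ↦ ?_
  rw [formResidue_smul, map_mul (algebraMap _ _)]
  rfl

theorem fibrePairing_mul_diagonal (y : Option ℂ) (a : Adele X) (f c : X.functionField) :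
    fibrePairing X ht y (a * diagonal X f) c = fibrePairing X ht y a (f * c) := by
  rw [fibrePairing_apply, fibrePairing_apply]
  refine Finset.sum_congr rfl fun x _ ↦ ?_
  rw [map_mul (algebraMap _ _), ← mul_assoc]
  rfl

theorem finsum_fibrePairing (a : Adele X) (c : X.functionField) :
    ∑ᶠ y, fibrePairing X ht y a c =
      adelePairing X (D ℂ X.functionField t) a (diagonal X c) :=
  finsum_sum_fibre X ht (finite_support_residue X _ a (diagonal X c))

theorem exists_fibrePairing_eq_zero (y : Option ℂ) (a : Adele X) :
    ∃ N : ℕ, ∀ c : X.functionField,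
      (∀ x ∈ fibre X ht y, pointValuation X x c ≤ pointValuation X x (coord t y) ^ N) →
      fibrePairing X ht y a c = 0 := by
  choose N hN using fun x : Point X ↦ exists_residue_eq_zero X x (t := t) (a x)
  refine ⟨(fibre X ht y).sup N, fun c hc ↦ ?_⟩
  refine Finset.sum_eq_zero fun x hx ↦ hN x c ((hc x hx).trans ?_)
  have h1 := le_exp_neg_one ((mem_fibre X ht).mp hx)
  calc _ ≤ WithZero.exp (-1 : ℤ) ^ ((fibre X ht y).sup N) := by gcongr
    _ = WithZero.exp (-((fibre X ht y).sup N : ℕ) : ℤ) := by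
      rw [← WithZero.exp_nsmul]
      simp
    _ ≤ _ := by
      rw [WithZero.exp_le_exp, neg_le_neg_iff]
      exact_mod_cast Finset.le_sup hx

/-- An adele has only finitely many nonintegral components, and dt is regular over finite points.
Hence only finitely many polar coefficients are needed to match the adele. -/
theorem exists_fibrePairing_coord_pow_eq_zero (a : Adele X) : ∃ N : Option ℂ → ℕ,
    {y | N y ≠ 0}.Finite ∧ ∀ y j, N y ≤ j →
      fibrePairing X ht y a (coord t y ^ (j + shift y)) = 0 := by
  classical
  choose N hN using fun y ↦ exists_fibrePairing_eq_zero X ht y a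
  choose π hπ using exists_mem_fibre X ht
  have hfin : {x | a x ∉ localIntegers X x}.Finite := a.eventually
  -- Infinity is always among the exceptional points, because dt has poles on its fibre even where
  -- the adele is integral.
  refine ⟨fun y ↦ if y ∈ insert none (π '' {x | a x ∉ localIntegers X x}) then N y else 0,
    ((hfin.image π).insert none).subset fun y hy ↦ ?_, fun y j hj ↦ ?_⟩
  · by_contra h
    exact hy (if_neg h)
  · dsimp only at hj
    split_ifs at hj with h
    · refine hN y _ fun x hx ↦ ?_
      rw [map_pow]
      exact pow_le_pow_right_of_le_one' ((mem_fibre X ht).mp hx).le (by omega)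
    · rw [Set.mem_insert_iff, not_or] at h
      obtain ⟨b, rfl⟩ := Option.ne_none_iff_exists'.mp h.1
      refine Finset.sum_eq_zero fun x hx ↦ residue_eq_zero_of_valued_le X ht hx ?_
      rw [shift, mul_zero, pow_zero, ← mem_localIntegers_iff]
      refine mul_mem ?_ (algebraMap_mem_localIntegers X x ?_)
      · by_contra hx'
        exact h.2 ⟨x, hx', eq_of_mem_fibre X ht (hπ x) hx⟩
      · rw [map_pow]
        exact pow_le_one' ((mem_fibre X ht).mp hx).le _

/-- A polar part at z is regular at y: it is v^(shift y) times a polynomial in v times a power of (d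
+ e v)⁻¹. The pairing is continuous, so vanishing on the powers of v extends to such functions. -/
theorem fibrePairing_polar_of_ne {a : Adele X} {y z : Option ℂ} (hyz : y ≠ z)
    (h : ∀ j, fibrePairing X ht y a (coord t y ^ (j + shift y)) = 0) (k : ℕ) :
    fibrePairing X ht y a (polar t z k) = 0 := by
  obtain ⟨d, e, p, m, hd, hp⟩ := exists_polar_eq X ht hyz k
  obtain ⟨N, hN⟩ := exists_fibrePairing_eq_zero X ht y a
  have h1 (x : Point X) (hx : x ∈ fibre X ht y) :=
    pointValuation_add_smul_eq_one X x ((mem_fibre X ht).mp hx) hd e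
  by_cases hw : algebraMap ℂ X.functionField d + e • coord t y = 0
  · refine (hN _ fun x hx ↦ ?_)
    have := h1 x hx
    rw [hw, map_zero] at this
    exact absurd this zero_ne_one
  have key := map_mul_inv_pow_eq_zero
    (fibrePairing X ht y a ∘ₗ LinearMap.mulLeft ℂ (coord t y ^ shift y)) hd hw
    (fun j ↦ by
      rw [LinearMap.comp_apply, LinearMap.mulLeft_apply, ← pow_add, add_comm]
      exact h j) (N := N) (fun j k hj ↦ hN _ fun x hx ↦ by
        rw [LinearMap.mulLeft_apply, map_mul, map_mul, map_pow _ (_⁻¹), map_inv₀, h1 x hx, inv_one,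
          one_pow, mul_one, ← map_mul, ← pow_add, map_pow]
        exact pow_le_pow_right_of_le_one' ((mem_fibre X ht).mp hx).le (by omega))
  rw [hp, Polynomial.aeval_eq_sum_range, mul_assoc, Finset.sum_mul, Finset.mul_sum, map_sum]
  refine Finset.sum_eq_zero fun i _ ↦ ?_
  rw [smul_mul_assoc, mul_smul_comm, LinearMap.map_smul (fibrePairing X ht y a)]
  exact smul_eq_zero_of_right _ (key i m)

/-- Both factors are divisible by v^(shift y), which together compensate the pole of dt. -/
theorem fibrePairing_diagonal_polar_of_ne {y z : Option ℂ} (hyz : y ≠ z) (k j : ℕ) :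
    fibrePairing X ht y (diagonal X (polar t z k)) (coord t y ^ (j + shift y)) = 0 := by
  rw [fibrePairing_diagonal]
  refine Finset.sum_eq_zero fun x hx ↦ formResidue_eq_zero_of_le X ht hx ?_
  rw [map_mul, map_pow, two_mul, pow_add _ (shift y) (shift y)]
  refine mul_le_mul' (pointValuation_polar_le X ht hx hyz k) ?_
  exact pow_le_pow_right_of_le_one' ((mem_fibre X ht).mp hx).le (by omega)

/-- Polar parts at y are dual, up to the factor ± n, to the powers of v used as tests, and polar
parts at other points are invisible to those tests. So r can be assembled coefficient by
coefficient. -/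
theorem exists_diagonal_fibrePairing_eq (a : Adele X) :
    ∃ r ∈ IntermediateField.adjoin ℂ {t}, ∀ y j,
      fibrePairing X ht y (a - diagonal X r) (coord t y ^ (j + shift y)) = 0 := by
  classical
  obtain ⟨N, hfin, hN⟩ := exists_fibrePairing_coord_pow_eq_zero X ht a
  let n : ℂ := Module.finrank (IntermediateField.adjoin ℂ {t}) X.functionField
  let α (y : Option ℂ) (k : ℕ) : ℂ :=
    fibrePairing X ht y a (coord t y ^ (k + shift y)) / (coordSign y * n)
  have hα (y : Option ℂ) (k : ℕ) : α y k * (coordSign y * n) =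
      fibrePairing X ht y a (coord t y ^ (k + shift y)) :=
    div_mul_cancel₀ _ (mul_ne_zero (coordSign_ne_zero y) (finrank_adjoin_ne_zero X ht))
  refine ⟨∑ z ∈ hfin.toFinset, ∑ k ∈ Finset.range (N z), α z k • polar t z k,
    sum_mem fun z _ ↦ sum_mem fun k _ ↦ IntermediateField.smul_mem _ ?_, fun y j ↦ ?_⟩
  · cases z with
    | none => exact pow_mem (mem_adjoin_self X t) _
    | some b => exact pow_mem (inv_mem (sub_mem (mem_adjoin_self X t) (algebraMap_mem _ b))) _
  rw [map_sub, LinearMap.sub_apply, sub_eq_zero, map_sum, map_sum, LinearMap.sum_apply]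
  have hz (z : Option ℂ) : fibrePairing X ht y
      (diagonal X (∑ k ∈ Finset.range (N z), α z k • polar t z k)) (coord t y ^ (j + shift y)) =
        if z = y then fibrePairing X ht y a (coord t y ^ (j + shift y)) else 0 := by
    have hs : fibrePairing X ht y
        (diagonal X (∑ k ∈ Finset.range (N z), α z k • polar t z k)) (coord t y ^ (j + shift y)) =
        ∑ k ∈ Finset.range (N z), α z k * fibrePairing X ht y (diagonal X (polar t z k))
          (coord t y ^ (j + shift y)) := by
      rw [map_sum, map_sum, LinearMap.sum_apply]
      refine Finset.sum_congr rfl fun k _ ↦ ?_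
      rw [LinearMap.map_smul (diagonal X), LinearMap.map_smul (fibrePairing X ht y),
        LinearMap.smul_apply, smul_eq_mul]
    rw [hs]
    split_ifs with hzy
    · subst hzy
      simp only [fibrePairing_diagonal, sum_formResidue_polar_mul X ht, mul_ite, mul_zero]
      rw [Finset.sum_ite_eq]
      split_ifs with hj
      · exact hα z j
      · exact (hN z j (by simpa using hj)).symm
    · exact Finset.sum_eq_zero fun k _ ↦ by
        rw [fibrePairing_diagonal_polar_of_ne X ht (Ne.symm hzy), mul_zero]
  rw [Finset.sum_congr rfl fun z _ ↦ hz z, Finset.sum_ite_eq']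
  split_ifs with hy
  · rfl
  · exact hN y j (by
      rw [Set.Finite.mem_toFinset, Set.mem_ofPred_eq, not_not] at hy
      omega)

/-- An adele which is orthogonal to the rational functions of `t` acts on each fibre as some
rational function of `t` does. -/
theorem exists_fibrePairing_sub_eq_zero {a : Adele X}
    (ha : ∀ c ∈ IntermediateField.adjoin ℂ {t},
      adelePairing X (D ℂ X.functionField t) a (diagonal X c) = 0) :
    ∃ r ∈ IntermediateField.adjoin ℂ {t}, ∀ y, ∀ c ∈ IntermediateField.adjoin ℂ {t},
      fibrePairing X ht y (a - diagonal X r) c = 0 := by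
  obtain ⟨r, hr, h⟩ := exists_diagonal_fibrePairing_eq X ht a
  refine ⟨r, hr, fun y c hc ↦ ?_⟩
  have hmem (z : Option ℂ) (k : ℕ) : polar t z k ∈ IntermediateField.adjoin ℂ {t} := by
    cases z with
    | none => exact pow_mem (mem_adjoin_self X t) _
    | some b => exact pow_mem (inv_mem (sub_mem (mem_adjoin_self X t) (algebraMap_mem _ b))) _
  have hpol (z : Option ℂ) (k : ℕ) :
      fibrePairing X ht z (a - diagonal X r) (polar t z k) = 0 := by
    have h1 := finsum_fibrePairing X ht (a - diagonal X r) (polar t z k)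
    -- Against a polar part at z only the fibre over z contributes. The total pairing is zero by
    -- orthogonality of a and the residue theorem for r, so this contribution vanishes too.
    rwa [finsum_eq_single _ z fun y hy ↦ fibrePairing_polar_of_ne X ht hy (h y) k,
      map_sub (adelePairing _ _), LinearMap.sub_apply, ha _ (hmem z k), adelePairing_diagonal, sub_zero] at h1
  have hspan := mem_span_polar t (sub_algebraMap_ne_zero X ht) hc
  refine Submodule.span_le (p := LinearMap.ker (fibrePairing X ht y (a - diagonal X r))).mpr ?_
    hspan
  rintro _ ⟨⟨z, k⟩, rfl⟩
  by_cases hyz : y = z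
  · subst hyz
    exact hpol y k
  · exact fibrePairing_polar_of_ne X ht hyz (h y) k

end

/-! ### Duality for adeles -/

theorem adelePairing_mul_diagonal (ω : Ω[X.functionField⁄ℂ]) (a : Adele X)
    (f g : X.functionField) :
    adelePairing X ω (a * diagonal X f) (diagonal X g) =
      adelePairing X ω a (diagonal X (f * g)) := by
  rw [adelePairing_apply, adelePairing_apply]
  refine finsum_congr fun x ↦ ?_
  rw [diagonal_apply, diagonal_apply, map_mul (algebraMap _ _), ← mul_assoc]
  rfl

/-- The residue pairing at a point is nondegenerate. -/
theorem exists_residue_ne_zero (x : Point X) {t : X.functionField}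
    (ht : D ℂ X.functionField t ≠ 0) {f : LocalField X x} (hf : f ≠ 0) :
    ∃ c : X.functionField,
      residue X x (D ℂ X.functionField t) (f * algebraMap X.functionField _ c) ≠ 0 := by
  obtain ⟨s, hs⟩ := IsDiscreteValuationRing.exists_irreducible (X.presheaf.stalk x.1)
  obtain ⟨h, hh⟩ := exists_eq_smul_differential X x hs (D ℂ X.functionField t)
  have hh0 : h ≠ 0 := by
    rintro rfl
    exact ht (by rw [hh, zero_smul])
  have hfh : Valued.v (f * algebraMap X.functionField (LocalField X x) h) ≠ 0 := by
    rw [Valuation.ne_zero_iff]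
    exact mul_ne_zero hf ((map_ne_zero _).mpr hh0)
  set σ := algebraMap (X.presheaf.stalk x.1) X.functionField s
  have hσ := algebraMap_uniformizer_ne_zero X x hs
  set m := WithZero.log (Valued.v (f * algebraMap X.functionField (LocalField X x) h))
  -- f h σᵐ is a unit with value c ≠ 0. So f σ^(m - 1) h = c σ⁻¹ plus an integral element, which has
  -- residue c against dσ.
  have hv : Valued.v (f * algebraMap X.functionField (LocalField X x) (h * σ ^ m)) = 1 := by
    rw [map_mul (algebraMap _ _), ← mul_assoc, map_mul, valued_functionField]
    erw [pointValuation_uniformizer_zpow X x hs]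
    rw [← WithZero.exp_log hfh, ← WithZero.exp_add, add_neg_cancel, WithZero.exp_zero]
  obtain ⟨c, hc⟩ := exists_complex_valued_sub_lt X x _ ((mem_localIntegers_iff X x _).mpr hv.le)
  refine ⟨σ ^ (m - 1), ?_⟩
  rw [hh, residue_eq_of_laurentSum X x hs h _ (Finsupp.single (-1) c), Finsupp.single_eq_same]
  · rintro rfl
    rw [map_zero, sub_zero, hv] at hc
    exact lt_irrefl _ hc
  · have hlt := le_exp_neg_one hc
    have : f * algebraMap X.functionField (LocalField X x) (σ ^ (m - 1)) *
        algebraMap X.functionField (LocalField X x) h -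
        laurentSum (algebraMap (X.presheaf.stalk x.1) (LocalField X x) s)
          (Finsupp.single (-1) c) =
        (f * algebraMap X.functionField (LocalField X x) (h * σ ^ m) -
          algebraMap ℂ (LocalField X x) c) *
            algebraMap X.functionField (LocalField X x) σ⁻¹ := by
      rw [laurentSum_single, Algebra.smul_def, sub_mul,
        IsScalarTower.algebraMap_apply (X.presheaf.stalk x.1) X.functionField (LocalField X x),
        zpow_sub_one₀ hσ, map_mul (algebraMap _ _), map_mul (algebraMap _ _), map_inv₀,
        zpow_neg_one]
      ring
    rw [this, mem_localIntegers_iff, map_mul, valued_functionField, map_inv₀]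
    erw [pointValuation_uniformizer X x hs]
    rw [← WithZero.exp_neg, neg_neg]
    calc _ ≤ WithZero.exp (-1 : ℤ) * WithZero.exp (1 : ℤ) := by gcongr
      _ = 1 := by rw [← WithZero.exp_add, neg_add_cancel, WithZero.exp_zero]
      _ ≤ 1 := le_rfl

section
variable {t : X.functionField} (ht : D ℂ X.functionField t ≠ 0)
include ht

theorem eq_zero_of_fibrePairing_eq_zero {a : Adele X}
    (ha : ∀ y c, fibrePairing X ht y a c = 0) : a = 0 := by
  refine RestrictedProduct.ext _ _ fun x ↦ ?_
  by_contra hx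
  obtain ⟨c, hc⟩ := exists_residue_ne_zero X x ht hx
  obtain ⟨y, hy⟩ := exists_mem_fibre X ht x
  choose N hN using fun x : Point X ↦ exists_residue_eq_zero X x (t := t) (a x)
  classical
  -- h imitates c at x and is nearly zero on the rest of the fibre, so the pairing with h isolates
  -- the residue at x.
  obtain ⟨h, hh⟩ := weak_approximation X (D_coord_ne_zero X ht y) (fibre X ht y)
    (fun z hz ↦ ((mem_fibre X ht).mp hz).le) (fun z ↦ if z = x then c else 0)
    ((fibre X ht y).sup N)
  have hle (z : Point X) (hz : z ∈ fibre X ht y) :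
      WithZero.exp (-((fibre X ht y).sup N : ℕ) : ℤ) ≤ WithZero.exp (-(N z : ℤ)) := by
    rw [WithZero.exp_le_exp, neg_le_neg_iff]
    exact_mod_cast Finset.le_sup hz
  refine hc ?_
  have h1 := ha y h
  have h2 := hN x _ ((hh x hy).trans (hle x hy))
  rw [if_pos rfl, map_sub (algebraMap _ _), mul_sub, map_sub, sub_eq_zero] at h2
  rw [fibrePairing_apply, Finset.sum_eq_single_of_mem x hy] at h1
  · rw [← h2, h1]
  · intro z hz hzx
    have h3 := hh z hz
    rw [if_neg hzx, sub_zero] at h3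
    exact hN z _ (h3.trans (hle z hz))

/-- The test c = r⁻¹ t⁻¹ gives the residues of dt / t over t = 0, whose sum is n ≠ 0. -/
theorem eq_zero_of_fibrePairing_diagonal_eq_zero {r : X.functionField}
    (hr : r ∈ IntermediateField.adjoin ℂ {t})
    (h : ∀ c ∈ IntermediateField.adjoin ℂ {t},
      fibrePairing X ht (some 0) (diagonal X r) c = 0) : r = 0 := by
  by_contra h0
  have h1 := sum_formResidue_polar_mul X ht (some 0) 0 0
  have h2 := h (r⁻¹ * (polar t (some 0) 0 * coord t (some 0) ^ (0 + shift (some 0))))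
    (mul_mem (inv_mem hr) (mul_mem
      (pow_mem (inv_mem (sub_mem (mem_adjoin_self X t) (algebraMap_mem _ 0))) _)
      (pow_mem (sub_mem (mem_adjoin_self X t) (algebraMap_mem _ 0)) _)))
  rw [fibrePairing_diagonal, mul_inv_cancel_left₀ h0, h1, if_pos rfl] at h2
  exact mul_ne_zero (coordSign_ne_zero _) (finrank_adjoin_ne_zero X ht) h2

theorem exists_diagonal_eq_of_orthogonal_D {a : Adele X}
    (ha : ∀ c, adelePairing X (D ℂ X.functionField t) a (diagonal X c) = 0) :
    ∃ g, diagonal X g = a := by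
  -- Orthogonality to all of K passes from a to ab, so each ab is represented on ℂ(t) by some r(b).
  have hex (b : X.functionField) := exists_fibrePairing_sub_eq_zero X ht
    (a := a * diagonal X b) fun c _ ↦ by rw [adelePairing_mul_diagonal, ha]
  choose r hr hr' using hex
  have h (b : X.functionField) (y : Option ℂ) {c : X.functionField}
      (hc : c ∈ IntermediateField.adjoin ℂ {t}) :
      fibrePairing X ht y (diagonal X (r b)) c = fibrePairing X ht y a (b * c) := by
    have := hr' b y c hc
    rwa [map_sub, LinearMap.sub_apply, fibrePairing_mul_diagonal, sub_eq_zero, eq_comm] at this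
  obtain ⟨_, _⟩ := finite_separable_adjoin X ht
  -- r(b) is determined by its pairings over the single fibre t = 0, which makes r linear over ℂ(t).
  have hadd (b b' : X.functionField) : r (b + b') = r b + r b' := by
    refine sub_eq_zero.mp (eq_zero_of_fibrePairing_diagonal_eq_zero X ht
      (sub_mem (hr _) (add_mem (hr b) (hr b'))) fun c hc ↦ ?_)
    rw [map_sub, map_sub, map_add, map_add, LinearMap.sub_apply, LinearMap.add_apply,
      h _ _ hc, h _ _ hc, h _ _ hc, add_mul, map_add, sub_self]
  have hmul (f : IntermediateField.adjoin ℂ {t}) (b : X.functionField) :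
      r (f * b) = f * r b := by
    refine sub_eq_zero.mp (eq_zero_of_fibrePairing_diagonal_eq_zero X ht
      (sub_mem (hr _) (mul_mem f.2 (hr b))) fun c hc ↦ ?_)
    have h1 : fibrePairing X ht (some 0) (diagonal X (f * r b)) c =
        fibrePairing X ht (some 0) (diagonal X (r b)) (f * c) := by
      rw [fibrePairing_diagonal, fibrePairing_diagonal]
      refine Finset.sum_congr rfl fun x _ ↦ ?_
      rw [mul_comm (f : X.functionField), mul_assoc]
    rw [map_sub, map_sub, LinearMap.sub_apply, h _ _ hc, h1, h _ _ (mul_mem f.2 hc),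
      mul_comm (f : X.functionField), mul_assoc, sub_self]
  let ρ : X.functionField →ₗ[IntermediateField.adjoin ℂ {t}] IntermediateField.adjoin ℂ {t} :=
    { toFun := fun b ↦ ⟨r b, hr b⟩
      map_add' := fun b b' ↦ Subtype.ext (hadd b b')
      map_smul' := fun f b ↦ Subtype.ext (hmul f b) }
  let B := Algebra.traceForm (IntermediateField.adjoin ℂ {t}) X.functionField
  have hB : B.Nondegenerate := traceForm_nondegenerate _ _
  let n := Module.finrank (IntermediateField.adjoin ℂ {t}) X.functionField
  -- The factor n matches the trace formula: on each fibre, n times the residues of g b dt add up to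
  -- those of tr(g b) dt = n r(b) dt.
  let g := (n : ℂ) • (B.toDual hB).symm ρ
  have htr (b : X.functionField) : traceTo X t (g * b) = (n : ℂ) • r b := by
    rw [smul_mul_assoc, LinearMap.map_smul (traceTo X t), traceTo_apply]
    exact congrArg (fun z : IntermediateField.adjoin ℂ {t} ↦ (n : ℂ) • (z : X.functionField))
      (LinearMap.BilinForm.apply_toDual_symm_apply (hB := hB) ρ b)
  have hn : (n : ℂ) ≠ 0 := finrank_adjoin_ne_zero X ht
  refine ⟨g, (sub_eq_zero.mp (eq_zero_of_fibrePairing_eq_zero X ht fun y b ↦ ?_)).symm⟩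
  rw [map_sub, LinearMap.sub_apply, sub_eq_zero]
  have h1 := sum_fibre_traceTo X ht y (g * b)
  rw [htr, ← fibrePairing_diagonal X ht y g b] at h1
  have h2 := h b y (one_mem _)
  rw [mul_one, fibrePairing_diagonal, mul_one] at h2
  refine mul_left_cancel₀ hn (Eq.trans ?_ h1)
  rw [← h2, Finset.mul_sum]
  refine Finset.sum_congr rfl fun x _ ↦ ?_
  rw [smul_assoc, LinearMap.map_smul (formResidue X x), smul_eq_mul]

end

theorem exists_diagonal_eq_of_orthogonal {ω : Ω[X.functionField⁄ℂ]} (hω : ω ≠ 0) {a : Adele X}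
    (ha : ∀ c, adelePairing X ω a (diagonal X c) = 0) : ∃ g, diagonal X g = a := by
  obtain ⟨t, ht⟩ := exists_D_ne_zero X
  obtain ⟨f, rfl⟩ := Submodule.mem_span_singleton.mp (span_D_eq_top X ht ▸ trivial :
    ω ∈ Submodule.span X.functionField {D ℂ X.functionField t})
  have hf : f ≠ 0 := (smul_ne_zero_iff.mp hω).1
  refine exists_diagonal_eq_of_orthogonal_D X ht fun c ↦ ?_
  -- Pairing with c against dt is pairing with f⁻¹ c against ω = f dt.
  rw [← mul_inv_cancel_left₀ hf c, ← ha (f⁻¹ * c), adelePairing_apply, adelePairing_apply]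
  refine finsum_congr fun x ↦ ?_
  rw [residue_smul_form, diagonal_apply, diagonal_apply, map_mul (algebraMap _ _) f, mul_assoc,
    mul_comm (algebraMap _ _ f)]

/-- A subspace which is its own orthogonal is Lagrangian. -/
theorem isLagrangian_of_orthogonal_eq {V : Type*} [AddCommGroup V] [Module ℂ V]
    {B : LinearMap.BilinForm ℂ V} {L : Submodule ℂ V} (h : B.orthogonal L = L) :
    IsLagrangian B L := by
  refine ⟨⟨fun u hu v hv ↦ ?_, fun M hM hLM v hv ↦ ?_⟩, h⟩
  · rw [← h] at hv
    exact hv u hu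
  · rw [← h]
    exact fun u hu ↦ hM u (hLM hu) v hv

theorem adelePairing_comm (ω : Ω[X.functionField⁄ℂ]) (a b : Adele X) :
    adelePairing X ω a b = adelePairing X ω b a := by
  rw [adelePairing_apply, adelePairing_apply]
  exact finsum_congr fun x ↦ by rw [mul_comm]

theorem isLagrangian_range_diagonal {ω : Ω[X.functionField⁄ℂ]} (hω : ω ≠ 0) :
    IsLagrangian (adelePairing X ω) (LinearMap.range (diagonal X)) := by
  refine isLagrangian_of_orthogonal_eq (le_antisymm (fun a ha ↦ ?_) ?_)
  · refine exists_diagonal_eq_of_orthogonal X hω fun c ↦ ?_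
    rw [adelePairing_comm]
    exact ha _ ⟨c, rfl⟩
  · rintro _ ⟨f, rfl⟩ _ ⟨g, rfl⟩
    exact adelePairing_diagonal X ω g f

/-! ### Local duality -/

theorem exists_limit (x : Point X) (P : ℕ → LocalField X x)
    (hP : ∀ N M, N ≤ M → Valued.v (P M - P N) ≤ WithZero.exp (-N : ℤ)) :
    ∃ h : LocalField X x, ∀ N, Valued.v (h - P N) ≤ WithZero.exp (-N : ℤ) := by
  obtain ⟨s, hs⟩ := IsDiscreteValuationRing.exists_irreducible (X.presheaf.stalk x.1)
  have hτ (N : ℕ) : Valued.v (algebraMap (X.presheaf.stalk x.1) (LocalField X x) s ^ N) =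
      WithZero.exp (-N : ℤ) := by
    rw [map_pow, valued_parameter X x hs, ← WithZero.exp_nsmul]
    simp
  have hcauchy : CauchySeq P := by
    refine Valued.cauchy_iff.mpr ⟨inferInstance, fun γ ↦ ?_⟩
    set γ' := MonoidWithZeroHom.ValueGroup₀.embedding γ.1
    have hγ : γ' ≠ 0 := by simp [γ']
    obtain ⟨N, hN⟩ : ∃ N : ℕ, WithZero.exp (-N : ℤ) < γ' := by
      refine ⟨(-WithZero.log γ' + 1).toNat, ?_⟩
      rw [← WithZero.exp_log hγ, WithZero.exp_lt_exp]
      simp only [WithZero.log_exp]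
      omega
    refine ⟨P '' Set.Ici N, Filter.image_mem_map (Filter.mem_atTop N), ?_⟩
    rintro _ ⟨m, hm, rfl⟩ _ ⟨k, hk, rfl⟩
    rw [Valuation.restrict_lt_iff_lt_embedding]
    refine lt_of_le_of_lt ?_ hN
    have := Valuation.map_sub_le _ (hP N k hk) (hP N m hm)
    rwa [sub_sub_sub_cancel_right] at this
  obtain ⟨h, hh⟩ := cauchySeq_tendsto_of_complete hcauchy
  refine ⟨h, fun N ↦ ?_⟩
  have hcl : IsClosed {z : LocalField X x | Valued.v (z - P N) ≤ WithZero.exp (-N : ℤ)} := by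
    have h1 := (Valued.isClosed_closedBall (LocalField X x) (Valuation.restrict _
      (algebraMap (X.presheaf.stalk x.1) (LocalField X x) s ^ N))).preimage
        (continuous_id.sub continuous_const : Continuous fun z ↦ z - P N)
    convert! h1 using 1
    ext z
    rw [← hτ N]
    exact (Valuation.restrict_le_iff (v := (Valued.v : Valuation (LocalField X x) _))).symm
  refine hcl.mem_of_tendsto hh ?_
  filter_upwards [Filter.mem_atTop N] with M hM
  exact hP N M hM

theorem residue_differential_zpow (x : Point X) {s : X.presheaf.stalk x.1} (hs : Irreducible s)
    (k : ℤ) : residue X x (differential X x s)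
      (algebraMap (X.presheaf.stalk x.1) (LocalField X x) s ^ k) = if k = -1 then 1 else 0 := by
  rw [← one_smul X.functionField (differential X x s),
    residue_eq_of_laurentSum X x hs 1 _ (Finsupp.single k 1), Finsupp.single_apply]
  rw [laurentSum_single, one_smul, map_one, mul_one, sub_self]
  exact zero_mem _

/-- Every linear form on the local field which vanishes on the integers is given by residues. -/
theorem exists_residue_eq (x : Point X) {s : X.presheaf.stalk x.1} (hs : Irreducible s)
    (l : LocalField X x →ₗ[ℂ] ℂ) (hl : ∀ z ∈ localIntegers X x, l z = 0) :
    ∃ h ∈ localIntegers X x, ∀ z, l z = residue X x (differential X x s) (h * z) := by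
  have hs1 : pointValuation X x (algebraMap (X.presheaf.stalk x.1) X.functionField s) ≤ 1 :=
    pointValuation_algebraMap_le_one X x s
  have hres {z : LocalField X x} (hz : z ∈ localIntegers X x) :
      residue X x (differential X x s) z = 0 := residue_eq_zero_of_integral X x hs1 hz
  have hrz := residue_differential_zpow X x hs
  have hτ : Valued.v (algebraMap (X.presheaf.stalk x.1) (LocalField X x) s) =
    WithZero.exp (-1 : ℤ) := valued_parameter X x hs
  have hlaurent := exists_laurentSum X x hs
  set τ := algebraMap (X.presheaf.stalk x.1) (LocalField X x) s
  have hτ0 : τ ≠ 0 := by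
    rw [← Valuation.ne_zero_iff Valued.v, hτ]
    exact WithZero.exp_ne_zero
  have hτz (k : ℤ) : Valued.v (τ ^ k) = WithZero.exp (-k) := by
    rw [map_zpow₀, hτ, ← WithZero.exp_zsmul]
    simp
  -- The residue pairing of τᵐ with τ^(-m - 1) is 1, so the coefficients of h are forced: h = ∑
  -- l(τ^(-m - 1)) τᵐ, obtained as a limit by completeness.
  let P (N : ℕ) : LocalField X x := ∑ m ∈ Finset.range N, l (τ ^ (-(m : ℤ) - 1)) • τ ^ (m : ℤ)
  obtain ⟨h, hh⟩ := exists_limit X x P fun N M hNM ↦ by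
    rw [← Finset.sum_Ico_eq_sub _ hNM]
    refine Valuation.map_sum_le _ fun m hm ↦ ?_
    rw [Algebra.smul_def, map_mul, hτz]
    calc _ ≤ 1 * WithZero.exp (-(m : ℤ)) :=
          mul_le_mul_left ((mem_localIntegers_iff X x _).mp (algebraMap_mem _ _)) _
      _ ≤ _ := by
        rw [one_mul, WithZero.exp_le_exp]
        have := (Finset.mem_Ico.mp hm).1
        omega
  have hint : h ∈ localIntegers X x := by
    have := hh 0
    simpa [P, mem_localIntegers_iff] using this
  refine ⟨h, hint, fun z ↦ ?_⟩
  have hpow (k : ℤ) : l (τ ^ k) = residue X x (differential X x s) (h * τ ^ k) := by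
    by_cases hk : 0 ≤ k
    · have hk' : τ ^ k ∈ localIntegers X x := by
        rw [mem_localIntegers_iff, hτz, ← WithZero.exp_zero, WithZero.exp_le_exp]
        omega
      rw [hl _ hk', hres (mul_mem hint hk')]
    · obtain ⟨m, rfl⟩ : ∃ m : ℕ, k = -(m : ℤ) - 1 := ⟨(-k - 1).toNat, by omega⟩
      -- Terms of h from degree m + 1 on contribute no residue against τ^(-m - 1), and among the
      -- first m + 1 only degree m does.
      have h1 : (h - P (m + 1)) * τ ^ (-(m : ℤ) - 1) ∈ localIntegers X x := by
        rw [mem_localIntegers_iff, map_mul, hτz]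
        calc _ ≤ WithZero.exp (-(m + 1 : ℕ) : ℤ) * WithZero.exp (-(-(m : ℤ) - 1)) :=
              mul_le_mul_left (hh (m + 1)) _
          _ = 1 := by
            rw [← WithZero.exp_add, ← WithZero.exp_zero]
            congr 1
            push_cast
            ring
          _ ≤ 1 := le_rfl
      have h2 := hres h1
      rw [sub_mul, map_sub, sub_eq_zero] at h2
      rw [h2, Finset.sum_mul, map_sum]
      have h3 (i : ℕ) : residue X x (differential X x s)
          (l (τ ^ (-(i : ℤ) - 1)) • τ ^ (i : ℤ) * τ ^ (-(m : ℤ) - 1)) =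
            if i = m then l (τ ^ (-(m : ℤ) - 1)) else 0 := by
        rw [smul_mul_assoc, map_smul, ← zpow_add₀ hτ0, hrz, smul_eq_mul, mul_ite, mul_one, mul_zero]
        by_cases him : i = m
        · rw [if_pos him, if_pos (by omega), him]
        · rw [if_neg him, if_neg (by omega)]
      rw [Finset.sum_congr rfl fun i _ ↦ h3 i, Finset.sum_ite_eq', if_pos (by simp)]
  -- Both sides vanish on the integers, so z may be replaced by its Laurent polynomial.
  obtain ⟨a, ha⟩ := hlaurent z
  have h1 : l z = l (laurentSum τ a) := by
    rw [← sub_eq_zero, ← map_sub, hl _ ha]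
  have h2 : residue X x (differential X x s) (h * z) =
      residue X x (differential X x s) (h * laurentSum τ a) := by
    rw [← sub_eq_zero, ← map_sub, ← mul_sub, hres (mul_mem hint ha)]
  rw [h1, h2, laurentSum, Finsupp.linearCombination_apply, Finsupp.sum, Finset.mul_sum, map_sum,
    map_sum]
  refine Finset.sum_congr rfl fun k _ ↦ ?_
  rw [mul_smul_comm, map_smul, map_smul, hpow]

section
variable {ω : Ω[X.functionField⁄ℂ]} {S : Finset (Point X)}
  (hS : ∀ x : Point X, HasZeroAt X ω x ∨ HasPoleAt X ω x → x ∈ S)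
include hS

/-- Neither a zero nor a pole is possible outside S, so the coefficient of ω there is a unit. -/
theorem exists_eq_unit_smul_differential {x : Point X} (hx : x ∉ S) :
    ∃ (s : X.presheaf.stalk x.1) (h : X.functionField), Irreducible s ∧
      pointValuation X x h = 1 ∧ ω = h • differential X x s := by
  obtain ⟨s, hs⟩ := IsDiscreteValuationRing.exists_irreducible (X.presheaf.stalk x.1)
  obtain ⟨h, hh⟩ := exists_eq_smul_differential X x hs ω
  have h1 : h ∈ (algebraMap (X.presheaf.stalk x.1) X.functionField).range := by
    by_contra h1
    exact hx (hS x (.inr ⟨s, h, hs, h1, hh⟩))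
  obtain ⟨a, rfl⟩ := h1
  refine ⟨s, _, hs, le_antisymm (pointValuation_algebraMap_le_one X x a) ?_, hh⟩
  by_contra h2
  exact hx (hS x (.inl ⟨s, a, hs,
    (pointValuation_algebraMap_lt_one_iff X x a).mp (not_le.mp h2), hh⟩))

theorem residue_eq_zero_of_notMem {x : Point X} (hx : x ∉ S) {f : LocalField X x}
    (hf : f ∈ localIntegers X x) : residue X x ω f = 0 := by
  obtain ⟨s, h, hs, hh, rfl⟩ := exists_eq_unit_smul_differential X hS hx
  rw [residue_smul_form]
  exact residue_eq_zero_of_integral X x (pointValuation_algebraMap_le_one X x s)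
    (mul_mem hf (algebraMap_mem_localIntegers X x hh.le))

theorem exists_residue_form_eq {x : Point X} (hx : x ∉ S)
    (l : LocalField X x →ₗ[ℂ] ℂ) (hl : ∀ z ∈ localIntegers X x, l z = 0) :
    ∃ h ∈ localIntegers X x, ∀ z, l z = residue X x ω (h * z) := by
  obtain ⟨s, h₀, hs, hh, rfl⟩ := exists_eq_unit_smul_differential X hS hx
  obtain ⟨h, hint, hz⟩ := exists_residue_eq X x hs l hl
  have h0 : h₀ ≠ 0 := by
    rw [← Valuation.ne_zero_iff (pointValuation X x), hh]
    exact one_ne_zero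
  refine ⟨h * algebraMap X.functionField _ h₀⁻¹, mul_mem hint
    (algebraMap_mem_localIntegers X x (by rw [map_inv₀, hh, inv_one])), fun z ↦ ?_⟩
  rw [residue_smul_form, hz, map_inv₀, mul_right_comm,
    inv_mul_cancel_right₀ ((map_ne_zero _).mpr h0)]

end

/-! ### Functions regular outside S -/

section
open Classical in
/-- The adele with a single nonzero component. -/
def singleAdele (x : Point X) : LocalField X x →ₗ[ℂ] Adele X where
  toFun z := RestrictedProduct.single _ x z
  map_add' z w := RestrictedProduct.single_add _ x z w
  map_smul' c z := RestrictedProduct.ext _ _ fun y ↦ by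
    by_cases h : y = x
    · subst h
      simp
    · simp [h]

theorem singleAdele_same (x : Point X) (z : LocalField X x) : singleAdele X x z x = z := by
  classical exact Pi.single_eq_same x z

theorem singleAdele_of_ne {x y : Point X} (h : y ≠ x) (z : LocalField X x) :
    singleAdele X x z y = 0 := by
  classical exact Pi.single_eq_of_ne h z

/-- The adeles which are integral outside `S`. -/
def integralOutside (S : Finset (Point X)) : Submodule ℂ (Adele X) where
  carrier := {a | ∀ x ∉ S, a x ∈ localIntegers X x}
  add_mem' ha hb x hx := add_mem (ha x hx) (hb x hx)
  zero_mem' _ _ := zero_mem _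
  smul_mem' c _ ha x hx := Subalgebra.smul_mem _ (ha x hx) c

theorem diagonal_mem_integralOutside {S : Finset (Point X)} {g : X.functionField} :
    diagonal X g ∈ integralOutside X S ↔ g ∈ regularOutside X S :=
  forall₂_congr fun x _ ↦ algebraMap_mem_localIntegers_iff X x g

theorem localPairing_apply (ω : Ω[X.functionField⁄ℂ]) (S : Finset (Point X))
    (f g : LocalProduct X S) : localPairing X ω S f g = ∑ s : S, residue X s.1 ω (f s * g s) := rfl

variable {ω : Ω[X.functionField⁄ℂ]} {S : Finset (Point X)}
  (hS : ∀ x : Point X, HasZeroAt X ω x ∨ HasPoleAt X ω x → x ∈ S)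
include hS

/-- Outside S the form f g ω is regular, so the pairing is the full sum of residues, which is zero.
-/
theorem localPairing_toLocalProduct {f g : X.functionField} (hf : f ∈ regularOutside X S)
    (hg : g ∈ regularOutside X S) :
    localPairing X ω S (toLocalProduct X S f) (toLocalProduct X S g) = 0 := by
  rw [← finsum_formResidue X ((f * g) • ω), localPairing_apply,
    finsum_eq_sum_of_support_subset (s := S)]
  · rw [← Finset.sum_coe_sort S]
    refine Finset.sum_congr rfl fun s _ ↦ ?_
    rw [formResidue_smul, map_mul (algebraMap _ _)]
    rfl
  · intro x hx
    by_contra h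
    refine hx ?_
    change formResidue X x ((f * g) • ω) = 0
    rw [formResidue_smul]
    exact residue_eq_zero_of_notMem X hS h
      ((algebraMap_mem_localIntegers_iff X x _).mpr (mul_mem (hf x h) (hg x h)))

theorem exists_toLocalProduct_eq (hω : ω ≠ 0) {f : LocalProduct X S}
    (hf : ∀ g ∈ regularOutside X S, localPairing X ω S f (toLocalProduct X S g) = 0) :
    ∃ g ∈ regularOutside X S, toLocalProduct X S g = f := by
  classical
  let φ : X.functionField →ₗ[ℂ] ℂ :=
    (localPairing X ω S f) ∘ₗ (toLocalProduct X S).toLinearMap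
  let j : X.functionField →ₗ[ℂ] Adele X ⧸ integralOutside X S :=
    (integralOutside X S).mkQ ∘ₗ diagonal X
  -- The kernel of j is R, on which φ vanishes by orthogonality. A linear form on K that kills the
  -- kernel of j extends along j to the whole quotient.
  have hφ : φ ∈ LinearMap.range j.dualMap := by
    rw [LinearMap.range_dualMap_eq_dualAnnihilator_ker, Submodule.mem_dualAnnihilator]
    intro g hg
    refine hf g (diagonal_mem_integralOutside X |>.mp ?_)
    exact (Submodule.Quotient.mk_eq_zero _).mp hg
  obtain ⟨θ', hθ'⟩ := hφ
  let θ : Adele X →ₗ[ℂ] ℂ := θ' ∘ₗ (integralOutside X S).mkQ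
  have hθφ (g : X.functionField) : θ (diagonal X g) = φ g := LinearMap.congr_fun hθ' g
  have hθ (a : Adele X) (ha : a ∈ integralOutside X S) : θ a = 0 := by
    change θ' (Submodule.Quotient.mk a) = 0
    rw [(Submodule.Quotient.mk_eq_zero _).mpr ha, map_zero]
  have hex (x : Point X) : ∃ h : LocalField X x, x ∉ S → h ∈ localIntegers X x ∧
      ∀ z, θ (singleAdele X x z) = residue X x ω (h * z) := by
    by_cases hx : x ∈ S
    · exact ⟨0, fun h ↦ absurd hx h⟩
    · have hl (z : LocalField X x) (hz : z ∈ localIntegers X x) :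
          (θ ∘ₗ singleAdele X x) z = 0 := by
        refine hθ _ fun y _ ↦ ?_
        by_cases hyx : y = x
        · subst hyx
          rwa [singleAdele_same]
        · rw [singleAdele_of_ne X hyx]
          exact zero_mem _
      obtain ⟨h, hh⟩ := exists_residue_form_eq X hS hx (θ ∘ₗ singleAdele X x) hl
      exact ⟨h, fun _ ↦ hh⟩
  choose h hh using hex
  -- On S the sign is reversed so that the two contributions to ⟨a, c⟩ are -φ(c) from S and θ(c) =
  -- φ(c) from outside.
  let a : Adele X := ⟨fun x ↦ if hx : x ∈ S then -f ⟨x, hx⟩ else h x, by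
    have : ∀ᶠ x : Point X in Filter.cofinite, x ∉ S := S.finite_toSet.eventually_cofinite_notMem
    filter_upwards [this] with x hx
    rw [dif_neg hx]
    exact (hh x hx).1⟩
  have haS (s : S) : a s.1 = -f s := dif_pos s.2
  have ha (x : Point X) (hx : x ∉ S) : a x = h x := dif_neg hx
  obtain ⟨g, hg⟩ := exists_diagonal_eq_of_orthogonal X hω (a := a) fun c ↦ by
    have hfin : {x | algebraMap X.functionField (LocalField X x) c ∉ localIntegers X x}.Finite :=
      eventually_mem_localIntegers X c
    -- E is the set of poles of c outside S. As θ kills adeles integral outside S, only the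
    -- components of c at E matter, and θ(c) is a finite sum of residues.
    set E : Finset (Point X) := hfin.toFinset \ S
    have hE {x : Point X} (hx : x ∉ S) (hxE : x ∉ E) :
        algebraMap X.functionField (LocalField X x) c ∈ localIntegers X x := by
      by_contra h1
      exact hxE (Finset.mem_sdiff.mpr ⟨hfin.mem_toFinset.mpr h1, hx⟩)
    have hES {x : Point X} (hx : x ∈ E) : x ∉ S := (Finset.mem_sdiff.mp hx).2
    have h1 : θ (diagonal X c) = ∑ x ∈ E, residue X x ω (a x * diagonal X c x) := by
      have h2 : diagonal X c - ∑ x ∈ E, singleAdele X x (algebraMap _ _ c) ∈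
          integralOutside X S := by
        intro y hy
        have h3 : (∑ x ∈ E, singleAdele X x (algebraMap X.functionField _ c)) y =
            ∑ x ∈ E, singleAdele X x (algebraMap X.functionField _ c) y :=
          map_sum (RestrictedProduct.evalAddMonoidHom _ y) _ _
        rw [RestrictedProduct.sub_apply, h3]
        by_cases hyE : y ∈ E
        · rw [Finset.sum_eq_single_of_mem y hyE fun x _ hxy ↦
            singleAdele_of_ne X (Ne.symm hxy) _, singleAdele_same, diagonal_apply, sub_self]
          exact zero_mem _
        · rw [Finset.sum_eq_zero fun x hx ↦ singleAdele_of_ne X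
            (fun hxy ↦ hyE (by rwa [hxy])) _, sub_zero]
          exact hE hy hyE
      have h4 := hθ _ h2
      rw [map_sub, sub_eq_zero, map_sum] at h4
      rw [h4]
      refine Finset.sum_congr rfl fun x hx ↦ ?_
      rw [(hh x (hES hx)).2, ha x (hES hx)]
      rfl
    have h5 : ∑ x ∈ S, residue X x ω (a x * diagonal X c x) = -φ c := by
      rw [← Finset.sum_coe_sort S]
      change _ = -∑ s : S, residue X s.1 ω (f s * algebraMap _ _ c)
      rw [← Finset.sum_neg_distrib]
      refine Finset.sum_congr rfl fun s _ ↦ ?_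
      rw [haS, neg_mul, map_neg]
      rfl
    have hdisj : Disjoint S E := Finset.disjoint_sdiff
    rw [adelePairing_apply, finsum_eq_sum_of_support_subset (s := S ∪ E),
      Finset.sum_union hdisj, h5, ← h1, hθφ, neg_add_cancel]
    intro x hx
    by_contra hx'
    rw [Finset.mem_coe, Finset.mem_union, not_or] at hx'
    refine hx (residue_eq_zero_of_notMem X hS hx'.1 (mul_mem ?_ (hE hx'.1 hx'.2)))
    rw [ha x hx'.1]
    exact (hh x hx'.1).1
  have hreg : g ∈ regularOutside X S := by
    rw [← diagonal_mem_integralOutside, hg]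
    intro x hx
    rw [ha x hx]
    exact (hh x hx).1
  refine ⟨-g, neg_mem hreg, funext fun s ↦ ?_⟩
  rw [map_neg, Pi.neg_apply, neg_eq_iff_eq_neg, ← haS, ← hg]
  rfl

theorem isLagrangian_regularOutside (hω : ω ≠ 0) : IsLagrangian (localPairing X ω S)
    ((Subalgebra.toSubmodule (regularOutside X S)).map (toLocalProduct X S).toLinearMap) := by
  have hcomm (f g : LocalProduct X S) : localPairing X ω S f g = localPairing X ω S g f := by
    rw [localPairing_apply, localPairing_apply]
    exact Finset.sum_congr rfl fun s _ ↦ by rw [mul_comm]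
  refine isLagrangian_of_orthogonal_eq (le_antisymm (fun f hf ↦ ?_) ?_)
  · obtain ⟨g, hg, rfl⟩ := exists_toLocalProduct_eq X hS hω (f := f) fun g hg ↦ by
      rw [hcomm]
      exact hf _ ⟨g, hg, rfl⟩
    exact ⟨g, hg, rfl⟩
  · rintro _ ⟨f, hf, rfl⟩ _ ⟨g, hg, rfl⟩
    exact localPairing_toLocalProduct X hS hg hf

end

end ResiduePairing

end

theorem mainTheorem12 (X : Scheme.{0}) [X.Over (Spec (CommRingCat.of ℂ))]
    [IsSmoothCompleteCurve X] (ω : Ω[X.functionField⁄ℂ]) (hω : ω ≠ 0) :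
    (∀ S : Finset (Point X), (∀ x : Point X, HasZeroAt X ω x ∨ HasPoleAt X ω x → x ∈ S) →
      IsLagrangian (localPairing X ω S)
        ((Subalgebra.toSubmodule (regularOutside X S)).map (toLocalProduct X S).toLinearMap)) ∧
    IsLagrangian (adelePairing X ω) (LinearMap.range (diagonal X)) := by
  exact ⟨fun S hS ↦ isLagrangian_regularOutside X hS hω, isLagrangian_range_diagonal X hω⟩
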